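/- **Theorem 7.2 (Markov theorem for welded links).** For $m\ge 1$, a *welded braid diagram of degree $m$* is a word in letters $\sigma_i$ (positive crossing), $\sigma_i^{-1}$ (negative crossing), $\tau_i$ (virtual crossing), $1\le i\le m-1$, each letter standing for a crossing of the strands in positions $i$ and $i+1$; strands run from top to bottom and the first letter is on top. The *welded braid group* $WB_m$ is the group with generators $\sigma_i,\tau_i$ ($1\le i\le m-1$) and defining relations $$\sigma_i\sigma_j=\sigma_j\sigma_i,\quad \tau_i\tau_j=\tau_j\tau_i,\quad \sigma_i\tau_j=\tau_j\sigma_i\qquad(|i-j|>1),$$ $$\sigma_i\sigma_{i+1}\sigma_i=\sigma_{i+1}\sigma_i\sigma_{i+1},\qquad \tau_i\tau_{i+1}\tau_i=\tau_{i+1}\tau_i\tau_{i+1},\qquad \tau_i^2=1,$$ $$\sigma_i\tau_{i+1}\tau_i=\tau_{i+1}\tau_i\sigma_{i+1},\qquad \tau_i\sigma_{i+1}\sigma_i=\sigma_{i+1}\sigma_i\tau_{i+1}$$ (on the level of diagrams also $\sigma_i\sigma_i^{-1}=\sigma_i^{-1}\sigma_i=1$). Its elements are the *welded braids* of degree $m$.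 Let $\iota_0^1: WB_m\to WB_{m+1}$ be the homomorphism $\sigma_i\mapsto\sigma_i$, $\tau_i\mapsto\tau_i$, which adds a trivial strand on the right. A *welded link diagram* is a closed oriented $1$-manifold immersed in $\mathbb R^2$ whose singularities are transverse double points, each marked as a positive, negative (real) or virtual crossing, considered up to isotopy of $\mathbb R^2$. Two welded link diagrams are *equivalent as welded links* if they are related by a finite sequence of the following local moves and their inverses, with all orientations of the strands: the Reidemeister moves RI, RII, RIII on real crossings; the same three moves with all crossings virtual (VI, VII, VIII); the mixed move MI, in which a strand having only virtual crossings passes a real crossing of two other strands; and the W-move, in which a strand passing over two other strands at real crossings passes a virtual crossing of these two strands. The closure of a welded braid diagram is the welded link diagram obtained by joining the bottom of each strand to the top in the same position by parallel arcs without further crossings. Let $b$ and $b'$ be welded braids, possibly of different degrees, and let $w$, $w'$ be any welded braid diagrams representing them. 1. The closures of $w$ and $w'$ are equivalent as welded links if and only if $b$ and $b'$ are related by a finite sequence of the moves * (WM1) conjugation $b\mapsto c^{-1}bc$ with $b,c\in WB_m$, * (WM2) right stabilization of positive, negative or virtual type, $b\mapsto\iota_0^1(b)\sigma_m$, $\iota_0^1(b)\sigma_m^{-1}$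 or $\iota_0^1(b)\tau_m\in WB_{m+1}$ for $b\in WB_m$, and its inverse operation. 2. The closures of $w$ and $w'$ are equivalent as welded links if and only if the diagrams $w$ and $w'$ are related by a finite sequence of the moves (WM0), (WM1), (WM2) on diagrams, where (WM0) replaces one side of a defining relation of $WB_m$ (including $\sigma_i\sigma_i^{-1}=\sigma_i^{-1}\sigma_i=1$) by the other inside a diagram, and (WM1), (WM2) are conjugation and right stabilization (and its inverse) of words. -/

import Mathlib

/-!
# Welded braids, welded link diagrams, closures and Markov moves

Conventions.  Everything is drawn in the plane and read from top to bottom; strand positions are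
counted from left to right, starting from `0`.  Braid strands are oriented downwards.

A welded (= virtual) link diagram in the plane is put in general position with respect to the height
function: finitely many local maxima, local minima and crossings, at pairwise different heights.
Such a diagram is recorded by the list of these events, each together with its horizontal position.
Two generic plane diagrams are isotopic in the plane exactly when the lists are related by the moves
`PlanarIsotopy` below (exchange of the heights of two events, creation or cancellation of a pair of a
maximum and a minimum, rotation of a crossing past a maximum or a minimum).
-/

namespace Welded

/-! ## Welded braid diagrams and the welded braid group -/

/-- The crossings that a braid diagram on `n + 1` strands may have; the index `i` (with `0 ≤ i < n`)
stands for a crossing of the strands at the positions `i` and `i + 1`.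
`sigma` is a positive, `sigmaInv` a negative and `tau` a virtual crossing. -/
inductive Letter (n : ℕ) : Type
  | sigma (i : Fin n)
  | sigmaInv (i : Fin n)
  | tau (i : Fin n)

/-- A welded braid diagram of degree `n + 1`.  Its crossings lie at pairwise different heights, so
it is a word in the letters; the product of diagrams (first factor on top) is `++`. -/
abbrev BraidDiagram (n : ℕ) : Type := List (Letter n)

namespace Letter

/-- The inverse letter. -/
def inv {n : ℕ} : Letter n → Letter n
  | sigma i => sigmaInv i
  | sigmaInv i => sigma i
  | tau i => tau i

/-- The same crossing after a trivial strand has been added to the right of the diagram. -/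
def addRight {n : ℕ} : Letter n → Letter (n + 1)
  | sigma i => sigma i.castSucc
  | sigmaInv i => sigmaInv i.castSucc
  | tau i => tau i.castSucc

end Letter

/-- The inverse of a braid diagram: the inverse letters in the opposite order. -/
def BraidDiagram.inv {n : ℕ} (w : BraidDiagram n) : BraidDiagram n :=
  (w.map Letter.inv).reverse

/-- `ι_0^1` on diagrams: a trivial strand is added on the right. -/
def BraidDiagram.addRight {n : ℕ} (w : BraidDiagram n) : BraidDiagram (n + 1) :=
  w.map Letter.addRight

open Letter in
/-- The defining relations of the welded braid group of degree `n + 1`. -/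
inductive BraidRelation (n : ℕ) : BraidDiagram n → BraidDiagram n → Prop
  -- trivial relations
  | sigma_sigmaInv (i : Fin n) : BraidRelation n [sigma i, sigmaInv i] []
  | sigmaInv_sigma (i : Fin n) : BraidRelation n [sigmaInv i, sigma i] []
  -- braid relations
  | sigma_comm (i j : Fin n) (h : (i : ℕ) + 1 < j ∨ (j : ℕ) + 1 < i) :
      BraidRelation n [sigma i, sigma j] [sigma j, sigma i]
  | sigma_braid (i j : Fin n) (h : (j : ℕ) = i + 1) :
      BraidRelation n [sigma i, sigma j, sigma i] [sigma j, sigma i, sigma j]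
  -- permutation group relations
  | tau_tau (i : Fin n) : BraidRelation n [tau i, tau i] []
  | tau_comm (i j : Fin n) (h : (i : ℕ) + 1 < j ∨ (j : ℕ) + 1 < i) :
      BraidRelation n [tau i, tau j] [tau j, tau i]
  | tau_braid (i j : Fin n) (h : (j : ℕ) = i + 1) :
      BraidRelation n [tau i, tau j, tau i] [tau j, tau i, tau j]
  -- mixed relations
  | mixed_comm (i j : Fin n) (h : (i : ℕ) + 1 < j ∨ (j : ℕ) + 1 < i) :
      BraidRelation n [sigma i, tau j] [tau j, sigma i]
  | mixed_braid (i j : Fin n) (h : (j : ℕ) = i + 1) :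
      BraidRelation n [sigma i, tau j, tau i] [tau j, tau i, sigma j]
  -- welded relations
  | welded (i j : Fin n) (h : (j : ℕ) = i + 1) :
      BraidRelation n [tau i, sigma j, sigma i] [sigma j, sigma i, tau j]

/-- The generators `σ_i` and `τ_i` of the welded braid group of degree `n + 1`. -/
inductive Generator (n : ℕ) : Type
  | sigma (i : Fin n)
  | tau (i : Fin n)

/-- The element of the free group on the generators given by a letter. -/
def Letter.toFree {n : ℕ} : Letter n → FreeGroup (Generator n)
  | sigma i => FreeGroup.of (Generator.sigma i)
  | sigmaInv i => (FreeGroup.of (Generator.sigma i))⁻¹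
  | tau i => FreeGroup.of (Generator.tau i)

/-- The element of the free group on the generators given by a braid diagram. -/
def BraidDiagram.toFree {n : ℕ} (w : BraidDiagram n) : FreeGroup (Generator n) :=
  (w.map Letter.toFree).prod

/-- The relators of the welded braid group. -/
def relators (n : ℕ) : Set (FreeGroup (Generator n)) :=
  {g | ∃ l r : BraidDiagram n, BraidRelation n l r ∧ g = l.toFree * r.toFree⁻¹}

/-- The welded braid group `WB_{n+1}` of degree `n + 1` (so all positive degrees occur). -/
abbrev WeldedBraid (n : ℕ) : Type := PresentedGroup (relators n)

/-- The positive generator; `σ i` crosses the strands at the positions `i` and `i + 1`. -/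
def WeldedBraid.sigma {n : ℕ} (i : Fin n) : WeldedBraid n := PresentedGroup.of (Generator.sigma i)

/-- The virtual generator; `τ i` crosses the strands at the positions `i` and `i + 1`. -/
def WeldedBraid.tau {n : ℕ} (i : Fin n) : WeldedBraid n := PresentedGroup.of (Generator.tau i)

/-- The welded braid represented by a braid diagram. -/
def BraidDiagram.toBraid {n : ℕ} (w : BraidDiagram n) : WeldedBraid n :=
  PresentedGroup.mk (relators n) w.toFree

/-- Adding a trivial strand on the right preserves the defining relations. -/
theorem BraidRelation.addRight {n : ℕ} {l r : BraidDiagram n} (h : BraidRelation n l r) :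
    BraidRelation (n + 1) l.addRight r.addRight := by
  cases h <;> simp only [BraidDiagram.addRight, List.map, Letter.addRight] <;>
    constructor <;> simpa using by assumption

/-- The images of the generators of degree `n + 1` in degree `n + 2`. -/
def Generator.addRight {n : ℕ} : Generator n → WeldedBraid (n + 1)
  | sigma i => WeldedBraid.sigma i.castSucc
  | tau i => WeldedBraid.tau i.castSucc

theorem BraidDiagram.lift_toFree {n : ℕ} (w : BraidDiagram n) :
    FreeGroup.lift Generator.addRight w.toFree = w.addRight.toBraid := by
  induction w with
  | nil => simp [BraidDiagram.toFree, BraidDiagram.toBraid, BraidDiagram.addRight]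
  | cons a w ih =>
    simp only [BraidDiagram.toFree, BraidDiagram.toBraid, BraidDiagram.addRight, List.map_cons,
      List.prod_cons, map_mul] at ih ⊢
    rw [ih]
    congr 1
    cases a <;> simp [Letter.toFree, Letter.addRight, Generator.addRight, WeldedBraid.sigma,
      WeldedBraid.tau, PresentedGroup.of]

/-- The homomorphism `ι_0^1 : WB_{n+1} → WB_{n+2}` that adds a trivial strand on the right. -/
def WeldedBraid.addRight {n : ℕ} : WeldedBraid n →* WeldedBraid (n + 1) :=
  PresentedGroup.toGroup (f := Generator.addRight) (by
    rintro _ ⟨l, r, h, rfl⟩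
    rw [map_mul, map_inv, BraidDiagram.lift_toFree, BraidDiagram.lift_toFree, mul_inv_eq_one]
    have h1 : PresentedGroup.mk (relators (n + 1))
        (l.addRight.toFree * r.addRight.toFree⁻¹) = 1 :=
      PresentedGroup.one_of_mem ⟨_, _, h.addRight, rfl⟩
    rwa [map_mul, map_inv, mul_inv_eq_one] at h1)

/-! ## The moves of the Markov theorem -/

open WeldedBraid in
/-- The moves on welded braids: conjugations, and right stabilizations of positive, negative and
virtual type. -/
inductive BraidMove : (Σ n, WeldedBraid n) → (Σ n, WeldedBraid n) → Prop
  | conj {n : ℕ} (b c : WeldedBraid n) : BraidMove ⟨n, b⟩ ⟨n, c⁻¹ * b * c⟩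
  | stab_pos {n : ℕ} (b : WeldedBraid n) :
      BraidMove ⟨n, b⟩ ⟨n + 1, addRight b * sigma (Fin.last n)⟩
  | stab_neg {n : ℕ} (b : WeldedBraid n) :
      BraidMove ⟨n, b⟩ ⟨n + 1, addRight b * (sigma (Fin.last n))⁻¹⟩
  | stab_virt {n : ℕ} (b : WeldedBraid n) :
      BraidMove ⟨n, b⟩ ⟨n + 1, addRight b * tau (Fin.last n)⟩

/-- Two welded braids are related by a finite sequence of conjugations, right stabilizations and
their inverse operations. -/
def BraidsRelated : (Σ n, WeldedBraid n) → (Σ n, WeldedBraid n) → Prop :=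
  Relation.EqvGen BraidMove

open Letter in
/-- The moves on welded braid diagrams: welded braid moves (one per defining relation of the welded
braid group, applied anywhere in the diagram), conjugations, and right stabilizations of positive,
negative and virtual type. -/
inductive DiagramMove : (Σ n, BraidDiagram n) → (Σ n, BraidDiagram n) → Prop
  | braid {n : ℕ} (x y l r : BraidDiagram n) (h : BraidRelation n l r) :
      DiagramMove ⟨n, x ++ l ++ y⟩ ⟨n, x ++ r ++ y⟩
  | conj {n : ℕ} (w v : BraidDiagram n) : DiagramMove ⟨n, w⟩ ⟨n, v.inv ++ w ++ v⟩
  | stab_pos {n : ℕ} (w : BraidDiagram n) :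
      DiagramMove ⟨n, w⟩ ⟨n + 1, w.addRight ++ [sigma (Fin.last n)]⟩
  | stab_neg {n : ℕ} (w : BraidDiagram n) :
      DiagramMove ⟨n, w⟩ ⟨n + 1, w.addRight ++ [sigmaInv (Fin.last n)]⟩
  | stab_virt {n : ℕ} (w : BraidDiagram n) :
      DiagramMove ⟨n, w⟩ ⟨n + 1, w.addRight ++ [tau (Fin.last n)]⟩

/-- Two welded braid diagrams are related by a finite sequence of welded braid moves, conjugations,
right stabilizations and their inverse operations. -/
def DiagramsRelated : (Σ n, BraidDiagram n) → (Σ n, BraidDiagram n) → Prop :=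
  Relation.EqvGen DiagramMove

/-! ## Welded link diagrams -/

/-- How a crossing looks in the plane.  Of the two strands at a crossing, the *left* strand is the
one that enters from the upper left (and leaves to the lower right), the *right* strand the one that
enters from the upper right.  At a real crossing one of them passes over the other.
When both strands are oriented downwards (or both upwards), `rightOver` is a positive and `leftOver`
a negative crossing; when exactly one of them is oriented downwards it is the other way round. -/
inductive Crossing : Type
  | leftOver
  | rightOver
  | virt

namespace Crossing

/-- Interchange of the left and the right strand. -/
def swap : Crossing → Crossing
  | leftOver => rightOver
  | rightOver => leftOver
  | virt => virt

/-- A real crossing is a positive or negative one. -/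
def IsReal (c : Crossing) : Prop := c ≠ virt

end Crossing

/-- An event of a plane diagram: a local maximum, a local minimum, or a crossing.
The two strands that go down from a maximum have opposite directions; `maximum true` has its left
strand oriented downwards, `maximum false` its right strand. -/
inductive Piece : Type
  | maximum (leftDown : Bool)
  | minimum
  | crossing (c : Crossing)

namespace Piece

/-- The number of strands that enter a piece from above. -/
def inputs : Piece → ℕ
  | maximum _ => 0
  | minimum => 2
  | crossing _ => 2

/-- The number of strands that leave a piece at the bottom. -/
def outputs : Piece → ℕ
  | maximum _ => 2
  | minimum => 0
  | crossing _ => 2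

end Piece

/-- A piece together with the number of strands that pass to the left of it. -/
structure Layer : Type where
  pos : ℕ
  piece : Piece

/-- The layer with a local maximum that has `p` strands to its left. -/
abbrev mx (p : ℕ) (leftDown : Bool) : Layer := ⟨p, .maximum leftDown⟩

/-- The layer with a local minimum that has `p` strands to its left. -/
abbrev mn (p : ℕ) : Layer := ⟨p, .minimum⟩

/-- The layer with a crossing that has `p` strands to its left. -/
abbrev cr (p : ℕ) (c : Crossing) : Layer := ⟨p, .crossing c⟩

/-- `Step L s t`: the layer `L` fits to oriented strands `s` above it and `t` below it.  Strands are
listed from left to right; `true` means oriented downwards, `false` upwards. -/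
inductive Step : Layer → List Bool → List Bool → Prop
  | maximum (u v : List Bool) (d : Bool) : Step (mx u.length d) (u ++ v) (u ++ d :: (!d) :: v)
  | minimum (u v : List Bool) (d : Bool) : Step (mn u.length) (u ++ d :: (!d) :: v) (u ++ v)
  | crossing (u v : List Bool) (d e : Bool) (c : Crossing) :
      Step (cr u.length c) (u ++ d :: e :: v) (u ++ e :: d :: v)

/-- `Run w s t`: the layers `w`, from top to bottom, form an oriented diagram whose strands at the
top are `s` and whose strands at the bottom are `t`. -/
inductive Run : List Layer → List Bool → List Bool → Prop
  | nil (s : List Bool) : Run [] s s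
  | cons {L : Layer} {w : List Layer} {s t u : List Bool} (h : Step L s t) (h' : Run w t u) :
      Run (L :: w) s u

/-- A welded link diagram: an oriented plane diagram without ends. -/
structure LinkDiagram : Type where
  layers : List Layer
  closed : Run layers [] []

/-! ## Moves of welded link diagrams -/

/-- The moves that generate plane isotopy. -/
inductive PlanarIsotopy : List Layer → List Layer → Prop
  /-- Two pieces that lie side by side exchange their heights; `k` strands pass between them. -/
  | exchange (p k : ℕ) (P Q : Piece) :
      PlanarIsotopy [⟨p, P⟩, ⟨p + P.outputs + k, Q⟩] [⟨p + P.inputs + k, Q⟩, ⟨p, P⟩]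
  /-- A strand that goes down, up and down again is straightened. -/
  | zigzag_right (p : ℕ) (d : Bool) : PlanarIsotopy [mx (p + 1) d, mn p] []
  | zigzag_left (p : ℕ) (d : Bool) : PlanarIsotopy [mx p d, mn (p + 1)] []
  /-- A strand that crosses one leg of a minimum or maximum is moved to the other leg. -/
  | minimum_slide (p : ℕ) (c : Crossing) :
      PlanarIsotopy [cr p c, mn (p + 1)] [cr (p + 1) c.swap, mn p]
  | maximum_slide (p : ℕ) (d : Bool) (c : Crossing) :
      PlanarIsotopy [mx p d, cr (p + 1) c] [mx (p + 1) d, cr p c.swap]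

open Crossing in
/-- Three strands `1`, `2`, `3` enter from above, from left to right, and cross pairwise; `c₁₂`,
`c₁₃`, `c₂₃` are the three crossings.  A triangle with such crossings may be passed by a Reidemeister
move of type RIII, VIII or MI. -/
inductive ReidemeisterTriangle : Crossing → Crossing → Crossing → Prop
  /-- RIII: three real crossings, where one strand is over, one in the middle and one under, i.e.
  the relation "passes over" on the strands is not cyclic. -/
  | real (c₁₂ c₁₃ c₂₃ : Crossing) (h₁₂ : c₁₂.IsReal) (h₁₃ : c₁₃.IsReal) (h₂₃ : c₂₃.IsReal)
      (h : ¬ (c₁₂ = leftOver ∧ c₂₃ = leftOver ∧ c₁₃ = rightOver))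
      (h' : ¬ (c₁₂ = rightOver ∧ c₂₃ = rightOver ∧ c₁₃ = leftOver)) :
      ReidemeisterTriangle c₁₂ c₁₃ c₂₃
  /-- VIII: three virtual crossings. -/
  | virt : ReidemeisterTriangle virt virt virt
  /-- MI: one strand has only virtual crossings, the other two cross in a real crossing. -/
  | mixed₁ (c : Crossing) (h : c.IsReal) : ReidemeisterTriangle virt virt c
  | mixed₂ (c : Crossing) (h : c.IsReal) : ReidemeisterTriangle virt c virt
  | mixed₃ (c : Crossing) (h : c.IsReal) : ReidemeisterTriangle c virt virt

open Crossing in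
/-- The triangles of the W-move: one of the strands passes over both other strands, which cross each
other in a virtual crossing. -/
inductive WTriangle : Crossing → Crossing → Crossing → Prop
  | over₁ : WTriangle leftOver leftOver virt
  | over₂ : WTriangle rightOver virt leftOver
  | over₃ : WTriangle virt rightOver rightOver

/-- The virtual Reidemeister moves, with all orientations of the strands. -/
inductive VirtualReidemeister : List Layer → List Layer → Prop
  /-- RI (real crossing) and VI (virtual crossing): a kink on the right or left side of a strand. -/
  | one_right (p : ℕ) (d : Bool) (c : Crossing) :
      VirtualReidemeister [mx (p + 1) d, cr p c, mn (p + 1)] []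
  | one_left (p : ℕ) (d : Bool) (c : Crossing) :
      VirtualReidemeister [mx p d, cr (p + 1) c, mn p] []
  /-- RII (the same strand is over at both crossings) and VII (two virtual crossings). -/
  | two (p : ℕ) (c : Crossing) : VirtualReidemeister [cr p c, cr p c.swap] []
  /-- RIII, VIII and MI. -/
  | three (p : ℕ) (c₁₂ c₁₃ c₂₃ : Crossing) (h : ReidemeisterTriangle c₁₂ c₁₃ c₂₃) :
      VirtualReidemeister [cr p c₁₂, cr (p + 1) c₁₃, cr p c₂₃] [cr (p + 1) c₂₃, cr p c₁₃, cr (p + 1) c₁₂]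

/-- The W-moves, with all orientations of the strands. -/
inductive WMove : List Layer → List Layer → Prop
  | w (p : ℕ) (c₁₂ c₁₃ c₂₃ : Crossing) (h : WTriangle c₁₂ c₁₃ c₂₃) :
      WMove [cr p c₁₂, cr (p + 1) c₁₃, cr p c₂₃] [cr (p + 1) c₂₃, cr p c₁₃, cr (p + 1) c₁₂]

/-- One of the local moves is applied somewhere in a welded link diagram, the rest of the diagram
being unchanged. -/
def LinkMove (K K' : LinkDiagram) : Prop :=
  ∃ x y l r : List Layer, (PlanarIsotopy l r ∨ VirtualReidemeister l r ∨ WMove l r) ∧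
    K.layers = x ++ l ++ y ∧ K'.layers = x ++ r ++ y

/-- Two welded link diagrams are equivalent as welded links: they are related, up to plane isotopy,
by a finite sequence of virtual Reidemeister moves and W-moves. -/
def EquivalentAsWeldedLinks : LinkDiagram → LinkDiagram → Prop :=
  Relation.EqvGen LinkMove

/-! ## Closures -/

/-- A braid crossing as a piece of a link diagram; the strands of a braid are oriented downwards. -/
def Letter.toLayer {n : ℕ} : Letter n → Layer
  | sigma i => cr i .rightOver
  | sigmaInv i => cr i .leftOver
  | tau i => cr i .virt

/-- The layers of the closure: `n + 1` nested maxima, the braid diagram on the strands at the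
positions `0, …, n` (the strands at the positions `n + 1, …, 2 n + 1` go up again, to its right), and
`n + 1` nested minima. -/
def closureLayers {n : ℕ} (w : BraidDiagram n) : List Layer :=
  (List.range (n + 1)).map (fun k => mx k true) ++ w.map Letter.toLayer ++
    (List.range (n + 1)).reverse.map (fun k => mn k)

theorem Run.append {x y : List Layer} {s t u : List Bool} (h : Run x s t) (h' : Run y t u) :
    Run (x ++ y) s u := by
  induction h with
  | nil => exact h'
  | cons a _ ih => exact .cons a (ih h')

theorem run_maxima (m : ℕ) : Run ((List.range m).map (fun k => mx k true)) []
    (List.replicate m true ++ List.replicate m false) := by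
  induction m with
  | zero => exact .nil _
  | succ m ih =>
    rw [List.range_succ, List.map_append]
    refine ih.append (.cons ?_ (.nil _))
    have h := Step.maximum (List.replicate m true) (List.replicate m false) true
    rw [List.length_replicate] at h
    rw [List.replicate_succ' (n := m) (a := true), List.replicate_succ (n := m) (a := false)]
    simpa using h

theorem run_minima (m : ℕ) : Run ((List.range m).reverse.map (fun k => mn k))
    (List.replicate m true ++ List.replicate m false) [] := by
  induction m with
  | zero => exact .nil _
  | succ m ih =>
    rw [List.range_succ, List.reverse_append, List.map_append]
    refine Run.append (.cons ?_ (.nil _)) ih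
    have h := Step.minimum (List.replicate m true) (List.replicate m false) true
    rw [List.length_replicate] at h
    rw [List.replicate_succ' (n := m) (a := true), List.replicate_succ (n := m) (a := false)]
    simpa using h

theorem step_crossing {n : ℕ} (i : Fin n) (c : Crossing) (v : List Bool) :
    Step (cr i c) (List.replicate (n + 1) true ++ v) (List.replicate (n + 1) true ++ v) := by
  obtain ⟨i, hi⟩ := i
  obtain ⟨k, rfl⟩ := Nat.exists_eq_add_of_lt hi
  have h := Step.crossing (List.replicate i true) (List.replicate k true ++ v) true true c
  rw [List.length_replicate] at h
  have e : List.replicate i true ++ true :: true :: (List.replicate k true ++ v) =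
      List.replicate (i + k + 1 + 1) true ++ v := by
    rw [show i + k + 1 + 1 = i + (k + 1 + 1) by omega, List.replicate_add i]
    simp [List.replicate_succ]
  rwa [e] at h

theorem run_braid {n : ℕ} (w : BraidDiagram n) (v : List Bool) :
    Run (w.map Letter.toLayer) (List.replicate (n + 1) true ++ v)
      (List.replicate (n + 1) true ++ v) := by
  induction w with
  | nil => exact .nil _
  | cons a w ih => cases a <;> exact .cons (step_crossing _ _ _) ih

/-- The closure of a welded braid diagram. -/
def closure {n : ℕ} (w : BraidDiagram n) : LinkDiagram where
  layers := closureLayers w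
  closed := ((run_maxima _).append (run_braid _ _)).append (run_minima _)

end Welded

/-!
The theorem is proved by means of Gauss diagrams. In the welded braid group let `arr n i j` be the
braid in which the strand `i` passes over the strand `j`, everything else being virtual; these
arrows are conjugate to `σ_0 τ_0` by virtual braids, and `σ_i` is the product of an arrow and `τ_i`.
A virtual braid is determined by its permutation (`Virt_eq_one`), and conjugation by it permutes the
strands of the arrows (`vb_arr`). Hence every welded braid is a word in arrows, followed by the
virtual braid `vb n π` of a permutation. The defining relations say that disjoint arrows commute,
that arrows with the same tail commute (`arr_comm_tails`, which is where welded differs from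
virtual) and that a strand above an arrow moves past it (`arr_comm_triangle`).

Such a pair of a word in arrows and a permutation can be read off from any link diagram: cut its
strands into labelled pieces, list the arrows of the real crossings from top to bottom, and let `π`
join the end of each piece to the beginning of the next one. This is expressed by `Lab` and
`Presents`. The resulting braid depends on the labelling only up to Markov moves: subdivisions of
strands are removed by destabilizations (`Numbering.remove_sub`), and two labellings without
subdivisions differ by a permutation of the labels, that is, by a conjugation (`Presents.unique`).

Virtual crossings have no arrows, so isotopies and moves with a virtual strand do not change these
data, apart from the labelling. The point at which a strand is cut can be moved along it, up to
conjugation (`move_cut`), and kinks of two of the four types are destabilizations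
(`remove_good_kink`). The other kinks and the moves of two and three strands, with all
orientations, follow from these facts and the relations between arrows (`remove_kink`,
`second_move`, `third_move`, `tails_move`). So equivalent diagrams have related braids
(`EquivalentAsWeldedLinks.braidsRelated`), and as the closure of a braid diagram presents the braid
itself (`presents_closure`), braids with equivalent closures are related.

Conversely, the braid relations are local moves, a crossing slides from the bottom of a closed braid
to its top through the minima and maxima (`closure_rotate`), and a stabilization adds a kink
(`closure_stab`); this is `DiagramsRelated.closure`. The statements about braids and about diagrams
agree, because words with the same class in the group are related by the defining relations
(`diagramsRelated_of_toBraid_eq`).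
-/

namespace Welded

open Equiv (swap Perm)

/-! ### Relations in the welded braid group -/

theorem BraidDiagram.toBraid_append {n : ℕ} (x y : BraidDiagram n) :
    BraidDiagram.toBraid (x ++ y) = x.toBraid * y.toBraid := by
  simp [BraidDiagram.toBraid, BraidDiagram.toFree]

theorem BraidDiagram.toBraid_nil {n : ℕ} : BraidDiagram.toBraid ([] : BraidDiagram n) = 1 := by
  simp [BraidDiagram.toBraid, BraidDiagram.toFree]

theorem BraidDiagram.toBraid_sigma {n : ℕ} (i : Fin n) :
    BraidDiagram.toBraid [Letter.sigma i] = WeldedBraid.sigma i := by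
  simp [BraidDiagram.toBraid, BraidDiagram.toFree, Letter.toFree, WeldedBraid.sigma,
    PresentedGroup.of]

theorem BraidDiagram.toBraid_sigmaInv {n : ℕ} (i : Fin n) :
    BraidDiagram.toBraid [Letter.sigmaInv i] = (WeldedBraid.sigma i)⁻¹ := by
  simp [BraidDiagram.toBraid, BraidDiagram.toFree, Letter.toFree, WeldedBraid.sigma,
    PresentedGroup.of]

theorem BraidDiagram.toBraid_tau {n : ℕ} (i : Fin n) :
    BraidDiagram.toBraid [Letter.tau i] = WeldedBraid.tau i := by
  simp [BraidDiagram.toBraid, BraidDiagram.toFree, Letter.toFree, WeldedBraid.tau,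
    PresentedGroup.of]

theorem BraidDiagram.toBraid_cons {n : ℕ} (a : Letter n) (x : BraidDiagram n) :
    BraidDiagram.toBraid (a :: x) = BraidDiagram.toBraid [a] * x.toBraid :=
  BraidDiagram.toBraid_append [a] x

theorem BraidRelation.toBraid_eq {n : ℕ} {l r : BraidDiagram n} (h : BraidRelation n l r) :
    l.toBraid = r.toBraid := by
  have h1 : PresentedGroup.mk (relators n) (l.toFree * r.toFree⁻¹) = 1 :=
    PresentedGroup.one_of_mem ⟨_, _, h, rfl⟩
  rwa [map_mul, map_inv, mul_inv_eq_one] at h1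

/-- The generator `σ i` with the index in `ℕ`; it is `1` when the index is out of range. -/
def sg (n i : ℕ) : WeldedBraid n := if h : i < n then WeldedBraid.sigma ⟨i, h⟩ else 1

/-- The generator `τ i` with the index in `ℕ`; it is `1` when the index is out of range. -/
def tu (n i : ℕ) : WeldedBraid n := if h : i < n then WeldedBraid.tau ⟨i, h⟩ else 1

theorem sg_fin {n : ℕ} (i : Fin n) : sg n i = WeldedBraid.sigma i := by simp [sg]

theorem tu_fin {n : ℕ} (i : Fin n) : tu n i = WeldedBraid.tau i := by simp [tu]

theorem tu_tu (n i : ℕ) : tu n i * tu n i = 1 := by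
  unfold tu
  split_ifs with h
  · simpa [BraidDiagram.toBraid_cons _ [_], BraidDiagram.toBraid_tau, BraidDiagram.toBraid_nil]
      using (BraidRelation.tau_tau (⟨i, h⟩ : Fin n)).toBraid_eq
  · simp

theorem tu_inv (n i : ℕ) : (tu n i)⁻¹ = tu n i := inv_eq_of_mul_eq_one_right (tu_tu n i)

theorem tu_cancel {n : ℕ} (i : ℕ) (b : WeldedBraid n) : tu n i * (tu n i * b) = b := by
  rw [← mul_assoc, tu_tu, one_mul]

theorem tu_comm {n i j : ℕ} (h : i + 1 < j ∨ j + 1 < i) : tu n i * tu n j = tu n j * tu n i := by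
  unfold tu
  split_ifs with h1 h2 h2 <;> try simp only [mul_one, one_mul]
  simpa [BraidDiagram.toBraid_cons _ [_], BraidDiagram.toBraid_tau]
    using (BraidRelation.tau_comm (⟨i, h1⟩ : Fin n) ⟨j, h2⟩ h).toBraid_eq

theorem sg_comm {n i j : ℕ} (h : i + 1 < j ∨ j + 1 < i) : sg n i * sg n j = sg n j * sg n i := by
  unfold sg
  split_ifs with h1 h2 h2 <;> try simp only [mul_one, one_mul]
  simpa [BraidDiagram.toBraid_cons _ [_], BraidDiagram.toBraid_sigma]
    using (BraidRelation.sigma_comm (⟨i, h1⟩ : Fin n) ⟨j, h2⟩ h).toBraid_eq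

theorem sg_tu_comm {n i j : ℕ} (h : i + 1 < j ∨ j + 1 < i) :
    sg n i * tu n j = tu n j * sg n i := by
  unfold sg tu
  split_ifs with h1 h2 h2 <;> try simp only [mul_one, one_mul]
  simpa [BraidDiagram.toBraid_cons _ [_], BraidDiagram.toBraid_sigma, BraidDiagram.toBraid_tau]
    using (BraidRelation.mixed_comm (⟨i, h1⟩ : Fin n) ⟨j, h2⟩ h).toBraid_eq

theorem tu_braid {n i : ℕ} (h : i + 1 < n) :
    tu n i * tu n (i + 1) * tu n i = tu n (i + 1) * tu n i * tu n (i + 1) := by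
  unfold tu
  rw [dif_pos h, dif_pos (by omega)]
  simpa [BraidDiagram.toBraid_cons _ [_], BraidDiagram.toBraid_cons _ [_, _],
    BraidDiagram.toBraid_tau, mul_assoc]
    using (BraidRelation.tau_braid (⟨i, by omega⟩ : Fin n) ⟨i + 1, h⟩ rfl).toBraid_eq

theorem sg_braid {n i : ℕ} (h : i + 1 < n) :
    sg n i * sg n (i + 1) * sg n i = sg n (i + 1) * sg n i * sg n (i + 1) := by
  unfold sg
  rw [dif_pos h, dif_pos (by omega)]
  simpa [BraidDiagram.toBraid_cons _ [_], BraidDiagram.toBraid_cons _ [_, _],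
    BraidDiagram.toBraid_sigma, mul_assoc]
    using (BraidRelation.sigma_braid (⟨i, by omega⟩ : Fin n) ⟨i + 1, h⟩ rfl).toBraid_eq

theorem mixed_braid {n i : ℕ} (h : i + 1 < n) :
    sg n i * tu n (i + 1) * tu n i = tu n (i + 1) * tu n i * sg n (i + 1) := by
  unfold sg tu
  rw [dif_pos h, dif_pos h, dif_pos (show i < n by omega), dif_pos (show i < n by omega)]
  simpa [BraidDiagram.toBraid_cons _ [_], BraidDiagram.toBraid_cons _ [_, _],
    BraidDiagram.toBraid_sigma, BraidDiagram.toBraid_tau, mul_assoc]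
    using (BraidRelation.mixed_braid (⟨i, by omega⟩ : Fin n) ⟨i + 1, h⟩ rfl).toBraid_eq

theorem welded_braid {n i : ℕ} (h : i + 1 < n) :
    tu n i * sg n (i + 1) * sg n i = sg n (i + 1) * sg n i * tu n (i + 1) := by
  unfold sg tu
  rw [dif_pos h, dif_pos h, dif_pos (show i < n by omega), dif_pos (show i < n by omega)]
  simpa [BraidDiagram.toBraid_cons _ [_], BraidDiagram.toBraid_cons _ [_, _],
    BraidDiagram.toBraid_sigma, BraidDiagram.toBraid_tau, mul_assoc]
    using (BraidRelation.welded (⟨i, by omega⟩ : Fin n) ⟨i + 1, h⟩ rfl).toBraid_eq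

/-- The mixed relation read upside down. -/
theorem mixed_braid' {n i : ℕ} (h : i + 1 < n) :
    tu n i * tu n (i + 1) * sg n i = sg n (i + 1) * tu n i * tu n (i + 1) := by
  have e := congrArg (fun b => tu n i * (tu n (i + 1) * (b * (tu n i * tu n (i + 1)))))
    (mixed_braid h)
  simpa only [mul_assoc, tu_cancel, tu_tu, mul_one] using e

theorem addRight_sg {n i : ℕ} (h : i < n) : WeldedBraid.addRight (sg n i) = sg (n + 1) i := by
  rw [sg, sg, dif_pos h, dif_pos (by omega)]
  exact PresentedGroup.toGroup.of _

theorem addRight_tu {n i : ℕ} (h : i < n) : WeldedBraid.addRight (tu n i) = tu (n + 1) i := by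
  rw [tu, tu, dif_pos h, dif_pos (by omega)]
  exact PresentedGroup.toGroup.of _

/-! ### The permutation of a welded braid -/

/-- The transposition of a generator. -/
def Generator.toPerm {n : ℕ} : Generator n → Perm ℕ
  | sigma i => swap i (i + 1)
  | tau i => swap i (i + 1)

theorem swap_succ_comm {i j : ℕ} (h : i + 1 < j ∨ j + 1 < i) :
    swap i (i + 1) * swap j (j + 1) = swap j (j + 1) * swap i (i + 1) := by
  ext k
  simp only [Perm.mul_apply, Equiv.swap_apply_def]
  split_ifs <;> omega

theorem swap_succ_braid (i : ℕ) :
    swap i (i + 1) * swap (i + 1) (i + 1 + 1) * swap i (i + 1) =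
      swap (i + 1) (i + 1 + 1) * swap i (i + 1) * swap (i + 1) (i + 1 + 1) := by
  ext k
  simp only [Perm.mul_apply, Equiv.swap_apply_def]
  split_ifs <;> omega

theorem BraidRelation.toPerm_eq {n : ℕ} {l r : BraidDiagram n} (h : BraidRelation n l r) :
    FreeGroup.lift Generator.toPerm l.toFree = FreeGroup.lift Generator.toPerm r.toFree := by
  cases h with
  | sigma_sigmaInv i => simp [BraidDiagram.toFree, Letter.toFree]
  | sigmaInv_sigma i => simp [BraidDiagram.toFree, Letter.toFree]
  | tau_tau i => simp [BraidDiagram.toFree, Letter.toFree, Generator.toPerm]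
  | sigma_comm i j h | tau_comm i j h | mixed_comm i j h =>
    simpa [BraidDiagram.toFree, Letter.toFree, Generator.toPerm] using swap_succ_comm h
  | sigma_braid i j h | tau_braid i j h | mixed_braid i j h | welded i j h =>
    simpa [BraidDiagram.toFree, Letter.toFree, Generator.toPerm, mul_assoc, h] using
      swap_succ_braid i

/-- The permutation of a welded braid; it sends the bottom position of a strand to its top
position.  Positions are natural numbers, so that adding a strand does not change it. -/
def toPerm (n : ℕ) : WeldedBraid n →* Perm ℕ :=
  PresentedGroup.toGroup (f := Generator.toPerm) (by
    rintro _ ⟨l, r, h, rfl⟩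
    rw [map_mul, map_inv, h.toPerm_eq, mul_inv_cancel])

theorem toPerm_sg {n i : ℕ} (h : i < n) : toPerm n (sg n i) = swap i (i + 1) := by
  rw [sg, dif_pos h]
  exact PresentedGroup.toGroup.of _

theorem toPerm_tu {n i : ℕ} (h : i < n) : toPerm n (tu n i) = swap i (i + 1) := by
  rw [tu, dif_pos h]
  exact PresentedGroup.toGroup.of _

/-- The permutations of the positions `0, …, n`. -/
def Pm (n : ℕ) : Subgroup (Perm ℕ) where
  carrier := {π | ∀ i, n < i → π i = i}
  one_mem' := fun _ _ => rfl
  mul_mem' := fun {a b} ha hb i hi => by rw [Perm.mul_apply, hb i hi, ha i hi]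
  inv_mem' := fun {a} ha i hi => by rw [Perm.inv_eq_iff_eq, ha i hi]

theorem Pm_le {n : ℕ} {π : Perm ℕ} (h : π ∈ Pm n) {i : ℕ} (hi : i ≤ n) : π i ≤ n := by
  by_contra hc
  have := h _ (not_le.mp hc)
  exact hc ((π.injective this).le.trans hi)

theorem Pm_of_fix {n : ℕ} {π : Perm ℕ} (h : π ∈ Pm (n + 1)) (h' : π (n + 1) = n + 1) :
    π ∈ Pm n := by
  intro i hi
  rcases (show i = n + 1 ∨ n + 1 < i by omega) with rfl | hi
  · exact h'
  · exact h i hi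

theorem swap_mem_Pm {n a b : ℕ} (ha : a ≤ n) (hb : b ≤ n) : swap a b ∈ Pm n :=
  fun i hi => Equiv.swap_apply_of_ne_of_ne (by omega) (by omega)

/-- The subgroup of the welded braids that have only virtual crossings. -/
def Virt (n : ℕ) : Subgroup (WeldedBraid n) := Subgroup.closure (Set.range (tu n))

theorem tu_mem_Virt (n i : ℕ) : tu n i ∈ Virt n := Subgroup.subset_closure ⟨i, rfl⟩

theorem tu_of_le {n i : ℕ} (h : n ≤ i) : tu n i = 1 := dif_neg (by omega)

theorem toPerm_mem_Pm {n : ℕ} {t : WeldedBraid n} (ht : t ∈ Virt n) : toPerm n t ∈ Pm n := by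
  induction ht using Subgroup.closure_induction with
  | mem x hx =>
    obtain ⟨i, rfl⟩ := hx
    by_cases h : i < n
    · rw [toPerm_tu h]; exact swap_mem_Pm (by omega) (by omega)
    · rw [tu_of_le (by omega), map_one]; exact one_mem _
  | one => rw [map_one]; exact one_mem _
  | mul x y _ _ hx hy => rw [map_mul]; exact mul_mem hx hy
  | inv x _ hx => rw [map_inv]; exact inv_mem hx

theorem addRight_mem_Virt {n : ℕ} {t : WeldedBraid n} (ht : t ∈ Virt n) :
    WeldedBraid.addRight t ∈ Virt (n + 1) := by
  induction ht using Subgroup.closure_induction with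
  | mem x hx =>
    obtain ⟨i, rfl⟩ := hx
    by_cases h : i < n
    · rw [addRight_tu h]; exact tu_mem_Virt _ _
    · rw [tu_of_le (by omega), map_one]; exact one_mem _
  | one => rw [map_one]; exact one_mem _
  | mul x y _ _ hx hy => rw [map_mul]; exact mul_mem hx hy
  | inv x _ hx => rw [map_inv]; exact inv_mem hx

theorem toPerm_addRight {n : ℕ} (b : WeldedBraid n) :
    toPerm (n + 1) (WeldedBraid.addRight b) = toPerm n b := by
  have : (toPerm (n + 1)).comp WeldedBraid.addRight = toPerm n := by
    refine PresentedGroup.ext ?_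
    rintro (i | i)
    · have := addRight_sg i.2
      rw [sg_fin] at this
      have h2 := toPerm_sg (n := n + 1) (i := i) (by omega)
      rw [← this] at h2
      have h3 := toPerm_sg i.2
      rw [sg_fin] at h3
      exact h2.trans h3.symm
    · have := addRight_tu i.2
      rw [tu_fin] at this
      have h2 := toPerm_tu (n := n + 1) (i := i) (by omega)
      rw [← this] at h2
      have h3 := toPerm_tu i.2
      rw [tu_fin] at h3
      exact h2.trans h3.symm
  exact DFunLike.congr_fun this b

/-- The virtual braid `τ_n τ_{n-1} ⋯ τ_{n-k+1}` with `k` crossings, a coset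
representative of `S_{n+1}` in `S_{n+2}`. -/
def cyc (n : ℕ) : ℕ → WeldedBraid (n + 1)
  | 0 => 1
  | k + 1 => cyc n k * tu (n + 1) (n - k)

theorem cyc_comm {n k i : ℕ} (h : i + k < n) : cyc n k * tu (n + 1) i = tu (n + 1) i * cyc n k := by
  induction k with
  | zero => simp [cyc]
  | succ k ih =>
    rw [cyc, mul_assoc, tu_comm (show n - k + 1 < i ∨ i + 1 < n - k by omega), ← mul_assoc,
      ih (by omega), mul_assoc]

theorem cyc_shift {n k i : ℕ} (hk : k ≤ n + 1) (h : n + 1 < i + k) (hi : i ≤ n) :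
    cyc n k * tu (n + 1) i = tu (n + 1) (i - 1) * cyc n k := by
  induction k with
  | zero => omega
  | succ k ih =>
    rcases (show n + 1 < i + k ∨ i + k = n + 1 by omega) with h' | h'
    · rw [cyc, mul_assoc, tu_comm (show n - k + 1 < i ∨ i + 1 < n - k by omega), ← mul_assoc,
        ih (by omega) h', mul_assoc]
    · obtain ⟨j, rfl⟩ : ∃ j, k = j + 1 := ⟨k - 1, by omega⟩
      obtain ⟨m, rfl⟩ : ∃ m, i = m + 1 := ⟨i - 1, by omega⟩
      have e1 : n - (j + 1) = m := by omega
      have e2 : n - j = m + 1 := by omega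
      rw [cyc, cyc, e1, e2, Nat.add_sub_cancel, mul_assoc, mul_assoc, ← mul_assoc (tu _ (m + 1)),
        ← tu_braid (by omega), ← mul_assoc, ← mul_assoc, cyc_comm (by omega)]
      simp only [mul_assoc]

theorem toPerm_cyc {n k : ℕ} (hk : k ≤ n + 1) : toPerm (n + 1) (cyc n k) (n + 1 - k) = n + 1 := by
  induction k with
  | zero => simp [cyc]
  | succ k ih =>
    rw [cyc, map_mul, toPerm_tu (by omega), Perm.mul_apply,
      show n + 1 - (k + 1) = n - k by omega, Equiv.swap_apply_left,
      show n - k + 1 = n + 1 - k by omega, ih (by omega)]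

/-- A virtual braid is the product of a virtual braid with one strand less and a coset
representative `cyc n k`: multiplication by a generator preserves this form, by the Coxeter
relations. -/
theorem Virt_normal_form {n : ℕ} {t : WeldedBraid (n + 1)} (ht : t ∈ Virt (n + 1)) :
    ∃ t' ∈ Virt n, ∃ k ≤ n + 1, t = WeldedBraid.addRight t' * cyc n k := by
  have step : ∀ x : WeldedBraid (n + 1), ∀ i,
      (∃ t' ∈ Virt n, ∃ k ≤ n + 1, x = WeldedBraid.addRight t' * cyc n k) →
      (∃ t' ∈ Virt n, ∃ k ≤ n + 1, x * tu (n + 1) i = WeldedBraid.addRight t' * cyc n k) := by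
    rintro x i ⟨t', ht', k, hk, rfl⟩
    by_cases hi : n + 1 ≤ i
    · rw [tu_of_le hi, mul_one]; exact ⟨t', ht', k, hk, rfl⟩
    rcases lt_trichotomy (i + k) n with h | h | h
    · refine ⟨t' * tu n i, mul_mem ht' (tu_mem_Virt _ _), k, hk, ?_⟩
      rw [mul_assoc, cyc_comm h, map_mul, addRight_tu (by omega), mul_assoc]
    · refine ⟨t', ht', k + 1, by omega, ?_⟩
      rw [cyc, show n - k = i by omega, mul_assoc]
    · rcases (show n + 1 = i + k ∨ n + 1 < i + k by omega) with h' | h'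
      · obtain ⟨j, rfl⟩ : ∃ j, k = j + 1 := ⟨k - 1, by omega⟩
        refine ⟨t', ht', j, by omega, ?_⟩
        rw [cyc, show n - j = i by omega, mul_assoc, mul_assoc, tu_tu, mul_one]
      · refine ⟨t' * tu n (i - 1), mul_mem ht' (tu_mem_Virt _ _), k, hk, ?_⟩
        rw [mul_assoc, cyc_shift hk h' (by omega), map_mul, addRight_tu (by omega), mul_assoc]
  induction ht using Subgroup.closure_induction_right with
  | one => exact ⟨1, one_mem _, 0, by omega, by simp [cyc]⟩
  | mul_right x hx y hy ih => obtain ⟨i, rfl⟩ := hy; exact step x i ih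
  | mul_inv_cancel x hx y hy ih => obtain ⟨i, rfl⟩ := hy; rw [tu_inv]; exact step x i ih

/-- The virtual generators satisfy no more relations than the transpositions of neighbours: a
virtual braid is determined by its permutation. -/
theorem Virt_eq_one {n : ℕ} {t : WeldedBraid n} (ht : t ∈ Virt n) (h : toPerm n t = 1) :
    t = 1 := by
  induction n with
  | zero =>
    have : Virt 0 = ⊥ := by
      rw [Virt, Subgroup.closure_eq_bot_iff]
      rintro _ ⟨i, rfl⟩
      exact tu_of_le (by omega)
    rw [this] at ht
    exact ht
  | succ n ih =>
    obtain ⟨t', ht', k, hk, rfl⟩ := Virt_normal_form ht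
    have h1 : toPerm (n + 1) (WeldedBraid.addRight t' * cyc n k) (n + 1 - k) = n + 1 := by
      rw [map_mul, toPerm_addRight, Perm.mul_apply, toPerm_cyc hk,
        toPerm_mem_Pm ht' _ (by omega)]
    rw [h, Perm.one_apply] at h1
    obtain rfl : k = 0 := by omega
    simp only [cyc, mul_one, toPerm_addRight] at h ⊢
    rw [ih ht' h, map_one]

theorem exists_Virt {n : ℕ} {π : Perm ℕ} (h : π ∈ Pm n) : ∃ t ∈ Virt n, toPerm n t = π := by
  induction n generalizing π with
  | zero =>
    refine ⟨1, one_mem _, ?_⟩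
    ext i
    rw [map_one, Perm.one_apply]
    rcases Nat.eq_zero_or_pos i with rfl | hi
    · exact (Nat.le_zero.mp (Pm_le h le_rfl)).symm
    · rw [h i hi]
  | succ n ih =>
    have hm : π⁻¹ (n + 1) ≤ n + 1 := Pm_le (inv_mem h) le_rfl
    have hc : cyc n (n + 1 - π⁻¹ (n + 1)) ∈ Virt (n + 1) := by
      generalize n + 1 - π⁻¹ (n + 1) = k
      induction k with
      | zero => exact one_mem _
      | succ k ih => exact mul_mem ih (tu_mem_Virt _ _)
    have h1 : toPerm (n + 1) (cyc n (n + 1 - π⁻¹ (n + 1))) (π⁻¹ (n + 1)) = n + 1 := by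
      have := toPerm_cyc (n := n) (k := n + 1 - π⁻¹ (n + 1)) (by omega)
      rwa [Nat.sub_sub_self hm] at this
    obtain ⟨t', ht', e⟩ := ih (π := π * (toPerm (n + 1) (cyc n (n + 1 - π⁻¹ (n + 1))))⁻¹)
      (Pm_of_fix (mul_mem h (inv_mem (toPerm_mem_Pm hc))) (by
        rw [Perm.mul_apply, (Perm.inv_eq_iff_eq (f := toPerm (n + 1) _)).mpr h1.symm]
        simp))
    exact ⟨_, mul_mem (addRight_mem_Virt ht') hc, by rw [map_mul, toPerm_addRight, e]; simp⟩

open Classical in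
/-- The virtual braid with a given permutation of the positions `0, …, n`; it is `1` when the
permutation moves other numbers. It is unique by `Virt_eq_one`. -/
noncomputable def vb (n : ℕ) (π : Perm ℕ) : WeldedBraid n :=
  if h : π ∈ Pm n then (exists_Virt h).choose else 1

theorem vb_mem {n : ℕ} {π : Perm ℕ} (h : π ∈ Pm n) : vb n π ∈ Virt n := by
  rw [vb, dif_pos h]; exact (exists_Virt h).choose_spec.1

theorem toPerm_vb {n : ℕ} {π : Perm ℕ} (h : π ∈ Pm n) : toPerm n (vb n π) = π := by
  rw [vb, dif_pos h]; exact (exists_Virt h).choose_spec.2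

theorem vb_unique {n : ℕ} {t : WeldedBraid n} (ht : t ∈ Virt n) : vb n (toPerm n t) = t := by
  have h := toPerm_mem_Pm ht
  rw [← mul_inv_eq_one]
  exact Virt_eq_one (mul_mem (vb_mem h) (inv_mem ht)) (by rw [map_mul, map_inv, toPerm_vb h]; simp)

theorem vb_mul {n : ℕ} {π ρ : Perm ℕ} (h : π ∈ Pm n) (h' : ρ ∈ Pm n) :
    vb n (π * ρ) = vb n π * vb n ρ := by
  conv_lhs => rw [← toPerm_vb h, ← toPerm_vb h', ← map_mul]
  exact vb_unique (mul_mem (vb_mem h) (vb_mem h'))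

theorem vb_one (n : ℕ) : vb n 1 = 1 := by
  have := vb_unique (one_mem (Virt n))
  rwa [map_one] at this

theorem vb_inv {n : ℕ} {π : Perm ℕ} (h : π ∈ Pm n) : vb n π⁻¹ = (vb n π)⁻¹ := by
  rw [eq_inv_iff_mul_eq_one, ← vb_mul (inv_mem h) h, inv_mul_cancel, vb_one]

theorem vb_swap {n i : ℕ} (h : i < n) : vb n (swap i (i + 1)) = tu n i := by
  rw [← toPerm_tu h]; exact vb_unique (tu_mem_Virt _ _)

theorem addRight_vb {n : ℕ} {π : Perm ℕ} (h : π ∈ Pm n) :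
    WeldedBraid.addRight (vb n π) = vb (n + 1) π := by
  rw [← vb_unique (addRight_mem_Virt (vb_mem h)), toPerm_addRight, toPerm_vb h]

theorem vb_swap_swap {n a b : ℕ} (ha : a ≤ n) (hb : b ≤ n) :
    vb n (swap a b) * vb n (swap a b) = 1 := by
  rw [← vb_mul (swap_mem_Pm ha hb) (swap_mem_Pm ha hb), Equiv.swap_mul_self, vb_one]

/-! ### Arrows in the welded braid group -/

/-- A permutation of `0, …, n` can be changed so that it takes a prescribed value at `m`, without
changing it at the points where it does not take this value. -/
theorem exists_extend {n m a : ℕ} {ρ : Perm ℕ} (h : ρ ∈ Pm n) (hm : m ≤ n) (ha : a ≤ n) :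
    ∃ ρ' ∈ Pm n, ρ' m = a ∧ ∀ p, p ≠ m → ρ p ≠ a → ρ' p = ρ p := by
  refine ⟨ρ * swap m (ρ⁻¹ a), mul_mem h (swap_mem_Pm hm (Pm_le (inv_mem h) ha)), by simp, ?_⟩
  intro p hp hp'
  rw [Perm.mul_apply, Equiv.swap_apply_of_ne_of_ne hp]
  rintro rfl
  simp at hp'

theorem exists_perm₂ {n p q a b : ℕ} (hp : p ≤ n) (hq : q ≤ n) (hpq : p ≠ q)
    (ha : a ≤ n) (hb : b ≤ n) (hab : a ≠ b) : ∃ ρ ∈ Pm n, ρ p = a ∧ ρ q = b := by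
  obtain ⟨ρ, h, h1, -⟩ := exists_extend (one_mem (Pm n)) hp ha
  obtain ⟨ρ', h', h2, h3⟩ := exists_extend h hq hb
  exact ⟨ρ', h', by rw [h3 p hpq (by rw [h1]; exact hab), h1], h2⟩

theorem exists_perm₃ {n a b c : ℕ} (ha : a ≤ n) (hb : b ≤ n) (hc : c ≤ n) (hab : a ≠ b)
    (hac : a ≠ c) (hbc : b ≠ c) : ∃ ρ ∈ Pm n, ρ 0 = a ∧ ρ 1 = b ∧ ρ 2 = c := by
  obtain ⟨ρ, h, h1, h2⟩ := exists_perm₂ (p := 0) (q := 1) (by omega) (by omega) (by omega) ha hb hab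
  obtain ⟨ρ', h', h3, h4⟩ := exists_extend (m := 2) h (by omega) hc
  exact ⟨ρ', h', by rw [h4 0 (by omega) (by rwa [h1]), h1],
    by rw [h4 1 (by omega) (by rwa [h2]), h2], h3⟩

theorem exists_perm₄ {n a b c d : ℕ} (ha : a ≤ n) (hb : b ≤ n) (hc : c ≤ n) (hd : d ≤ n)
    (hab : a ≠ b) (hac : a ≠ c) (hbc : b ≠ c) (had : a ≠ d) (hbd : b ≠ d) (hcd : c ≠ d) :
    ∃ ρ ∈ Pm n, ρ 0 = a ∧ ρ 1 = b ∧ ρ 2 = c ∧ ρ 3 = d := by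
  obtain ⟨ρ, h, h1, h2, h3⟩ := exists_perm₃ ha hb hc hab hac hbc
  obtain ⟨ρ', h', h4, h5⟩ := exists_extend (m := 3) h (by omega) hd
  exact ⟨ρ', h', by rw [h5 0 (by omega) (by rwa [h1]), h1],
    by rw [h5 1 (by omega) (by rwa [h2]), h2], by rw [h5 2 (by omega) (by rwa [h3]), h3], h4⟩

theorem mem_closure_neighbours {n : ℕ} {π : Perm ℕ} (h : π ∈ Pm n) (h0 : π 0 = 0) (h1 : π 1 = 1) :
    π ∈ Subgroup.closure {σ : Perm ℕ | ∃ i, 2 ≤ i ∧ i < n ∧ σ = swap i (i + 1)} := by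
  set S := {σ : Perm ℕ | ∃ i, 2 ≤ i ∧ i < n ∧ σ = swap i (i + 1)} with hS
  rw [mem_closure_isSwap]
  · refine ⟨(Set.finite_Iic n).subset ?_, ?_⟩
    · intro x hx
      by_contra hc
      exact hx (h x (by simpa using hc))
    · have up : ∀ x y, 2 ≤ x → x ≤ y → y ≤ n → y ∈ MulAction.orbit (Subgroup.closure S) x := by
        intro x y hx hxy
        induction y, hxy using Nat.le_induction with
        | base => intro _; exact MulAction.mem_orbit_self x
        | succ y hxy ih =>
          intro hy
          obtain ⟨g, hg⟩ := ih (by omega)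
          refine ⟨⟨swap y (y + 1), Subgroup.subset_closure ⟨y, by omega, by omega, rfl⟩⟩ * g, ?_⟩
          simp only [mul_smul]
          simp only at hg
          rw [hg]
          exact Equiv.swap_apply_left _ _
      intro x
      rcases Nat.lt_or_ge n x with hn | hn
      · rw [h x hn]; exact MulAction.mem_orbit_self x
      have hx : x = 0 ∨ x = 1 ∨ 2 ≤ x := by omega
      rcases hx with rfl | rfl | hx
      · rw [h0]; exact MulAction.mem_orbit_self _
      · rw [h1]; exact MulAction.mem_orbit_self _
      · have hy : 2 ≤ π x := by
          by_contra hc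
          rcases (show π x = 0 ∨ π x = 1 by omega) with e | e
          · have := π.injective (e.trans h0.symm); omega
          · have := π.injective (e.trans h1.symm); omega
        rcases le_total x (π x) with hle | hle
        · exact up x _ hx hle (Pm_le h hn)
        · exact MulAction.mem_orbit_symm.mp (up _ x hy hle hn)
  · rintro _ ⟨i, -, -, rfl⟩
    exact ⟨i, i + 1, by omega, rfl⟩

/-- A virtual braid that fixes the first two strands commutes with a crossing of these strands,
because it is a product of generators with indices at least `2`. -/
theorem vb_comm_base {n : ℕ} {π : Perm ℕ} (h : π ∈ Pm n) (h0 : π 0 = 0) (h1 : π 1 = 1) :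
    Commute (vb n π) (sg n 0 * tu n 0) := by
  suffices π ∈ Pm n ∧ Commute (vb n π) (sg n 0 * tu n 0) from this.2
  have hπ := mem_closure_neighbours h h0 h1
  clear h h0 h1
  induction hπ using Subgroup.closure_induction with
  | mem σ hσ =>
    obtain ⟨i, hi, hin, rfl⟩ := hσ
    refine ⟨swap_mem_Pm (by omega) (by omega), ?_⟩
    rw [vb_swap hin]
    exact (show Commute _ _ from (sg_tu_comm (by omega)).symm).mul_right (tu_comm (by omega))
  | one => exact ⟨one_mem _, by rw [vb_one]; exact Commute.one_left _⟩
  | mul a b _ _ ha hb => exact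
      ⟨mul_mem ha.1 hb.1, by rw [vb_mul ha.1 hb.1]; exact ha.2.mul_left hb.2⟩
  | inv a _ ha => exact ⟨inv_mem ha.1, by rw [vb_inv ha.1]; exact ha.2.inv_left⟩

/-- The welded braid in which the strand at position `i` passes over the strand at position `j` and
all strands return virtually to their positions; so `arr n 1 0 = σ_0 τ_0`, and the other arrows are
conjugate to it by virtual braids. -/
noncomputable def arr (n i j : ℕ) : WeldedBraid n :=
  vb n (swap 0 j * swap 1 (swap 0 j i)) * (sg n 0 * tu n 0) *
    (vb n (swap 0 j * swap 1 (swap 0 j i)))⁻¹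

theorem arr_perm_spec {n i j : ℕ} (hi : i ≤ n) (hj : j ≤ n) (hij : i ≠ j) :
    swap 0 j * swap 1 (swap 0 j i) ∈ Pm n ∧ (swap 0 j * swap 1 (swap 0 j i)) 1 = i ∧
      (swap 0 j * swap 1 (swap 0 j i)) 0 = j := by
  have h0 : swap 0 j ∈ Pm n := swap_mem_Pm (by omega) hj
  refine ⟨mul_mem h0 (swap_mem_Pm (by omega) (Pm_le h0 hi)), by simp, ?_⟩
  rw [Perm.mul_apply, Equiv.swap_apply_of_ne_of_ne (a := 1) (x := 0) (by omega),
    Equiv.swap_apply_left]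
  intro h
  rw [eq_comm, Equiv.swap_apply_eq_iff, Equiv.swap_apply_left] at h
  exact hij h

/-- Conjugation by a virtual braid renames the strands of an arrow. -/
theorem vb_arr {n i j : ℕ} {π : Perm ℕ} (h : π ∈ Pm n) (hi : i ≤ n) (hj : j ≤ n) (hij : i ≠ j) :
    vb n π * arr n i j = arr n (π i) (π j) * vb n π := by
  have hπ : π i ≠ π j := fun e => hij (π.injective e)
  obtain ⟨p1, p2, p3⟩ := arr_perm_spec hi hj hij
  obtain ⟨q1, q2, q3⟩ := arr_perm_spec (Pm_le h hi) (Pm_le h hj) hπ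
  rw [arr, arr]
  generalize swap 0 j * swap 1 (swap 0 j i) = p at *
  generalize swap 0 (π j) * swap 1 (swap 0 (π j) (π i)) = q at *
  have hc : Commute (vb n (q⁻¹ * π * p)) (sg n 0 * tu n 0) := by
    refine vb_comm_base (mul_mem (mul_mem (inv_mem q1) h) p1) ?_ ?_
    · rw [Perm.mul_apply, Perm.mul_apply, p3, ← q3]; simp
    · rw [Perm.mul_apply, Perm.mul_apply, p2, ← q2]; simp
  have e := hc.eq
  rw [vb_mul (mul_mem (inv_mem q1) h) p1, vb_mul (inv_mem q1) h, vb_inv q1] at e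
  generalize sg n 0 * tu n 0 = z at *
  have e2 := congrArg (fun b => vb n q * b * (vb n p)⁻¹) e
  simpa [mul_assoc] using e2

theorem arr_succ {n i : ℕ} (h : i < n) : arr n (i + 1) i = sg n i * tu n i := by
  induction i with
  | zero => simp [arr, vb_one, ← Perm.one_def]
  | succ i ih =>
    have hs := swap_mem_Pm (n := n) (a := i) (b := i + 1) (by omega) (by omega)
    have hs' := swap_mem_Pm (n := n) (a := i + 1) (b := i + 1 + 1) (by omega) (by omega)
    have e := vb_arr (n := n) (π := swap i (i + 1) * swap (i + 1) (i + 1 + 1)) (i := i + 1) (j := i)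
      (mul_mem hs hs') (by omega) (by omega) (by omega)
    rw [vb_mul hs hs', vb_swap (by omega), vb_swap h, ih (by omega)] at e
    have e1 : (swap i (i + 1) * swap (i + 1) (i + 1 + 1)) (i + 1) = i + 1 + 1 := by
      rw [Perm.mul_apply, Equiv.swap_apply_left,
        Equiv.swap_apply_of_ne_of_ne (by omega) (by omega)]
    have e2 : (swap i (i + 1) * swap (i + 1) (i + 1 + 1)) i = i + 1 := by
      rw [Perm.mul_apply, Equiv.swap_apply_of_ne_of_ne (a := i + 1) (x := i) (by omega) (by omega),
        Equiv.swap_apply_left]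
    rw [e1, e2] at e
    have b1 := mixed_braid' h
    have b2 := tu_braid h
    apply mul_right_cancel (b := tu n i * tu n (i + 1))
    rw [← e]
    calc _ = (tu n i * tu n (i + 1) * sg n i) * tu n i := by simp only [mul_assoc]
      _ = sg n (i + 1) * (tu n i * tu n (i + 1) * tu n i) := by rw [b1]; simp only [mul_assoc]
      _ = _ := by rw [b2]; simp only [mul_assoc]

/-- A property of arrows at some positions may be checked at other positions. -/
theorem conj_transfer {n : ℕ} {x y x' y' c : WeldedBraid n} (hx : c * x = x' * c)
    (hy : c * y = y' * c) (h : x = y) : x' = y' := by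
  apply mul_right_cancel (b := c)
  rw [← hx, ← hy, h]

theorem conj_mul {n : ℕ} {x y x' y' c : WeldedBraid n} (hx : c * x = x' * c)
    (hy : c * y = y' * c) : c * (x * y) = x' * y' * c := by
  rw [← mul_assoc, hx, mul_assoc, hy, mul_assoc]

theorem arr_comm_disjoint {n i j k l : ℕ} (hi : i ≤ n) (hj : j ≤ n) (hk : k ≤ n) (hl : l ≤ n)
    (hij : i ≠ j) (hik : i ≠ k) (hil : i ≠ l) (hjk : j ≠ k) (hjl : j ≠ l) (hkl : k ≠ l) :
    Commute (arr n i j) (arr n k l) := by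
  obtain ⟨ρ, hρ, rfl, rfl, rfl, rfl⟩ := exists_perm₄ hj hi hl hk hij.symm hjl hil hjk hik hkl.symm
  have hn : 3 ≤ n := by
    by_contra hc
    have := hρ 3 (by omega)
    omega
  have a1 := vb_arr hρ (show 1 ≤ n by omega) (show 0 ≤ n by omega) (by omega)
  have a2 := vb_arr hρ (show 3 ≤ n by omega) (show 2 ≤ n by omega) (by omega)
  refine conj_transfer (conj_mul a1 a2) (conj_mul a2 a1) ?_
  rw [arr_succ (i := 0) (by omega), arr_succ (i := 2) (by omega)]
  have c1 : Commute (sg n 0) (sg n 2) := sg_comm (by omega)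
  have c2 : Commute (sg n 0) (tu n 2) := sg_tu_comm (by omega)
  have c3 : Commute (tu n 0) (sg n 2) := (sg_tu_comm (by omega)).symm
  have c4 : Commute (tu n 0) (tu n 2) := tu_comm (by omega)
  exact ((c1.mul_right c2).mul_left (c3.mul_right c4)).eq

theorem arr_two_zero {n : ℕ} (hn : 2 ≤ n) :
    arr n 2 0 = tu n 1 * (sg n 0 * tu n 0) * tu n 1 := by
  have e := vb_arr (n := n) (π := swap 1 2) (i := 1) (j := 0) (swap_mem_Pm (by omega) (by omega))
    (by omega) (by omega) (by omega)
  rw [vb_swap (i := 1) (by omega), arr_succ (i := 0) (by omega), Equiv.swap_apply_left,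
    Equiv.swap_apply_of_ne_of_ne (by omega) (by omega)] at e
  rw [e, mul_assoc, tu_tu, mul_one]

theorem arr_product {n : ℕ} (hn : 2 ≤ n) :
    arr n 2 1 * arr n 2 0 = sg n 1 * sg n 0 * tu n 0 * tu n 1 := by
  rw [arr_two_zero hn, arr_succ (i := 1) (by omega)]
  simp only [mul_assoc, tu_cancel]

/-- Arrows with the same over-strand commute: this is the welded relation. -/
theorem arr_comm_tails {n i j k : ℕ} (hi : i ≤ n) (hj : j ≤ n) (hk : k ≤ n)
    (hij : i ≠ j) (hik : i ≠ k) : Commute (arr n i j) (arr n i k) := by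
  rcases eq_or_ne j k with rfl | hjk
  · exact Commute.refl _
  obtain ⟨ρ, hρ, rfl, rfl, rfl⟩ := exists_perm₃ hk hj hi hjk.symm hik.symm hij.symm
  have hn : 2 ≤ n := by
    by_contra hc
    have := hρ 2 (by omega)
    omega
  have a1 := vb_arr hρ (show 2 ≤ n by omega) (show 1 ≤ n by omega) (by omega)
  have a2 := vb_arr hρ (show 2 ≤ n by omega) (show 0 ≤ n by omega) (by omega)
  refine conj_transfer (conj_mul a1 a2) (conj_mul a2 a1) ?_
  have hs := swap_mem_Pm (n := n) (a := 0) (b := 1) (by omega) (by omega)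
  have b1 := vb_arr (i := 2) (j := 1) hs (by omega) (by omega) (by omega)
  have b2 := vb_arr (i := 2) (j := 0) hs (by omega) (by omega) (by omega)
  rw [vb_swap (i := 0) (by omega)] at b1 b2
  rw [Equiv.swap_apply_right, Equiv.swap_apply_of_ne_of_ne (by omega) (by omega)] at b1
  rw [Equiv.swap_apply_left, Equiv.swap_apply_of_ne_of_ne (by omega) (by omega)] at b2
  have key := conj_mul b1 b2
  apply mul_right_cancel (b := tu n 0)
  rw [← key, arr_product hn]
  have w := welded_braid (n := n) (i := 0) (by omega)
  have t := tu_braid (n := n) (i := 0) (by omega)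
  simp only [zero_add] at w t
  calc _ = sg n 1 * sg n 0 * (tu n 0 * tu n 1 * tu n 0) := by simp only [mul_assoc]
    _ = (sg n 1 * sg n 0 * tu n 1) * tu n 0 * tu n 1 := by rw [t]; simp only [mul_assoc]
    _ = _ := by rw [← w]; simp only [mul_assoc]

/-- A strand `i` that passes over both strands of an arrow may be moved past this arrow. -/
theorem arr_comm_triangle {n i j k : ℕ} (hi : i ≤ n) (hj : j ≤ n) (hk : k ≤ n)
    (hij : i ≠ j) (hik : i ≠ k) (hjk : j ≠ k) :
    Commute (arr n i j * arr n i k) (arr n j k) := by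
  obtain ⟨ρ, hρ, rfl, rfl, rfl⟩ := exists_perm₃ hk hj hi hjk.symm hik.symm hij.symm
  have hn : 2 ≤ n := by
    by_contra hc
    have := hρ 2 (by omega)
    omega
  have a1 := vb_arr hρ (show 2 ≤ n by omega) (show 1 ≤ n by omega) (by omega)
  have a2 := vb_arr hρ (show 2 ≤ n by omega) (show 0 ≤ n by omega) (by omega)
  have a3 := vb_arr hρ (show 1 ≤ n by omega) (show 0 ≤ n by omega) (by omega)
  refine conj_transfer (conj_mul (conj_mul a1 a2) a3) (conj_mul a3 (conj_mul a1 a2)) ?_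
  rw [arr_product hn, arr_succ (i := 0) (by omega)]
  have w := welded_braid (n := n) (i := 0) (by omega)
  have t := tu_braid (n := n) (i := 0) (by omega)
  have s := sg_braid (n := n) (i := 0) (by omega)
  have m := mixed_braid' (n := n) (i := 0) (by omega)
  simp only [zero_add] at w t s m
  calc _ = sg n 1 * sg n 0 * (tu n 0 * tu n 1 * sg n 0) * tu n 0 := by simp only [mul_assoc]
    _ = (sg n 1 * sg n 0 * sg n 1) * (tu n 0 * tu n 1 * tu n 0) := by
      rw [m]; simp only [mul_assoc]
    _ = sg n 0 * (sg n 1 * sg n 0 * tu n 1) * tu n 0 * tu n 1 := by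
      rw [t, ← s]; simp only [mul_assoc]
    _ = _ := by rw [← w]; simp only [mul_assoc]

theorem addRight_arr {n i j : ℕ} (hi : i ≤ n) (hj : j ≤ n) (hij : i ≠ j) :
    WeldedBraid.addRight (arr n i j) = arr (n + 1) i j := by
  rw [arr, arr, map_mul, map_mul, map_mul, map_inv, addRight_vb (arr_perm_spec hi hj hij).1,
    addRight_sg (by omega), addRight_tu (by omega)]

/-! ### Words in arrows -/

/-- A real crossing of a Gauss diagram: an arrow from the over-strand to the under-strand, with the
sign of the crossing. -/
structure Arrow (X : Type) : Type where
  tail : X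
  head : X
  pos : Bool

/-- The arrow with other strand labels. -/
def Arrow.map {X Y : Type} (f : X → Y) (a : Arrow X) : Arrow Y := ⟨f a.tail, f a.head, a.pos⟩

/-- The welded braid of an arrow between strands labelled by their positions. -/
noncomputable def Arrow.ev (n : ℕ) (a : Arrow ℕ) : WeldedBraid n :=
  if a.pos then arr n a.tail a.head else (arr n a.tail a.head)⁻¹

/-- The welded braid of a word in arrows. -/
noncomputable def wd (n : ℕ) (A : List (Arrow ℕ)) : WeldedBraid n := (A.map (Arrow.ev n)).prod

/-- The arrow connects two different positions among `0, …, n`. -/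
def Arrow.Ok (n : ℕ) (a : Arrow ℕ) : Prop := a.tail ≤ n ∧ a.head ≤ n ∧ a.tail ≠ a.head

theorem wd_nil (n : ℕ) : wd n [] = 1 := rfl

theorem wd_cons (n : ℕ) (a : Arrow ℕ) (A : List (Arrow ℕ)) : wd n (a :: A) = a.ev n * wd n A := rfl

theorem wd_append (n : ℕ) (A B : List (Arrow ℕ)) : wd n (A ++ B) = wd n A * wd n B := by
  simp [wd]

theorem vb_ev {n : ℕ} {π : Perm ℕ} (h : π ∈ Pm n) {a : Arrow ℕ} (ha : a.Ok n) :
    vb n π * a.ev n = (a.map π).ev n * vb n π := by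
  have e := vb_arr h ha.1 ha.2.1 ha.2.2
  unfold Arrow.ev Arrow.map
  split_ifs with hp
  · exact e
  · rw [eq_inv_mul_iff_mul_eq, ← mul_assoc, ← e]; group

theorem vb_wd {n : ℕ} {π : Perm ℕ} (h : π ∈ Pm n) {A : List (Arrow ℕ)}
    (hA : ∀ a ∈ A, a.Ok n) : vb n π * wd n A = wd n (A.map (Arrow.map π)) * vb n π := by
  induction A with
  | nil => simp [wd]
  | cons a A ih =>
    rw [List.forall_mem_cons] at hA
    exact conj_mul (vb_ev h hA.1) (ih hA.2)

theorem Arrow.Ok.map {n : ℕ} {π : Perm ℕ} (h : π ∈ Pm n) {a : Arrow ℕ} (ha : a.Ok n) :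
    (a.map π).Ok n := ⟨Pm_le h ha.1, Pm_le h ha.2.1, fun e => ha.2.2 (π.injective e)⟩

theorem addRight_wd {n : ℕ} {A : List (Arrow ℕ)} (hA : ∀ a ∈ A, a.Ok n) :
    WeldedBraid.addRight (wd n A) = wd (n + 1) A := by
  induction A with
  | nil => simp [wd]
  | cons a A ih =>
    rw [List.forall_mem_cons] at hA
    rw [wd_cons, wd_cons, map_mul, ih hA.2]
    congr 1
    unfold Arrow.ev
    split_ifs
    · exact addRight_arr hA.1.1 hA.1.2.1 hA.1.2.2
    · rw [map_inv, addRight_arr hA.1.1 hA.1.2.1 hA.1.2.2]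

/-- The arrows have no strand in common. -/
def Arrow.Disj {X : Type} (a b : Arrow X) : Prop :=
  a.tail ≠ b.tail ∧ a.tail ≠ b.head ∧ a.head ≠ b.tail ∧ a.head ≠ b.head

theorem ev_comm_of_arr {n : ℕ} {a b : Arrow ℕ}
    (h : Commute (arr n a.tail a.head) (arr n b.tail b.head)) : Commute (a.ev n) (b.ev n) := by
  unfold Arrow.ev
  split_ifs
  · exact h
  · exact h.inv_right
  · exact h.inv_left
  · exact h.inv_left.inv_right

theorem ev_comm_disjoint {n : ℕ} {a b : Arrow ℕ} (ha : a.Ok n) (hb : b.Ok n) (h : a.Disj b) :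
    Commute (a.ev n) (b.ev n) :=
  ev_comm_of_arr (arr_comm_disjoint ha.1 ha.2.1 hb.1 hb.2.1 ha.2.2 h.1 h.2.1 h.2.2.1 h.2.2.2 hb.2.2)

theorem ev_comm_tails {n : ℕ} {a b : Arrow ℕ} (ha : a.Ok n) (hb : b.Ok n) (h : a.tail = b.tail) :
    Commute (a.ev n) (b.ev n) := by
  refine ev_comm_of_arr ?_
  rw [← h]
  exact arr_comm_tails ha.1 ha.2.1 hb.2.1 ha.2.2 (h ▸ hb.2.2)

theorem ev_mul_neg (n i j : ℕ) (e : Bool) :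
    (⟨i, j, e⟩ : Arrow ℕ).ev n * (⟨i, j, !e⟩ : Arrow ℕ).ev n = 1 := by
  cases e <;> simp [Arrow.ev]

/-! ### Destabilization of a closed strand -/

theorem BraidsRelated.refl (b : Σ n, WeldedBraid n) : BraidsRelated b b := Relation.EqvGen.refl _

theorem BraidsRelated.symm {b c : Σ n, WeldedBraid n} (h : BraidsRelated b c) :
    BraidsRelated c b := Relation.EqvGen.symm _ _ h

theorem BraidsRelated.trans {b c d : Σ n, WeldedBraid n} (h : BraidsRelated b c)
    (h' : BraidsRelated c d) : BraidsRelated b d := Relation.EqvGen.trans _ _ _ h h'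

theorem braidsRelated_comm {n : ℕ} (a b : WeldedBraid n) :
    BraidsRelated ⟨n, a * b⟩ ⟨n, b * a⟩ := by
  have h := BraidMove.conj (a * b) a
  rw [← mul_assoc, inv_mul_cancel, one_mul] at h
  exact .rel _ _ h

theorem braidsRelated_of_conj {n : ℕ} {a b c : WeldedBraid n} (h : c * a = b * c) :
    BraidsRelated ⟨n, a⟩ ⟨n, b⟩ := by
  have h' := braidsRelated_comm (c * a) c⁻¹
  rw [inv_mul_cancel_left, h, mul_inv_cancel_right] at h'
  exact h'.symm

/-- The last letter of a right stabilization of degree `m + 1`, placed at the strands `m` and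
`m + 1`. -/
inductive StabLetter (m : ℕ) : WeldedBraid (m + 1) → Prop
  | pos : StabLetter m (sg (m + 1) m)
  | neg : StabLetter m (sg (m + 1) m)⁻¹
  | virt : StabLetter m (tu (m + 1) m)

theorem StabLetter.related {m : ℕ} {L : WeldedBraid (m + 1)} (h : StabLetter m L)
    (V : WeldedBraid m) : BraidsRelated ⟨m + 1, L * WeldedBraid.addRight V⟩ ⟨m, V⟩ := by
  refine (braidsRelated_comm _ _).trans ?_
  have e1 := sg_fin (Fin.last m)
  have e2 := tu_fin (Fin.last m)
  rw [Fin.val_last] at e1 e2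
  cases h
  · rw [e1]; exact Relation.EqvGen.symm _ _ (.rel _ _ (.stab_pos V))
  · rw [e1]; exact Relation.EqvGen.symm _ _ (.rel _ _ (.stab_neg V))
  · rw [e2]; exact Relation.EqvGen.symm _ _ (.rel _ _ (.stab_virt V))

/-- Destabilization up to conjugation: `c` carries `K` to the last letter of a stabilization, and
the rest `U` of the braid to a braid that does not use the last strand. -/
theorem destab {m : ℕ} {K L U : WeldedBraid (m + 1)} {V : WeldedBraid m} {c : WeldedBraid (m + 1)}
    (hL : StabLetter m L) (hK : c * K = L * c) (hU : c * U = WeldedBraid.addRight V * c) :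
    BraidsRelated ⟨m + 1, K * U⟩ ⟨m, V⟩ :=
  (braidsRelated_of_conj (conj_mul hK hU)).trans (hL.related V)

/-- The welded braids in which the strand labelled `y` has no real crossing and returns to its
position. -/
def Avoid (n y : ℕ) : Subgroup (WeldedBraid n) :=
  Subgroup.closure ({b | ∃ i j, i ≤ n ∧ j ≤ n ∧ i ≠ j ∧ i ≠ y ∧ j ≠ y ∧ b = arr n i j} ∪
    {b | ∃ π ∈ Pm n, π y = y ∧ b = vb n π})

theorem vb_mem_Avoid {n y : ℕ} {π : Perm ℕ} (h : π ∈ Pm n) (hy : π y = y) :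
    vb n π ∈ Avoid n y := Subgroup.subset_closure (Or.inr ⟨π, h, hy, rfl⟩)

theorem ev_mem_Avoid {n y : ℕ} {a : Arrow ℕ} (h : a.Ok n) (h1 : a.tail ≠ y) (h2 : a.head ≠ y) :
    a.ev n ∈ Avoid n y := by
  have : arr n a.tail a.head ∈ Avoid n y :=
    Subgroup.subset_closure (Or.inl ⟨_, _, h.1, h.2.1, h.2.2, h1, h2, rfl⟩)
  unfold Arrow.ev
  split_ifs
  · exact this
  · exact inv_mem this

theorem wd_mem_Avoid {n y : ℕ} {A : List (Arrow ℕ)}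
    (h : ∀ a ∈ A, a.Ok n ∧ a.tail ≠ y ∧ a.head ≠ y) : wd n A ∈ Avoid n y := by
  refine Subgroup.list_prod_mem _ ?_
  intro b hb
  obtain ⟨a, ha, rfl⟩ := List.mem_map.mp hb
  exact ev_mem_Avoid (h a ha).1 (h a ha).2.1 (h a ha).2.2

/-- Conjugation by a virtual braid renames the avoided strand. -/
theorem Avoid_conj {n y : ℕ} {ρ : Perm ℕ} (h : ρ ∈ Pm n) {U : WeldedBraid n}
    (hU : U ∈ Avoid n y) : ∃ U' ∈ Avoid n (ρ y), vb n ρ * U = U' * vb n ρ := by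
  induction hU using Subgroup.closure_induction with
  | mem x hx =>
    rcases hx with ⟨i, j, hi, hj, hij, hiy, hjy, rfl⟩ | ⟨π, hπ, hy, rfl⟩
    · exact ⟨_, Subgroup.subset_closure (Or.inl ⟨_, _, Pm_le h hi, Pm_le h hj,
        fun e => hij (ρ.injective e), fun e => hiy (ρ.injective e), fun e => hjy (ρ.injective e),
        rfl⟩), vb_arr h hi hj hij⟩
    · have hm := mul_mem (mul_mem h hπ) (inv_mem h)
      refine ⟨vb n (ρ * π * ρ⁻¹), vb_mem_Avoid hm (by simp [hy]), ?_⟩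
      rw [← vb_mul h hπ, ← vb_mul hm h, inv_mul_cancel_right]
  | one => exact ⟨1, one_mem _, by simp⟩
  | mul a b _ _ ha hb =>
    obtain ⟨a', ha', ea⟩ := ha
    obtain ⟨b', hb', eb⟩ := hb
    exact ⟨_, mul_mem ha' hb', conj_mul ea eb⟩
  | inv a _ ha =>
    obtain ⟨a', ha', ea⟩ := ha
    exact ⟨a'⁻¹, inv_mem ha', by rw [mul_inv_eq_iff_eq_mul, mul_assoc, ea, inv_mul_cancel_left]⟩

theorem Avoid_last {m : ℕ} {U : WeldedBraid (m + 1)} (hU : U ∈ Avoid (m + 1) (m + 1)) :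
    ∃ V, U = WeldedBraid.addRight V := by
  induction hU using Subgroup.closure_induction with
  | mem x hx =>
    rcases hx with ⟨i, j, hi, hj, hij, hiy, hjy, rfl⟩ | ⟨π, hπ, hy, rfl⟩
    · exact ⟨arr m i j, (addRight_arr (by omega) (by omega) hij).symm⟩
    · exact ⟨vb m π, (addRight_vb (Pm_of_fix hπ hy)).symm⟩
  | one => exact ⟨1, by simp⟩
  | mul a b _ _ ha hb =>
    obtain ⟨a', rfl⟩ := ha
    obtain ⟨b', rfl⟩ := hb
    exact ⟨a' * b', by simp⟩
  | inv a _ ha =>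
    obtain ⟨a', rfl⟩ := ha
    exact ⟨a'⁻¹, by simp⟩

/-- When the avoided strand is moved to the last position, the braid comes from a braid with one
strand less. -/
theorem Avoid_lift {m y : ℕ} {ρ : Perm ℕ} (h : ρ ∈ Pm (m + 1)) (hy : ρ y = m + 1)
    {U : WeldedBraid (m + 1)} (hU : U ∈ Avoid (m + 1) y) :
    ∃ V, vb (m + 1) ρ * U = WeldedBraid.addRight V * vb (m + 1) ρ := by
  obtain ⟨U', hU', e⟩ := Avoid_conj h hU
  rw [hy] at hU'
  obtain ⟨V, rfl⟩ := Avoid_last hU'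
  exact ⟨V, e⟩

theorem vb_conj_swap {n x y : ℕ} {ρ : Perm ℕ} (h : ρ ∈ Pm n) (hx : x ≤ n) (hy : y ≤ n) :
    vb n ρ * vb n (swap x y) = vb n (swap (ρ x) (ρ y)) * vb n ρ := by
  rw [← vb_mul h (swap_mem_Pm hx hy), ← vb_mul (swap_mem_Pm (Pm_le h hx) (Pm_le h hy)) h,
    Equiv.mul_swap_eq_swap_mul]

/-- An element that joins the strands `x` and `y` like a virtual crossing, or like a real crossing
that may be removed by a destabilization. -/
inductive Joint (n x y : ℕ) : WeldedBraid n → Prop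
  | virt : Joint n x y (vb n (swap x y))
  | pos : Joint n x y ((⟨y, x, true⟩ : Arrow ℕ).ev n * vb n (swap x y))
  | neg : Joint n x y ((⟨x, y, false⟩ : Arrow ℕ).ev n * vb n (swap x y))

theorem Joint.conj {m x y : ℕ} {K : WeldedBraid (m + 1)} {ρ : Perm ℕ} (hK : Joint (m + 1) x y K)
    (hxy : x ≠ y) (hx : x ≤ m + 1) (hy : y ≤ m + 1) (h : ρ ∈ Pm (m + 1)) (h1 : ρ x = m)
    (h2 : ρ y = m + 1) : ∃ L, StabLetter m L ∧ vb (m + 1) ρ * K = L * vb (m + 1) ρ := by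
  have e := vb_conj_swap h hx hy
  rw [h1, h2, vb_swap (by omega)] at e
  cases hK with
  | virt => exact ⟨_, .virt, e⟩
  | pos =>
    have e' := vb_ev h (show Arrow.Ok (m + 1) ⟨y, x, true⟩ from ⟨hy, hx, hxy.symm⟩)
    refine ⟨sg (m + 1) m, .pos, ?_⟩
    rw [conj_mul e' e]
    simp only [Arrow.map, Arrow.ev, h1, h2, if_true]
    rw [arr_succ (by omega), mul_assoc (sg _ _), tu_tu, mul_one]
  | neg =>
    have e' := vb_ev h (show Arrow.Ok (m + 1) ⟨x, y, false⟩ from ⟨hx, hy, hxy⟩)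
    refine ⟨(sg (m + 1) m)⁻¹, .neg, ?_⟩
    rw [conj_mul e' e]
    simp only [Arrow.map, Arrow.ev, h1, h2]
    have e3 := vb_arr (n := m + 1) (π := swap m (m + 1)) (i := m + 1) (j := m)
      (swap_mem_Pm (by omega) (by omega)) (by omega) (by omega) (by omega)
    rw [Equiv.swap_apply_left, Equiv.swap_apply_right, vb_swap (by omega), arr_succ (by omega)]
      at e3
    have e4 : arr (m + 1) m (m + 1) = tu (m + 1) m * sg (m + 1) m := by
      apply mul_right_cancel (b := tu (m + 1) m)
      rw [← e3, mul_assoc]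
    rw [e4]
    simp [tu_inv, mul_assoc, tu_cancel]

/-- The two factors of the rest of the diagram may be exchanged: after the destabilization this is
a conjugation. -/
theorem Joint.exchange {n x y : ℕ} {K U U' : WeldedBraid n} (hK : Joint n x y K) (hxy : x ≠ y)
    (hx : x ≤ n) (hy : y ≤ n) (hU : U ∈ Avoid n y) (hU' : U' ∈ Avoid n y) :
    BraidsRelated ⟨n, K * (U * U')⟩ ⟨n, K * (U' * U)⟩ := by
  obtain ⟨m, rfl⟩ : ∃ m, n = m + 1 := ⟨n - 1, by omega⟩
  obtain ⟨ρ, hρ, h1, h2⟩ := exists_perm₂ hx hy hxy (Nat.le_succ m) le_rfl (Nat.succ_ne_self m).symm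
  obtain ⟨L, hL, eL⟩ := hK.conj hxy hx hy hρ h1 h2
  obtain ⟨V, eV⟩ := Avoid_lift hρ h2 hU
  obtain ⟨V', eV'⟩ := Avoid_lift hρ h2 hU'
  have e1 := destab hL eL (V := V * V') (by rw [map_mul]; exact conj_mul eV eV')
  have e2 := destab hL eL (V := V' * V) (by rw [map_mul]; exact conj_mul eV' eV)
  exact e1.trans ((braidsRelated_comm _ _).trans e2.symm)

theorem Joint.replace {n x y : ℕ} {K K' U : WeldedBraid n} (hK : Joint n x y K)
    (hK' : Joint n x y K') (hxy : x ≠ y) (hx : x ≤ n) (hy : y ≤ n) (hU : U ∈ Avoid n y) :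
    BraidsRelated ⟨n, K * U⟩ ⟨n, K' * U⟩ := by
  obtain ⟨m, rfl⟩ : ∃ m, n = m + 1 := ⟨n - 1, by omega⟩
  obtain ⟨ρ, hρ, h1, h2⟩ := exists_perm₂ hx hy hxy (Nat.le_succ m) le_rfl (Nat.succ_ne_self m).symm
  obtain ⟨L, hL, eL⟩ := hK.conj hxy hx hy hρ h1 h2
  obtain ⟨L', hL', eL'⟩ := hK'.conj hxy hx hy hρ h1 h2
  obtain ⟨V, eV⟩ := Avoid_lift hρ h2 hU
  exact (destab hL eL eV).trans (destab hL' eL' eV).symm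

/-- If the end of the strand `x` is joined to the beginning of the strand `y`, the closing
permutation is the transposition `(x y)` followed by a permutation that fixes `y`. -/
theorem vb_split {n x y : ℕ} {π : Perm ℕ} (h : π ∈ Pm n) (hy : y ≤ n) (hx : π y = x) :
    vb n π = vb n (swap x y) * vb n (swap x y * π) ∧ vb n (swap x y * π) ∈ Avoid n y := by
  have hxn : x ≤ n := hx ▸ Pm_le h hy
  have hs := swap_mem_Pm hxn hy
  refine ⟨by rw [vb_mul hs h, ← mul_assoc, vb_swap_swap hxn hy, one_mul],
    vb_mem_Avoid (mul_mem hs h) (by simp [hx])⟩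

/-- The point at which the long strand `x y` is cut into the strands `x` and `y` may be moved
along the strand. -/
theorem move_cut {n x y : ℕ} {π : Perm ℕ} {X W W' Z : WeldedBraid n} (h : π ∈ Pm n) (hy : y ≤ n)
    (hπ : π y = x) (hxy : x ≠ y) (hX : X ∈ Avoid n y) (hW : W ∈ Avoid n y)
    (hW' : vb n (swap x y) * W = W' * vb n (swap x y)) (hZ : Z ∈ Avoid n x) :
    BraidsRelated ⟨n, X * W * Z * vb n π⟩ ⟨n, X * W' * Z * vb n π⟩ := by
  have hxn : x ≤ n := hπ ▸ Pm_le h hy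
  have hs := swap_mem_Pm hxn hy
  obtain ⟨e, hU⟩ := vb_split h hy hπ
  obtain ⟨Z', hZ', eZ⟩ := Avoid_conj hs hZ
  rw [Equiv.swap_apply_left] at hZ'
  have tt := vb_swap_swap hxn hy
  rw [e]
  generalize vb n (swap x y * π) = U at *
  have J : Joint n x y (vb n (swap x y)) := .virt
  generalize vb n (swap x y) = t at *
  have eZ2 : Z * t = t * Z' := by
    have := congrArg (fun b => t * b * t) eZ
    simp only [mul_assoc, tt, mul_one] at this
    rw [← this, ← mul_assoc, tt, one_mul]
  have eW2 : W' = t * W * t := by rw [hW', mul_assoc, tt, mul_one]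
  have a1 : BraidsRelated ⟨n, X * W * Z * (t * U)⟩ ⟨n, t * ((Z' * U * X) * W)⟩ := by
    have := braidsRelated_comm (X * W) (t * (Z' * U))
    have e1 : X * W * Z * (t * U) = X * W * (t * (Z' * U)) := by
      rw [mul_assoc, ← mul_assoc Z, eZ2]; simp only [mul_assoc]
    rw [e1]
    convert! this using 2
    simp only [mul_assoc]
  have a2 : BraidsRelated ⟨n, X * W' * Z * (t * U)⟩ ⟨n, t * (W * (Z' * U * X))⟩ := by
    have := braidsRelated_comm X (t * W * (Z' * U))
    have e1 : X * W' * Z * (t * U) = X * (t * W * (Z' * U)) := by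
      rw [mul_assoc, ← mul_assoc Z, eZ2, eW2]
      simp only [mul_assoc]
      rw [← mul_assoc t t, tt, one_mul]
    rw [e1]
    convert! this using 2
    simp only [mul_assoc]
  exact a1.trans ((J.exchange hxy hxn hy (mul_mem (mul_mem hZ' hU) hX) hW).trans a2.symm)

/-- A kink of one of the two types that occur in a stabilization can be removed. -/
theorem remove_good_kink {n x y : ℕ} {π : Perm ℕ} {X Z : WeldedBraid n} {a : Arrow ℕ}
    (h : π ∈ Pm n) (hy : y ≤ n) (hπ : π y = x) (hxy : x ≠ y) (hX : X ∈ Avoid n y)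
    (hZ : Z ∈ Avoid n x) (ha : a = ⟨y, x, true⟩ ∨ a = ⟨x, y, false⟩) :
    BraidsRelated ⟨n, X * a.ev n * Z * vb n π⟩ ⟨n, X * Z * vb n π⟩ := by
  have hxn : x ≤ n := hπ ▸ Pm_le h hy
  have hs := swap_mem_Pm hxn hy
  obtain ⟨e, hU⟩ := vb_split h hy hπ
  obtain ⟨Z', hZ', eZ⟩ := Avoid_conj hs hZ
  rw [Equiv.swap_apply_left] at hZ'
  have tt := vb_swap_swap hxn hy
  rw [e]
  generalize vb n (swap x y * π) = U at *
  have J : Joint n x y (vb n (swap x y)) := .virt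
  have J' : Joint n x y (a.ev n * vb n (swap x y)) := by
    rcases ha with rfl | rfl
    · exact .pos
    · exact .neg
  generalize vb n (swap x y) = t at *
  have eZ2 : Z * t = t * Z' := by
    have := congrArg (fun b => t * b * t) eZ
    simp only [mul_assoc, tt, mul_one] at this
    rw [← this, ← mul_assoc, tt, one_mul]
  have a1 : ∀ E : WeldedBraid n,
      BraidsRelated ⟨n, X * E * Z * (t * U)⟩ ⟨n, E * t * (Z' * U * X)⟩ := by
    intro E
    have := braidsRelated_comm X (E * t * (Z' * U))
    have e1 : X * E * Z * (t * U) = X * (E * t * (Z' * U)) := by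
      rw [mul_assoc, ← mul_assoc Z, eZ2]; simp only [mul_assoc]
    rw [e1]
    convert! this using 2
    simp only [mul_assoc]
  have a2 := a1 1
  rw [mul_one, one_mul] at a2
  exact (a1 _).trans ((J'.replace J hxy hxn hy (mul_mem (mul_mem hZ' hU) hX)).trans a2.symm)

/-! ### Gauss diagram moves in the welded braid group -/

theorem ev_mk_mem_Avoid {n i j y : ℕ} {e : Bool} (hi : i ≤ n) (hj : j ≤ n) (hij : i ≠ j)
    (hiy : i ≠ y) (hjy : j ≠ y) : (⟨i, j, e⟩ : Arrow ℕ).ev n ∈ Avoid n y :=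
  ev_mem_Avoid ⟨hi, hj, hij⟩ hiy hjy

section Moves

variable {n : ℕ} {π : Perm ℕ}

/-- The tail of an arrow moves over the point at which the strand `x y` is cut. -/
theorem move_tail {x y u : ℕ} {e : Bool} {X Z : WeldedBraid n} (h : π ∈ Pm n) (hy : y ≤ n)
    (hπ : π y = x) (hxy : x ≠ y) (hu : u ≤ n) (hux : x ≠ u) (huy : y ≠ u) (hX : X ∈ Avoid n y)
    (hZ : Z ∈ Avoid n x) :
    BraidsRelated ⟨n, X * (⟨x, u, e⟩ : Arrow ℕ).ev n * Z * vb n π⟩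
      ⟨n, X * (⟨y, u, e⟩ : Arrow ℕ).ev n * Z * vb n π⟩ := by
  have hx : x ≤ n := hπ ▸ Pm_le h hy
  refine move_cut h hy hπ hxy hX (ev_mk_mem_Avoid hx hu hux hxy huy.symm) ?_ hZ
  rw [vb_ev (swap_mem_Pm hx hy) ⟨hx, hu, hux⟩]
  simp only [Arrow.map, Equiv.swap_apply_left,
    Equiv.swap_apply_of_ne_of_ne hux.symm huy.symm]

/-- The head of an arrow moves over the point at which the strand `x y` is cut. -/
theorem move_head {x y u : ℕ} {e : Bool} {X Z : WeldedBraid n} (h : π ∈ Pm n) (hy : y ≤ n)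
    (hπ : π y = x) (hxy : x ≠ y) (hu : u ≤ n) (hux : u ≠ x) (huy : u ≠ y) (hX : X ∈ Avoid n y)
    (hZ : Z ∈ Avoid n x) :
    BraidsRelated ⟨n, X * (⟨u, x, e⟩ : Arrow ℕ).ev n * Z * vb n π⟩
      ⟨n, X * (⟨u, y, e⟩ : Arrow ℕ).ev n * Z * vb n π⟩ := by
  have hx : x ≤ n := hπ ▸ Pm_le h hy
  refine move_cut h hy hπ hxy hX (ev_mk_mem_Avoid hu hx hux huy hxy) ?_ hZ
  rw [vb_ev (swap_mem_Pm hx hy) ⟨hu, hx, hux⟩]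
  simp only [Arrow.map, Equiv.swap_apply_left, Equiv.swap_apply_of_ne_of_ne hux huy]

theorem comm_disjoint {i j k l : ℕ} {e f : Bool} (hi : i ≤ n) (hj : j ≤ n) (hk : k ≤ n)
    (hl : l ≤ n) (hij : i ≠ j) (hkl : k ≠ l) (hik : i ≠ k) (hil : i ≠ l) (hjk : j ≠ k)
    (hjl : j ≠ l) : Commute ((⟨i, j, e⟩ : Arrow ℕ).ev n) ((⟨k, l, f⟩ : Arrow ℕ).ev n) :=
  ev_comm_disjoint ⟨hi, hj, hij⟩ ⟨hk, hl, hkl⟩ ⟨hik, hil, hjk, hjl⟩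

theorem comm_tails {i j l : ℕ} {e f : Bool} (hi : i ≤ n) (hj : j ≤ n)
    (hl : l ≤ n) (hij : i ≠ j) (hil : i ≠ l) :
    Commute ((⟨i, j, e⟩ : Arrow ℕ).ev n) ((⟨i, l, f⟩ : Arrow ℕ).ev n) :=
  ev_comm_tails ⟨hi, hj, hij⟩ ⟨hi, hl, hil⟩ rfl

/-- Removal of a kink `a → y → b`, where `y` has no arrows.  Only two of the four types of kinks
occur in a stabilization; a kink of another type is removed together with a kink of such a type,
which is first created beside it. -/
theorem remove_kink {a y b : ℕ} {e o : Bool} {r : WeldedBraid n} (h : π ∈ Pm n) (hy : y ≤ n)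
    (hb : b ≤ n) (h1 : π y = a) (h2 : π b = y) (hay : a ≠ y) (hyb : y ≠ b) (hab : a ≠ b)
    (ha' : r ∈ Avoid n a) (hy' : r ∈ Avoid n y) :
    BraidsRelated
      ⟨n, (if o then (⟨a, b, e⟩ : Arrow ℕ) else ⟨b, a, e⟩).ev n * r * vb n π⟩ ⟨n, r * vb n π⟩ := by
  have ha : a ≤ n := h1 ▸ Pm_le h hy
  have triv : ∀ x : WeldedBraid n, BraidsRelated ⟨n, x⟩ ⟨n, x⟩ := fun x => .refl _
  cases o <;> cases e <;> simp only [if_true, if_false, Bool.false_eq_true]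
  · -- the under-crossing first, negative
    have k1 := ev_mul_neg n b a false
    have s1 := move_head (e := true) (X := (⟨b, a, false⟩ : Arrow ℕ).ev n) (Z := r) h hy h1 hay hb
      hab.symm hyb.symm (ev_mk_mem_Avoid hb ha hab.symm hyb.symm hay) ha'
    rw [Bool.not_false] at k1
    rw [k1, one_mul] at s1
    rw [comm_tails hb ha hy hab.symm hyb.symm] at s1
    have s2 := remove_good_kink (X := 1) (Z := (⟨b, a, false⟩ : Arrow ℕ).ev n * r) h hb h2 hyb
      (one_mem _) (mul_mem (ev_mk_mem_Avoid hb ha hab.symm hyb.symm hay) hy') (Or.inl rfl)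
    rw [one_mul, one_mul, ← mul_assoc] at s2
    exact (s1.trans s2).symm
  · -- the under-crossing first, positive
    have s1 := move_tail (e := true) (X := 1) (Z := r) h hb h2 hyb ha hay.symm hab.symm
      (one_mem _) hy'
    have s2 := remove_good_kink (X := 1) (Z := r) h hy h1 hay (one_mem _) ha' (Or.inl rfl)
    simp only [one_mul] at s1 s2
    exact s1.symm.trans s2
  · -- the over-crossing first, negative
    have s1 := move_head (e := false) (X := 1) (Z := r) h hb h2 hyb ha hay hab
      (one_mem _) hy'
    have s2 := remove_good_kink (X := 1) (Z := r) h hy h1 hay (one_mem _) ha' (Or.inr rfl)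
    simp only [one_mul] at s1 s2
    exact s1.symm.trans s2
  · -- the over-crossing first, positive
    have k1 := ev_mul_neg n a y false
    have s1 := move_head (e := true) (X := (⟨a, y, false⟩ : Arrow ℕ).ev n) (Z := r) h hb h2 hyb ha
      hay hab (ev_mk_mem_Avoid ha hy hay hab hyb) hy'
    rw [Bool.not_false] at k1
    rw [k1, one_mul] at s1
    rw [comm_tails ha hy hb hay hab] at s1
    have s2 := remove_good_kink (X := (⟨a, b, true⟩ : Arrow ℕ).ev n) (Z := r) h hy h1 hay
      (ev_mk_mem_Avoid ha hb hab hay hyb.symm) ha' (Or.inr rfl)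
    exact (s1.trans s2).symm

/-- The way in which two pieces of a strand are joined: `x` lies above `y`, and `d` tells whether
the strand is oriented downwards. -/
def link {X : Type} (d : Bool) (x y : X) : X × X := if d then (x, y) else (y, x)

/-- The closing permutation joins the end of the first strand to the beginning of the second. -/
def Joins (π : Perm ℕ) (p : ℕ × ℕ) : Prop := π p.2 = p.1

/-- The second Reidemeister move between strands of the same direction. -/
theorem second_parallel {o o' u u' : ℕ} {e : Bool} {r : WeldedBraid n} (h : π ∈ Pm n)
    (ho' : o' ≤ n) (hu' : u' ≤ n) (h1 : π o' = o) (h2 : π u' = u)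
    (hd : [o, o', u, u'].Nodup) (r1 : r ∈ Avoid n o) (r2 : r ∈ Avoid n u) :
    BraidsRelated ⟨n, (⟨o, u, e⟩ : Arrow ℕ).ev n * (⟨o', u', !e⟩ : Arrow ℕ).ev n * r * vb n π⟩
      ⟨n, r * vb n π⟩ := by
  have ho : o ≤ n := h1 ▸ Pm_le h ho'
  have hu : u ≤ n := h2 ▸ Pm_le h hu'
  simp only [List.nodup_cons, List.mem_cons, List.not_mem_nil, not_or, or_false] at hd
  obtain ⟨⟨d1, d2, d3⟩, ⟨d4, d5⟩, d6, -⟩ := hd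
  have s1 := move_tail (e := !e) (X := (⟨o, u, e⟩ : Arrow ℕ).ev n) (Z := r) h ho' h1 d1 hu' d3 d5
    (ev_mk_mem_Avoid ho hu d2 d1 (Ne.symm d4)) r1
  have s2 := move_head (e := !e) (X := (⟨o, u, e⟩ : Arrow ℕ).ev n) (Z := r) h hu' h2 d6 ho d2 d3
    (ev_mk_mem_Avoid ho hu d2 d3 d6) r2
  rw [ev_mul_neg, one_mul] at s2
  exact (s2.trans s1).symm

/-- The second Reidemeister move between strands of opposite directions. -/
theorem second_antiparallel {o o' u u' : ℕ} {e : Bool} {r : WeldedBraid n} (h : π ∈ Pm n)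
    (ho' : o' ≤ n) (hu : u ≤ n) (h1 : π o' = o) (h2 : π u = u')
    (hd : [o, o', u, u'].Nodup) (r1 : r ∈ Avoid n o) (r2 : r ∈ Avoid n u') :
    BraidsRelated ⟨n, (⟨o, u, e⟩ : Arrow ℕ).ev n * (⟨o', u', !e⟩ : Arrow ℕ).ev n * r * vb n π⟩
      ⟨n, r * vb n π⟩ := by
  have ho : o ≤ n := h1 ▸ Pm_le h ho'
  have hu' : u' ≤ n := h2 ▸ Pm_le h hu
  simp only [List.nodup_cons, List.mem_cons, List.not_mem_nil, not_or, or_false] at hd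
  obtain ⟨⟨d1, d2, d3⟩, ⟨d4, d5⟩, d6, -⟩ := hd
  have s1 := move_tail (e := !e) (X := (⟨o, u, e⟩ : Arrow ℕ).ev n) (Z := r) h ho' h1 d1 hu' d3 d5
    (ev_mk_mem_Avoid ho hu d2 d1 (Ne.symm d4)) r1
  rw [comm_tails ho hu hu' d2 d3] at s1
  have s2 := move_head (e := e) (X := (⟨o, u', !e⟩ : Arrow ℕ).ev n) (Z := r) h hu h2 (Ne.symm d6) ho
    d3 d2 (ev_mk_mem_Avoid ho hu' d3 d2 (Ne.symm d6)) r2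
  have k := ev_mul_neg n o u' (!e)
  rw [Bool.not_not] at k
  rw [k, one_mul] at s2
  exact (s2.trans s1).symm

/-- The second Reidemeister move, with all orientations of the strands. -/
theorem second_move {o o' u u' : ℕ} {e f d : Bool} {r : WeldedBraid n} (h : π ∈ Pm n)
    (ho : o ≤ n) (ho' : o' ≤ n) (hu : u ≤ n) (hu' : u' ≤ n) (h1 : Joins π (link d o o'))
    (h2 : Joins π (link f u u')) (hd : [o, o', u, u'].Nodup) (r1 : r ∈ Avoid n o)
    (r2 : r ∈ Avoid n o') (r3 : r ∈ Avoid n u) (r4 : r ∈ Avoid n u') :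
    BraidsRelated ⟨n, (⟨o, u, e⟩ : Arrow ℕ).ev n * (⟨o', u', !e⟩ : Arrow ℕ).ev n * r * vb n π⟩
      ⟨n, r * vb n π⟩ := by
  have hd' := hd
  simp only [List.nodup_cons, List.mem_cons, List.not_mem_nil, not_or, or_false] at hd'
  obtain ⟨⟨d1, d2, d3⟩, ⟨d4, d5⟩, d6, -⟩ := hd'
  have hd2 : [o', o, u', u].Nodup := by
    simp only [List.nodup_cons, List.mem_cons, List.not_mem_nil, not_or, or_false]
    exact ⟨⟨Ne.symm d1, d5, d4⟩, ⟨d3, d2⟩, Ne.symm d6, fun h => h, List.nodup_nil⟩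
  cases d <;> cases f
  · rw [comm_disjoint ho hu ho' hu' d2 d5 d1 d3 (Ne.symm d4) d6]
    have := second_parallel (e := !e) h ho hu h1 h2 hd2 r2 r4
    rwa [Bool.not_not] at this
  · rw [comm_disjoint ho hu ho' hu' d2 d5 d1 d3 (Ne.symm d4) d6]
    have := second_antiparallel (e := !e) h ho hu' h1 h2 hd2 r2 r3
    rwa [Bool.not_not] at this
  · exact second_antiparallel h ho' hu h1 h2 hd r1 r4
  · exact second_parallel h ho' hu' h1 h2 hd r1 r3

theorem tails_move_aux {o o' u v : ℕ} {e f : Bool} {r : WeldedBraid n} (h : π ∈ Pm n)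
    (ho' : o' ≤ n) (hu : u ≤ n) (hv : v ≤ n) (h1 : π o' = o)
    (hd : [o, o', u, v].Nodup) (r1 : r ∈ Avoid n o) :
    BraidsRelated ⟨n, (⟨o, u, e⟩ : Arrow ℕ).ev n * (⟨o', v, f⟩ : Arrow ℕ).ev n * r * vb n π⟩
      ⟨n, (⟨o, v, f⟩ : Arrow ℕ).ev n * (⟨o', u, e⟩ : Arrow ℕ).ev n * r * vb n π⟩ := by
  have ho : o ≤ n := h1 ▸ Pm_le h ho'
  simp only [List.nodup_cons, List.mem_cons, List.not_mem_nil, not_or, or_false] at hd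
  obtain ⟨⟨d1, d2, d3⟩, ⟨d4, d5⟩, d6, -⟩ := hd
  have s1 := move_tail (e := f) (X := (⟨o, u, e⟩ : Arrow ℕ).ev n) (Z := r) h ho' h1 d1 hv d3 d5
    (ev_mk_mem_Avoid ho hu d2 d1 (Ne.symm d4)) r1
  have s2 := move_tail (e := e) (X := (⟨o, v, f⟩ : Arrow ℕ).ev n) (Z := r) h ho' h1 d1 hu d2 d4
    (ev_mk_mem_Avoid ho hv d3 d1 (Ne.symm d5)) r1
  rw [comm_tails ho hu hv d2 d3] at s1
  exact s1.symm.trans s2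

/-- The W-move: two neighbouring arrow tails are exchanged. -/
theorem tails_move {o o' u v : ℕ} {e f d : Bool} {r : WeldedBraid n} (h : π ∈ Pm n)
    (ho : o ≤ n) (ho' : o' ≤ n) (hu : u ≤ n) (hv : v ≤ n) (h1 : Joins π (link d o o'))
    (hd : [o, o', u, v].Nodup) (r1 : r ∈ Avoid n o) (r2 : r ∈ Avoid n o') :
    BraidsRelated ⟨n, (⟨o, u, e⟩ : Arrow ℕ).ev n * (⟨o', v, f⟩ : Arrow ℕ).ev n * r * vb n π⟩
      ⟨n, (⟨o, v, f⟩ : Arrow ℕ).ev n * (⟨o', u, e⟩ : Arrow ℕ).ev n * r * vb n π⟩ := by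
  have hd' := hd
  simp only [List.nodup_cons, List.mem_cons, List.not_mem_nil, not_or, or_false] at hd'
  obtain ⟨⟨d1, d2, d3⟩, ⟨d4, d5⟩, d6, -⟩ := hd'
  cases d
  · rw [comm_disjoint ho hu ho' hv d2 d5 d1 d3 (Ne.symm d4) d6,
      comm_disjoint ho hv ho' hu d3 d4 d1 d2 (Ne.symm d5) (Ne.symm d6)]
    refine tails_move_aux h ho hv hu h1 ?_ r2
    simp only [List.nodup_cons, List.mem_cons, List.not_mem_nil, not_or, or_false]
    exact ⟨⟨Ne.symm d1, d5, d4⟩, ⟨d3, d2⟩, Ne.symm d6, fun h => h, List.nodup_nil⟩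
  · exact tails_move_aux h ho' hu hv h1 hd r1

theorem triangle_parallel {t m b : ℕ} {e f : Bool} (ht : t ≤ n) (hm : m ≤ n) (hb : b ≤ n)
    (htm : t ≠ m) (htb : t ≠ b) (hmb : m ≠ b) :
    (⟨t, m, e⟩ : Arrow ℕ).ev n * (⟨t, b, e⟩ : Arrow ℕ).ev n * (⟨m, b, f⟩ : Arrow ℕ).ev n =
      (⟨m, b, f⟩ : Arrow ℕ).ev n * (⟨t, b, e⟩ : Arrow ℕ).ev n * (⟨t, m, e⟩ : Arrow ℕ).ev n := by
  have c := arr_comm_triangle ht hm hb htm htb hmb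
  have c2 := arr_comm_tails ht hm hb htm htb
  have c3 : Commute ((⟨t, m, e⟩ : Arrow ℕ).ev n * (⟨t, b, e⟩ : Arrow ℕ).ev n)
      ((⟨m, b, f⟩ : Arrow ℕ).ev n) := by
    cases e
    · have : (⟨t, m, false⟩ : Arrow ℕ).ev n * (⟨t, b, false⟩ : Arrow ℕ).ev n =
          (arr n t m * arr n t b)⁻¹ := by
        rw [c2.eq]; simp [Arrow.ev]
      rw [this]
      cases f
      · exact c.inv_left.inv_right
      · exact c.inv_left
    · cases f
      · exact c.inv_right
      · exact c
  rw [c3.eq, comm_tails ht hm hb htm htb, mul_assoc]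

/-- The relation `triangle_parallel`, multiplied on both sides by the arrow from `t` to `m`. -/
theorem triangle_antiparallel {t m b : ℕ} {e f : Bool} (ht : t ≤ n) (hm : m ≤ n) (hb : b ≤ n)
    (htm : t ≠ m) (htb : t ≠ b) (hmb : m ≠ b) :
    (⟨t, b, !e⟩ : Arrow ℕ).ev n * (⟨m, b, f⟩ : Arrow ℕ).ev n * (⟨t, m, e⟩ : Arrow ℕ).ev n =
      (⟨t, m, e⟩ : Arrow ℕ).ev n * (⟨m, b, f⟩ : Arrow ℕ).ev n * (⟨t, b, !e⟩ : Arrow ℕ).ev n := by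
  have c := triangle_parallel (e := !e) (f := f) ht hm hb htm htb hmb
  have k1 := ev_mul_neg n t m e
  have k2 := ev_mul_neg n t m (!e)
  rw [Bool.not_not] at k2
  have c' := congrArg (fun x => (⟨t, m, e⟩ : Arrow ℕ).ev n * x * (⟨t, m, e⟩ : Arrow ℕ).ev n) c
  simp only [← mul_assoc] at c'
  rw [k1, one_mul] at c'
  rw [c', mul_assoc _ (Arrow.ev n ⟨t, m, !e⟩), k2, mul_one]

theorem third_parallel {t m m' b b' : ℕ} {e f : Bool} {r : WeldedBraid n} (h : π ∈ Pm n)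
    (ht : t ≤ n) (hm' : m' ≤ n) (hb' : b' ≤ n) (h1 : π m' = m) (h2 : π b' = b)
    (hd : [t, m, m', b, b'].Nodup) (r1 : r ∈ Avoid n m) (r2 : r ∈ Avoid n b) :
    BraidsRelated
      ⟨n, (⟨t, m, e⟩ : Arrow ℕ).ev n * (⟨t, b, e⟩ : Arrow ℕ).ev n * (⟨m', b', f⟩ : Arrow ℕ).ev n *
        r * vb n π⟩
      ⟨n, (⟨m, b, f⟩ : Arrow ℕ).ev n * (⟨t, b', e⟩ : Arrow ℕ).ev n * (⟨t, m', e⟩ : Arrow ℕ).ev n *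
        r * vb n π⟩ := by
  have hm : m ≤ n := h1 ▸ Pm_le h hm'
  have hb : b ≤ n := h2 ▸ Pm_le h hb'
  simp only [List.nodup_cons, List.mem_cons, List.not_mem_nil, not_or, or_false] at hd
  obtain ⟨⟨d1, d2, d3, d4⟩, ⟨d5, d6, d7⟩, ⟨d8, d9⟩, d10, -⟩ := hd
  have s1 := move_tail (e := f) (u := b')
    (X := (⟨t, m, e⟩ : Arrow ℕ).ev n * (⟨t, b, e⟩ : Arrow ℕ).ev n) (Z := r) h hm' h1 d5 hb' d7 d9
    (mul_mem (ev_mk_mem_Avoid ht hm d1 d2 d5) (ev_mk_mem_Avoid ht hb d3 d2 (Ne.symm d8))) r1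
  have s2 := move_head (e := f) (u := m)
    (X := (⟨t, m, e⟩ : Arrow ℕ).ev n * (⟨t, b, e⟩ : Arrow ℕ).ev n) (Z := r) h hb' h2 d10 hm d6 d7
    (mul_mem (ev_mk_mem_Avoid ht hm d1 d4 d7) (ev_mk_mem_Avoid ht hb d3 d4 d10)) r2
  have s3 := move_head (e := e) (u := t)
    (X := (⟨m, b, f⟩ : Arrow ℕ).ev n * (⟨t, b, e⟩ : Arrow ℕ).ev n) (Z := r) h hm' h1 d5 ht d1 d2
    (mul_mem (ev_mk_mem_Avoid hm hb d6 d5 (Ne.symm d8))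
      (ev_mk_mem_Avoid ht hb d3 d2 (Ne.symm d8))) r1
  have s4 := move_head (e := e) (u := t) (X := (⟨m, b, f⟩ : Arrow ℕ).ev n)
    (Z := (⟨t, m', e⟩ : Arrow ℕ).ev n * r) h hb' h2 d10 ht d3 d4
    (ev_mk_mem_Avoid hm hb d6 d7 d10) (mul_mem (ev_mk_mem_Avoid ht hm' d2 d3 d8) r2)
  rw [triangle_parallel ht hm hb d1 d3 d6] at s2
  rw [← mul_assoc, ← mul_assoc] at s4
  exact s1.symm.trans (s2.symm.trans (s3.trans s4))

theorem third_antiparallel {t m m' b b' : ℕ} {e f : Bool} {r : WeldedBraid n} (h : π ∈ Pm n)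
    (ht : t ≤ n) (hm : m ≤ n) (hb' : b' ≤ n) (h1 : π m = m') (h2 : π b' = b)
    (hd : [t, m, m', b, b'].Nodup) (r1 : r ∈ Avoid n m') (r2 : r ∈ Avoid n b) :
    BraidsRelated
      ⟨n, (⟨t, m, e⟩ : Arrow ℕ).ev n * (⟨t, b, !e⟩ : Arrow ℕ).ev n * (⟨m', b', f⟩ : Arrow ℕ).ev n *
        r * vb n π⟩
      ⟨n, (⟨m, b, f⟩ : Arrow ℕ).ev n * (⟨t, b', !e⟩ : Arrow ℕ).ev n * (⟨t, m', e⟩ : Arrow ℕ).ev n *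
        r * vb n π⟩ := by
  have hm' : m' ≤ n := h1 ▸ Pm_le h hm
  have hb : b ≤ n := h2 ▸ Pm_le h hb'
  simp only [List.nodup_cons, List.mem_cons, List.not_mem_nil, not_or, or_false] at hd
  obtain ⟨⟨d1, d2, d3, d4⟩, ⟨d5, d6, d7⟩, ⟨d8, d9⟩, d10, -⟩ := hd
  rw [comm_tails ht hm hb d1 d3, Commute.right_comm
    (comm_disjoint ht hm hm' hb' d1 d9 d2 d4 d5 d7),
    Commute.right_comm (comm_tails ht hb' hm' d4 d2),
    comm_disjoint hm hb ht hm' d6 d2 (Ne.symm d1) d5 (Ne.symm d3) (Ne.symm d8)]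
  have s1 := move_head (e := e) (u := t)
    (X := (⟨t, b, !e⟩ : Arrow ℕ).ev n * (⟨m', b', f⟩ : Arrow ℕ).ev n) (Z := r) h hm h1 (Ne.symm d5)
    ht d2 d1 (mul_mem (ev_mk_mem_Avoid ht hb d3 d1 (Ne.symm d6))
      (ev_mk_mem_Avoid hm' hb' d9 (Ne.symm d5) (Ne.symm d7))) r1
  have s2 := move_head (e := f) (u := m') (X := (⟨t, b, !e⟩ : Arrow ℕ).ev n)
    (Z := (⟨t, m', e⟩ : Arrow ℕ).ev n * r) h hb' h2 d10 hm' d8 d9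
    (ev_mk_mem_Avoid ht hb d3 d4 d10) (mul_mem (ev_mk_mem_Avoid ht hm' d2 d3 d8) r2)
  have s3 := move_tail (e := f) (u := b) (X := (⟨t, m', e⟩ : Arrow ℕ).ev n)
    (Z := (⟨t, b', !e⟩ : Arrow ℕ).ev n * r) h hm h1 (Ne.symm d5) hb d8 d6
    (ev_mk_mem_Avoid ht hm' d2 d1 (Ne.symm d5))
    (mul_mem (ev_mk_mem_Avoid ht hb' d4 d2 (Ne.symm d9)) r1)
  have s4 := move_head (e := !e) (u := t)
    (X := (⟨t, m', e⟩ : Arrow ℕ).ev n * (⟨m', b, f⟩ : Arrow ℕ).ev n) (Z := r) h hb' h2 d10 ht d3 d4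
    (mul_mem (ev_mk_mem_Avoid ht hm' d2 d4 d9) (ev_mk_mem_Avoid hm' hb d8 d9 d10)) r2
  rw [← mul_assoc, ← mul_assoc] at s2 s3
  rw [triangle_antiparallel ht hm' hb d2 d3 d8] at s2
  exact s1.symm.trans (s2.symm.trans (s4.trans s3))

/-- The third Reidemeister move, in which the top strand `t` is not cut: its arrow tails commute. -/
theorem third_single {t m m' b b' : ℕ} {e e' f dm db : Bool} {r : WeldedBraid n} (h : π ∈ Pm n)
    (ht : t ≤ n) (hm : m ≤ n) (hm' : m' ≤ n) (hb : b ≤ n) (hb' : b' ≤ n)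
    (h1 : Joins π (link dm m m')) (h2 : Joins π (link db b b')) (he : e = e' ↔ dm = db)
    (hd : [t, m, m', b, b'].Nodup) (r1 : r ∈ Avoid n m) (r2 : r ∈ Avoid n m') (r3 : r ∈ Avoid n b)
    (r4 : r ∈ Avoid n b') :
    BraidsRelated
      ⟨n, (⟨t, m, e⟩ : Arrow ℕ).ev n * (⟨t, b, e'⟩ : Arrow ℕ).ev n * (⟨m', b', f⟩ : Arrow ℕ).ev n *
        r * vb n π⟩
      ⟨n, (⟨m, b, f⟩ : Arrow ℕ).ev n * (⟨t, b', e'⟩ : Arrow ℕ).ev n * (⟨t, m', e⟩ : Arrow ℕ).ev n *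
        r * vb n π⟩ := by
  have hd' := hd
  simp only [List.nodup_cons, List.mem_cons, List.not_mem_nil, not_or, or_false] at hd'
  obtain ⟨⟨d1, d2, d3, d4⟩, ⟨d5, d6, d7⟩, ⟨d8, d9⟩, d10, -⟩ := hd'
  have hd2 : [t, m', m, b', b].Nodup := by
    simp only [List.nodup_cons, List.mem_cons, List.not_mem_nil, not_or, or_false]
    exact ⟨⟨d2, d1, d4, d3⟩, ⟨Ne.symm d5, d9, d8⟩, ⟨d7, d6⟩, Ne.symm d10, fun h => h,
      List.nodup_nil⟩
  -- both sides in the form in which the roles of the primed and unprimed strands are exchanged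
  have eL : (⟨t, m, e⟩ : Arrow ℕ).ev n * (⟨t, b, e'⟩ : Arrow ℕ).ev n *
      (⟨m', b', f⟩ : Arrow ℕ).ev n = (⟨m', b', f⟩ : Arrow ℕ).ev n * (⟨t, b, e'⟩ : Arrow ℕ).ev n *
        (⟨t, m, e⟩ : Arrow ℕ).ev n := by
    rw [Commute.right_comm (comm_disjoint ht hb hm' hb' d3 d9 d2 d4 (Ne.symm d8) d10),
      comm_disjoint ht hm hm' hb' d1 d9 d2 d4 d5 d7,
      Commute.right_comm (comm_tails ht hm hb d1 d3)]
  have eR : (⟨m, b, f⟩ : Arrow ℕ).ev n * (⟨t, b', e'⟩ : Arrow ℕ).ev n *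
      (⟨t, m', e⟩ : Arrow ℕ).ev n = (⟨t, m', e⟩ : Arrow ℕ).ev n * (⟨t, b', e'⟩ : Arrow ℕ).ev n *
        (⟨m, b, f⟩ : Arrow ℕ).ev n := by
    rw [Commute.right_comm (comm_tails ht hb' hm' d4 d2),
      comm_disjoint hm hb ht hm' d6 d2 (Ne.symm d1) d5 (Ne.symm d3) (Ne.symm d8),
      Commute.right_comm (comm_disjoint hm hb ht hb' d6 d4 (Ne.symm d1) d7 (Ne.symm d3) d10)]
  cases dm <;> cases db
  · obtain rfl : e = e' := he.mpr rfl
    rw [eL, eR]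
    exact (third_parallel h ht hm hb h1 h2 hd2 r2 r4).symm
  · obtain rfl : e' = !e := by revert he; cases e <;> cases e' <;> simp
    exact third_antiparallel h ht hm hb' h1 h2 hd r2 r3
  · obtain rfl : e' = !e := by revert he; cases e <;> cases e' <;> simp
    rw [eL, eR]
    exact (third_antiparallel h ht hm' hb h1 h2 hd2 r1 r4).symm
  · obtain rfl : e = e' := he.mpr rfl
    exact third_parallel h ht hm' hb' h1 h2 hd r1 r3

/-- The third Reidemeister move, with all orientations of the strands. The strand `t t'` passes
over the strands `m m'` and `b b'`, and `m m'` passes over `b b'`. -/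
theorem third_move {t t' m m' b b' : ℕ} {e e' f dt dm db : Bool} {r : WeldedBraid n} (h : π ∈ Pm n)
    (ht : t ≤ n) (ht' : t' ≤ n) (hm : m ≤ n) (hm' : m' ≤ n) (hb : b ≤ n) (hb' : b' ≤ n)
    (h0 : Joins π (link dt t t')) (h1 : Joins π (link dm m m')) (h2 : Joins π (link db b b'))
    (he : e = e' ↔ dm = db) (hd : [t, t', m, m', b, b'].Nodup)
    (r1 : r ∈ Avoid n t) (r1' : r ∈ Avoid n t') (r2 : r ∈ Avoid n m) (r2' : r ∈ Avoid n m')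
    (r3 : r ∈ Avoid n b) (r3' : r ∈ Avoid n b') :
    BraidsRelated
      ⟨n, (⟨t, m, e⟩ : Arrow ℕ).ev n * (⟨t', b, e'⟩ : Arrow ℕ).ev n * (⟨m', b', f⟩ : Arrow ℕ).ev n *
        r * vb n π⟩
      ⟨n, (⟨m, b, f⟩ : Arrow ℕ).ev n * (⟨t, b', e'⟩ : Arrow ℕ).ev n * (⟨t', m', e⟩ : Arrow ℕ).ev n *
        r * vb n π⟩ := by
  simp only [List.nodup_cons, List.mem_cons, List.not_mem_nil, not_or, or_false] at hd
  obtain ⟨⟨c1, c2, c3, c4, c5⟩, ⟨d1, d2, d3, d4⟩, ⟨d5, d6, d7⟩, ⟨d8, d9⟩, d10, -⟩ := hd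
  cases dt
  · have key := third_single (f := f) h ht' hm hm' hb hb' h1 h2 he (by
      simp only [List.nodup_cons, List.mem_cons, List.not_mem_nil, not_or, or_false]
      exact ⟨⟨d1, d2, d3, d4⟩, ⟨d5, d6, d7⟩, ⟨d8, d9⟩, d10, fun h => h, List.nodup_nil⟩)
      r2 r2' r3 r3'
    rw [comm_disjoint ht hm ht' hb c2 d3 c1 c4 (Ne.symm d1) d6,
      Commute.right_comm (comm_disjoint ht hb' ht' hm' c5 d2 c1 c3 (Ne.symm d4) (Ne.symm d9))]
    rw [comm_tails ht' hm hb d1 d3, Commute.right_comm (comm_tails ht' hb' hm' d4 d2)] at key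
    have s1 := move_tail (e := e) (u := m) (X := (⟨t', b, e'⟩ : Arrow ℕ).ev n)
      (Z := (⟨m', b', f⟩ : Arrow ℕ).ev n * r) h ht h0 (Ne.symm c1) hm d1 c2
      (ev_mk_mem_Avoid ht' hb d3 (Ne.symm c1) (Ne.symm c4))
      (mul_mem (ev_mk_mem_Avoid hm' hb' d9 (Ne.symm d2) (Ne.symm d4)) r1')
    have s2 := move_tail (e := e') (u := b')
      (X := (⟨m, b, f⟩ : Arrow ℕ).ev n * (⟨t', m', e⟩ : Arrow ℕ).ev n)
      (Z := r) h ht h0 (Ne.symm c1) hb' d4 c5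
      (mul_mem (ev_mk_mem_Avoid hm hb d6 (Ne.symm c2) (Ne.symm c4))
        (ev_mk_mem_Avoid ht' hm' d2 (Ne.symm c1) (Ne.symm c3))) r1'
    rw [← mul_assoc, ← mul_assoc] at s1
    exact s1.symm.trans (key.trans s2)
  · have key := third_single (f := f) h ht hm hm' hb hb' h1 h2 he (by
      simp only [List.nodup_cons, List.mem_cons, List.not_mem_nil, not_or, or_false]
      exact ⟨⟨c2, c3, c4, c5⟩, ⟨d5, d6, d7⟩, ⟨d8, d9⟩, d10, fun h => h, List.nodup_nil⟩)
      r2 r2' r3 r3'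
    have s1 := move_tail (e := e') (u := b) (X := (⟨t, m, e⟩ : Arrow ℕ).ev n)
      (Z := (⟨m', b', f⟩ : Arrow ℕ).ev n * r) h ht' h0 c1 hb c4 d3
      (ev_mk_mem_Avoid ht hm c2 c1 (Ne.symm d1))
      (mul_mem (ev_mk_mem_Avoid hm' hb' d9 (Ne.symm c3) (Ne.symm c5)) r1)
    have s2 := move_tail (e := e) (u := m')
      (X := (⟨m, b, f⟩ : Arrow ℕ).ev n * (⟨t, b', e'⟩ : Arrow ℕ).ev n)
      (Z := r) h ht' h0 c1 hm' c3 d2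
      (mul_mem (ev_mk_mem_Avoid hm hb d6 (Ne.symm d1) (Ne.symm d3))
        (ev_mk_mem_Avoid ht hb' c5 c1 (Ne.symm d4))) r1
    rw [← mul_assoc, ← mul_assoc] at s1
    exact s1.symm.trans (key.trans s2)

/-- An arrow may be moved from one piece of a strand to the other. -/
theorem slide_move {x y u : ℕ} {e o d : Bool} {r : WeldedBraid n} (h : π ∈ Pm n) (hx : x ≤ n)
    (hy : y ≤ n) (hu : u ≤ n) (h1 : Joins π (link d x y)) (hxy : x ≠ y) (hux : u ≠ x) (huy : u ≠ y)
    (r1 : r ∈ Avoid n x) (r2 : r ∈ Avoid n y) :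
    BraidsRelated ⟨n, (if o then (⟨x, u, e⟩ : Arrow ℕ) else ⟨u, x, e⟩).ev n * r * vb n π⟩
      ⟨n, (if o then (⟨y, u, e⟩ : Arrow ℕ) else ⟨u, y, e⟩).ev n * r * vb n π⟩ := by
  cases d
  · have s1 := move_tail (e := e) (X := 1) h hx h1 hxy.symm hu huy.symm hux.symm (one_mem _) r2
    have s2 := move_head (e := e) (X := 1) h hx h1 hxy.symm hu huy hux (one_mem _) r2
    simp only [one_mul] at s1 s2
    cases o
    · exact s2.symm
    · exact s1.symm
  · have s1 := move_tail (e := e) (X := 1) h hy h1 hxy hu hux.symm huy.symm (one_mem _) r1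
    have s2 := move_head (e := e) (X := 1) h hy h1 hxy hu hux huy (one_mem _) r1
    simp only [one_mul] at s1 s2
    cases o
    · exact s2
    · exact s1

end Moves

/-! ### Labelled link diagrams -/

/-- The arrow of a real crossing, whose left strand has the orientation `d` and the label `a` and
whose right strand has the orientation `e` and the label `b`. -/
def arrowOf {X : Type} (c : Crossing) (d e : Bool) (a b : X) : Arrow X :=
  match c with
  | .leftOver => ⟨a, b, d != e⟩
  | .rightOver => ⟨b, a, d == e⟩
  | .virt => ⟨b, a, d == e⟩

/-- `Relabel f d x a G N`: at a real crossing a strand with the orientation `d` and the label `x`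
gets the label `a`.  Either the label is kept, or it is a new label; `N` lists the new label and `G`
records how the two pieces are joined.  Only labels of strands that go down may be kept, because the
arrows are listed from top to bottom; when `f` is true, all labels are new. -/
inductive Relabel (f : Bool) {X : Type} :
    Bool → X → X → Multiset (X × X) → Multiset X → Prop
  | keep (x : X) (h : f = false) : Relabel f true x x 0 0
  | new (d : Bool) (x a : X) (h : f = true ∨ d = false) : Relabel f d x a {link d x a} {a}

/-- A labelling of the strands at a single piece: the strands above it, the strands below it, the
arrows, the joints and the new labels. -/
inductive LabPiece (f : Bool) {X : Type} : Piece → List (Bool × X) → List (Bool × X) →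
    List (Arrow X) → Multiset (X × X) → Multiset X → Prop
  | maximum (d : Bool) (y : X) : LabPiece f (.maximum d) [] [(d, y), (!d, y)] [] 0 {y}
  | minimum (d : Bool) (x y : X) : LabPiece f .minimum [(d, x), (!d, y)] [] [] {link d x y} 0
  | virt (p q : Bool × X) : LabPiece f (.crossing .virt) [p, q] [q, p] [] 0 0
  | real (c : Crossing) (hc : c.IsReal) (d e : Bool) (x y a b : X) (G G' : Multiset (X × X))
      (N N' : Multiset X) (h : Relabel f d x a G N) (h' : Relabel f e y b G' N') :
      LabPiece f (.crossing c) [(d, x), (e, y)] [(e, b), (d, a)] [arrowOf c d e a b] (G + G')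
        (N + N')

/-- `Lab f k w B B' A G N`: a labelling of the diagram `w`.  The oriented strands at the top and at
the bottom have the labels `B` and `B'`; `A` is the list of the arrows of the real crossings, `G`
the multiset of joints between labelled pieces of strands, written as pairs `(x, y)` where the end
of `x` is joined to the beginning of `y`, and `N` is the multiset of the labels that are introduced
inside the diagram.  A strand may also be subdivided at a point that is not a crossing, and `k`
counts these subdivisions. -/
inductive Lab (f : Bool) {X : Type} : ℕ → List Layer → List (Bool × X) → List (Bool × X) →
    List (Arrow X) → Multiset (X × X) → Multiset X → Prop
  | nil (B : List (Bool × X)) : Lab f 0 [] B B [] 0 0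
  | cons {P : Piece} {i o : List (Bool × X)} {A : List (Arrow X)} {G : Multiset (X × X)}
      {N : Multiset X} (h : LabPiece f P i o A G N) (u v : List (Bool × X)) {k : ℕ}
      {w : List Layer} {B' : List (Bool × X)} {A' : List (Arrow X)} {G' : Multiset (X × X)}
      {N' : Multiset X} (h' : Lab f k w (u ++ o ++ v) B' A' G' N') :
      Lab f k (⟨u.length, P⟩ :: w) (u ++ i ++ v) B' (A ++ A') (G + G') (N + N')
  | sub (u v : List (Bool × X)) (d : Bool) (x y : X) {k : ℕ} {w : List Layer}
      {B' : List (Bool × X)} {A' : List (Arrow X)} {G' : Multiset (X × X)} {N' : Multiset X}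
      (h' : Lab f k w (u ++ (d, y) :: v) B' A' G' N') :
      Lab f (k + 1) w (u ++ (d, x) :: v) B' A' ({link d x y} + G') ({y} + N')

section
variable {f : Bool} {X Y : Type}

theorem map_link (g : X → Y) (d : Bool) (x y : X) :
    Prod.map g g (link d x y) = link d (g x) (g y) := by
  cases d <;> rfl

theorem map_arrowOf (g : X → Y) (c : Crossing) (d e : Bool) (a b : X) :
    (arrowOf c d e a b).map g = arrowOf c d e (g a) (g b) := by
  cases c <;> rfl

theorem Relabel.map (g : X → Y) {d : Bool} {x a : X} {G : Multiset (X × X)} {N : Multiset X}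
    (h : Relabel f d x a G N) : Relabel f d (g x) (g a) (G.map (Prod.map g g)) (N.map g) := by
  cases h with
  | keep x h => exact .keep _ h
  | new d x a h =>
    rw [Multiset.map_singleton, Multiset.map_singleton, map_link]
    exact .new _ _ _ h

/-- Change of the labels of a row of strands. -/
def mapRow (g : X → Y) (B : List (Bool × X)) : List (Bool × Y) := B.map (Prod.map id g)

theorem mapRow_append (g : X → Y) (B C : List (Bool × X)) :
    mapRow g (B ++ C) = mapRow g B ++ mapRow g C := List.map_append

theorem mapRow_length (g : X → Y) (B : List (Bool × X)) : (mapRow g B).length = B.length :=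
  List.length_map _

theorem mapRow_cons (g : X → Y) (d : Bool) (x : X) (B : List (Bool × X)) :
    mapRow g ((d, x) :: B) = (d, g x) :: mapRow g B := rfl

theorem LabPiece.map (g : X → Y) {P : Piece} {i o : List (Bool × X)} {A : List (Arrow X)}
    {G : Multiset (X × X)} {N : Multiset X} (h : LabPiece f P i o A G N) :
    LabPiece f P (mapRow g i) (mapRow g o) (A.map (Arrow.map g)) (G.map (Prod.map g g))
      (N.map g) := by
  cases h with
  | maximum d y => exact .maximum d (g y)
  | minimum d x y =>
    rw [Multiset.map_singleton, map_link]
    exact .minimum d (g x) (g y)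
  | virt p q => exact .virt _ _
  | real c hc d e x y a b G G' N N' h h' =>
    rw [Multiset.map_add, Multiset.map_add, List.map_singleton, map_arrowOf]
    exact .real c hc d e _ _ _ _ _ _ _ _ (h.map g) (h'.map g)

theorem Lab.map (g : X → Y) {k : ℕ} {w : List Layer} {B B' : List (Bool × X)}
    {A : List (Arrow X)} {G : Multiset (X × X)} {N : Multiset X} (h : Lab f k w B B' A G N) :
    Lab f k w (mapRow g B) (mapRow g B') (A.map (Arrow.map g)) (G.map (Prod.map g g))
      (N.map g) := by
  induction h with
  | nil B => exact .nil _
  | cons h u v h' ih =>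
    rw [mapRow_append, mapRow_append] at ih ⊢
    rw [Multiset.map_add, Multiset.map_add, List.map_append, ← mapRow_length g u]
    exact .cons (h.map g) _ _ ih
  | sub u v d x y h' ih =>
    rw [mapRow_append, mapRow_cons] at ih ⊢
    rw [Multiset.map_add, Multiset.map_add, Multiset.map_singleton, Multiset.map_singleton,
      map_link]
    exact .sub _ _ _ _ _ ih

theorem Lab.append {k k' : ℕ} {w w' : List Layer} {B B' B'' : List (Bool × X)}
    {A A' : List (Arrow X)} {G G' : Multiset (X × X)} {N N' : Multiset X}
    (h : Lab f k w B B' A G N) (h' : Lab f k' w' B' B'' A' G' N') :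
    Lab f (k + k') (w ++ w') B B'' (A ++ A') (G + G') (N + N') := by
  induction h with
  | nil B => simpa using h'
  | cons h u v _ ih =>
    rw [List.cons_append, List.append_assoc (_ : List (Arrow X)), add_assoc, add_assoc]
    exact .cons h u v (ih h')
  | sub u v d x y _ ih =>
    rw [add_right_comm, add_assoc ({_} : Multiset (X × X)), add_assoc ({_} : Multiset X)]
    exact .sub u v d x y (ih h')

theorem Lab.split {k : ℕ} {x y : List Layer} {B B'' : List (Bool × X)} {A : List (Arrow X)}
    {G : Multiset (X × X)} {N : Multiset X} (h : Lab f k (x ++ y) B B'' A G N) :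
    ∃ k₁ k₂ B' A₁ A₂ G₁ G₂ N₁ N₂, Lab f k₁ x B B' A₁ G₁ N₁ ∧ Lab f k₂ y B' B'' A₂ G₂ N₂ ∧
      k = k₁ + k₂ ∧ A = A₁ ++ A₂ ∧ G = G₁ + G₂ ∧ N = N₁ + N₂ := by
  generalize hw : x ++ y = w at h
  induction h generalizing x with
  | nil B =>
    obtain ⟨rfl, rfl⟩ := List.append_eq_nil_iff.mp hw
    exact ⟨0, 0, B, [], [], 0, 0, 0, 0, .nil _, .nil _, rfl, rfl, rfl, rfl⟩
  | cons h u v h' ih =>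
    cases x with
    | nil =>
      rw [List.nil_append] at hw
      subst hw
      exact ⟨0, _, _, [], _, 0, _, 0, _, .nil _, .cons h u v h', by simp, rfl, by simp, by simp⟩
    | cons L x =>
      rw [List.cons_append, List.cons.injEq] at hw
      obtain ⟨rfl, rfl⟩ := hw
      obtain ⟨k₁, k₂, B', A₁, A₂, G₁, G₂, N₁, N₂, h1, h2, rfl, rfl, rfl, rfl⟩ := ih rfl
      exact ⟨_, _, _, _, _, _, _, _, _, .cons h u v h1, h2, rfl, by simp, by rw [add_assoc],
        by rw [add_assoc]⟩
  | sub u v d a b h' ih =>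
    obtain ⟨k₁, k₂, B', A₁, A₂, G₁, G₂, N₁, N₂, h1, h2, rfl, rfl, rfl, rfl⟩ := ih hw
    exact ⟨_, _, _, _, _, _, _, _, _, .sub u v d a b h1, h2, by omega, rfl, by rw [add_assoc],
      by rw [add_assoc]⟩

/-- The labels of the strands with the orientation `d`. -/
def side (d : Bool) (B : List (Bool × X)) : Multiset X :=
  ((B.filter (fun p => p.1 == d)).map Prod.snd : List X)

theorem side_nil (d : Bool) : side d ([] : List (Bool × X)) = 0 := rfl

theorem side_append (d : Bool) (B C : List (Bool × X)) : side d (B ++ C) = side d B + side d C := by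
  simp [side]

theorem side_cons (d e : Bool) (x : X) (B : List (Bool × X)) :
    side d ((e, x) :: B) = (if e = d then {x} else 0) + side d B := by
  by_cases h : e = d <;> simp [side, h]

/-- The piece of strand that ends (for `d = true`) or begins (for `d = false`) at a joint. -/
def proj (d : Bool) (p : X × X) : X := if d then p.1 else p.2

theorem proj_link (d e : Bool) (x y : X) : proj d (link e x y) = if e = d then x else y := by
  cases d <;> cases e <;> rfl

theorem Relabel.side {t d : Bool} {x a : X} {G : Multiset (X × X)} {N : Multiset X}
    (h : Relabel f d x a G N) :
    G.map (proj t) + (if d = t then {a} else 0) = (if d = t then {x} else 0) + N := by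
  cases h with
  | keep x h => simp
  | new d x a h =>
    rw [Multiset.map_singleton, proj_link]
    split_ifs <;> simp

theorem LabPiece.side (t : Bool) {P : Piece} {i o : List (Bool × X)} {A : List (Arrow X)}
    {G : Multiset (X × X)} {N : Multiset X} (h : LabPiece f P i o A G N) :
    G.map (proj t) + Welded.side t o = Welded.side t i + N := by
  cases h with
  | maximum d y => cases t <;> cases d <;> simp [side_cons, side_nil]
  | minimum d x y => cases t <;> cases d <;> simp [side_cons, side_nil, proj_link]
  | virt p q =>
    obtain ⟨d, x⟩ := p
    obtain ⟨e, y⟩ := q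
    simp [side_cons, side_nil, add_comm]
  | real c hc d e x y a b G G' N N' h h' =>
    have e1 := h.side (t := t)
    have e2 := h'.side (t := t)
    simp only [side_cons, side_nil, Multiset.map_add, add_zero]
    calc _ = (G.map (proj t) + (if d = t then {a} else 0)) +
          (G'.map (proj t) + (if e = t then {b} else 0)) := by abel
      _ = _ := by rw [e1, e2]; abel

/-- Every piece of strand has one end and one beginning, which are at a joint or at the boundary. -/
theorem Lab.side (t : Bool) {k : ℕ} {w : List Layer} {B B' : List (Bool × X)}
    {A : List (Arrow X)} {G : Multiset (X × X)} {N : Multiset X} (h : Lab f k w B B' A G N) :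
    G.map (proj t) + Welded.side t B' = Welded.side t B + N := by
  induction h with
  | nil B => simp
  | @cons P i o A G N h u v k w B' A' G' N' h' ih =>
    have e := h.side t
    simp only [side_append] at ih ⊢
    rw [Multiset.map_add]
    calc _ = G.map (proj t) + (G'.map (proj t) + Welded.side t B') := by abel
      _ = (G.map (proj t) + Welded.side t o) + (Welded.side t u + Welded.side t v + N') := by
        rw [ih]; abel
      _ = _ := by rw [e]; abel
  | @sub u v d x y k w B' A' G' N' h' ih =>
    simp only [side_append, side_cons] at ih ⊢
    rw [Multiset.map_add, Multiset.map_singleton, proj_link, add_assoc, ih]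
    split_ifs
    · abel
    · abel

theorem LabPiece.side_le (t : Bool) {P : Piece} {i o : List (Bool × X)} {A : List (Arrow X)}
    {G : Multiset (X × X)} {N : Multiset X} (h : LabPiece f P i o A G N) (u v : List (Bool × X))
    (N' : Multiset X) :
    Welded.side t (u ++ o ++ v) + N' ≤ Welded.side t (u ++ i ++ v) + (N + N') := by
  have hle : Welded.side t o ≤ Welded.side t i + N := by
    rw [← h.side t]; exact Multiset.le_add_left _ _
  simp only [side_append]
  calc _ = Welded.side t o + (Welded.side t u + Welded.side t v + N') := by abel
    _ ≤ (Welded.side t i + N) + (Welded.side t u + Welded.side t v + N') :=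
      Multiset.add_le_add_iff_right.mpr hle
    _ = _ := by abel

theorem side_sub_le (t d : Bool) (x y : X) (u v : List (Bool × X)) (N' : Multiset X) :
    side t (u ++ (d, y) :: v) + N' ≤ side t (u ++ (d, x) :: v) + ({y} + N') := by
  simp only [side_append, side_cons]
  split_ifs
  · calc _ ≤ side t u + ({y} + side t v) + N' + {x} := Multiset.le_add_right _ _
      _ = _ := by abel
  · calc _ ≤ side t u + (0 + side t v) + N' + {y} := Multiset.le_add_right _ _
      _ = _ := by abel

theorem Relabel.mem {d : Bool} {x a : X} {G : Multiset (X × X)} {N : Multiset X}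
    (h : Relabel f d x a G N) : a ∈ (if d = true then {x} else 0) + N := by
  cases h <;> simp

theorem LabPiece.arrow_mem {P : Piece} {i o : List (Bool × X)} {A : List (Arrow X)}
    {G : Multiset (X × X)} {N : Multiset X} (h : LabPiece f P i o A G N) :
    ∀ a ∈ A, a.tail ∈ Welded.side true i + N ∧ a.head ∈ Welded.side true i + N := by
  intro q ha
  cases h with
  | maximum d y => simp at ha
  | minimum d x y => simp at ha
  | virt p q => simp at ha
  | real c hc d e x y a b G G' N N' h h' =>
    have h1 := h.mem
    have h2 := h'.mem
    have k1 : a ∈ Welded.side true [(d, x), (e, y)] + (N + N') := by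
      simp only [side_cons, side_nil, Multiset.mem_add] at h1 ⊢
      tauto
    have k2 : b ∈ Welded.side true [(d, x), (e, y)] + (N + N') := by
      simp only [side_cons, side_nil, Multiset.mem_add] at h2 ⊢
      tauto
    rw [List.mem_singleton] at ha
    subst ha
    cases c
    · exact ⟨k1, k2⟩
    · exact ⟨k2, k1⟩
    · exact ⟨k2, k1⟩

/-- The labels at the ends of an arrow are new, or belong to strands that come from above. -/
theorem Lab.arrow_mem {k : ℕ} {w : List Layer} {B B' : List (Bool × X)}
    {A : List (Arrow X)} {G : Multiset (X × X)} {N : Multiset X} (h : Lab f k w B B' A G N) :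
    ∀ a ∈ A, a.tail ∈ Welded.side true B + N ∧ a.head ∈ Welded.side true B + N := by
  induction h with
  | nil B => simp
  | @cons P i o A G N h u v k w B' A' G' N' h' ih =>
    intro a ha
    rcases List.mem_append.mp ha with ha | ha
    · have := h.arrow_mem a ha
      simp only [side_append, Multiset.mem_add] at this ⊢
      tauto
    · have hle := h.side_le true u v N'
      exact ⟨Multiset.mem_of_le hle (ih a ha).1, Multiset.mem_of_le hle (ih a ha).2⟩
  | @sub u v d x y k w B' A' G' N' h' ih =>
    intro a ha
    have hle := side_sub_le true d x y u v N'
    exact ⟨Multiset.mem_of_le hle (ih a ha).1, Multiset.mem_of_le hle (ih a ha).2⟩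

theorem LabPiece.arrow_ne {P : Piece} {i o : List (Bool × X)} {A : List (Arrow X)}
    {G : Multiset (X × X)} {N : Multiset X} (h : LabPiece f P i o A G N)
    (hN : (Welded.side true i + N).Nodup) : ∀ a ∈ A, a.tail ≠ a.head := by
  intro q ha
  cases h with
  | maximum d y => simp at ha
  | minimum d x y => simp at ha
  | virt p q => simp at ha
  | real c hc d e x y a b G G' N N' h h' =>
    have hne : a ≠ b := by
      rintro rfl
      have hle : {a} + {a} ≤ ((if d = true then {x} else 0) + N) +
          ((if e = true then {y} else 0) + N') :=
        add_le_add (Multiset.singleton_le.mpr h.mem) (Multiset.singleton_le.mpr h'.mem)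
      have : ({a} + {a} : Multiset X).Nodup := by
        refine Multiset.nodup_of_le (hle.trans (le_of_eq ?_)) hN
        simp only [side_cons, side_nil]
        abel
      simp at this
    rw [List.mem_singleton] at ha
    subst ha
    cases c
    · exact hne
    · exact hne.symm
    · exact hne.symm

/-- Different strands meet at a real crossing. -/
theorem Lab.arrow_ne {k : ℕ} {w : List Layer} {B B' : List (Bool × X)}
    {A : List (Arrow X)} {G : Multiset (X × X)} {N : Multiset X} (h : Lab f k w B B' A G N)
    (hN : (Welded.side true B + N).Nodup) : ∀ a ∈ A, a.tail ≠ a.head := by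
  induction h with
  | nil B => simp
  | @cons P i o A G N h u v k w B' A' G' N' h' ih =>
    intro a ha
    rcases List.mem_append.mp ha with ha | ha
    · refine h.arrow_ne (Multiset.nodup_of_le ?_ hN) a ha
      simp only [side_append]
      calc _ ≤ (Welded.side true i + N) + (Welded.side true u + Welded.side true v + N') :=
            Multiset.le_add_right _ _
        _ = _ := by abel
    · exact ih (Multiset.nodup_of_le (h.side_le true u v N') hN) a ha
  | @sub u v d x y k w B' A' G' N' h' ih =>
    exact ih (Multiset.nodup_of_le (side_sub_le true d x y u v N') hN)

end

section
variable {f : Bool} {X Y : Type}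

theorem Lab.cons_inv {p : ℕ} {P : Piece} {w : List Layer} {B B' : List (Bool × X)}
    {A : List (Arrow X)} {G : Multiset (X × X)} {N : Multiset X}
    (h : Lab f 0 (⟨p, P⟩ :: w) B B' A G N) :
    ∃ u v i o A₁ A₂ G₁ G₂ N₁ N₂, u.length = p ∧ B = u ++ i ++ v ∧ LabPiece f P i o A₁ G₁ N₁ ∧
      Lab f 0 w (u ++ o ++ v) B' A₂ G₂ N₂ ∧ A = A₁ ++ A₂ ∧ G = G₁ + G₂ ∧ N = N₁ + N₂ := by
  generalize hw : (⟨p, P⟩ :: w : List Layer) = w' at h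
  generalize hk : 0 = k at h
  cases h with
  | nil => simp at hw
  | cons h u v h' =>
    simp only [List.cons.injEq, Layer.mk.injEq] at hw
    obtain ⟨⟨rfl, rfl⟩, rfl⟩ := hw
    subst hk
    exact ⟨u, v, _, _, _, _, _, _, _, _, rfl, rfl, h, h', rfl, rfl, rfl⟩
  | sub => omega

theorem Lab.nil_inv {B B' : List (Bool × X)} {A : List (Arrow X)} {G : Multiset (X × X)}
    {N : Multiset X} (h : Lab f 0 [] B B' A G N) : B' = B ∧ A = [] ∧ G = 0 ∧ N = 0 := by
  generalize hw : ([] : List Layer) = w' at h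
  generalize hk : 0 = k at h
  cases h with
  | nil => exact ⟨rfl, rfl, rfl, rfl⟩
  | cons => simp at hw
  | sub => omega

theorem LabPiece.inputs {P : Piece} {i o : List (Bool × X)} {A : List (Arrow X)}
    {G : Multiset (X × X)} {N : Multiset X} (h : LabPiece f P i o A G N) :
    i.length = P.inputs ∧ o.length = P.outputs := by
  cases h <;> exact ⟨rfl, rfl⟩

/-- Labellings in which all labels at real crossings are new are labellings in general. -/
theorem Lab.of_fresh {k : ℕ} {w : List Layer} {B B' : List (Bool × X)} {A : List (Arrow X)}
    {G : Multiset (X × X)} {N : Multiset X} (h : Lab true k w B B' A G N) :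
    ∃ k', Lab false k' w B B' A G N := by
  induction h with
  | nil B => exact ⟨0, .nil B⟩
  | sub u v d x y _ ih => obtain ⟨k', ih⟩ := ih; exact ⟨_, .sub u v d x y ih⟩
  | @cons P i o A₀ G₀ N₀ h u v k w B' A G N h' ih =>
    obtain ⟨k', ih⟩ := ih
    cases h with
    | maximum d y => exact ⟨_, .cons (.maximum d y) u v ih⟩
    | minimum d x y => exact ⟨_, .cons (.minimum d x y) u v ih⟩
    | virt p q => exact ⟨_, .cons (.virt p q) u v ih⟩
    | real c hc d e x y a b _ _ _ _ r r' =>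
      cases r with
      | keep _ h => simp at h
      | new =>
      cases r' with
      | keep _ h => simp at h
      | new =>
      have st : ∀ (d : Bool) (x a : X), ∃ z H M, Relabel false d z a H M ∧
          (d = true → z = a ∧ H = 0 ∧ M = 0) ∧
          (d = false → z = x ∧ H = {link d x a} ∧ M = {a}) := by
        intro d x a
        cases d
        · exact ⟨x, _, _, .new false x a (Or.inr rfl), by simp, fun _ => ⟨rfl, rfl, rfl⟩⟩
        · exact ⟨a, _, _, .keep a rfl, fun _ => ⟨rfl, rfl, rfl⟩, by simp⟩
      obtain ⟨z, H, M, r1, r2, r3⟩ := st d x a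
      obtain ⟨z', H', M', s1, s2, s3⟩ := st e y b
      have key := Lab.cons (.real c hc d e z z' a b H H' M M' r1 s1) u v ih
      -- a strand that goes down is subdivided above the crossing
      have key2 : ∃ k'', Lab false k'' (⟨u.length, .crossing c⟩ :: w)
          (u ++ (d, z) :: (e, y) :: v) B' ([arrowOf c d e a b] ++ A) (H + {link e y b} + G)
          (M + {b} + N) := by
        cases e
        · obtain ⟨rfl, rfl, rfl⟩ := s3 rfl
          exact ⟨_, by simpa using key⟩
        · obtain ⟨rfl, rfl, rfl⟩ := s2 rfl
          have := Lab.sub (u ++ [(d, z)]) v true y z' (by simpa using key)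
          refine ⟨k' + 1, ?_⟩
          convert this using 1
          all_goals first | (simp; done) | abel
      obtain ⟨k'', key2⟩ := key2
      cases d
      · obtain ⟨rfl, rfl, rfl⟩ := r3 rfl
        exact ⟨_, by simpa using key2⟩
      · obtain ⟨rfl, rfl, rfl⟩ := r2 rfl
        rw [zero_add, zero_add] at key2
        have := Lab.sub u ((e, y) :: v) true x z key2
        refine ⟨k'' + 1, ?_⟩
        convert this using 1
        all_goals first | (simp; done) | abel

/-- Every diagram has a labelling. -/
theorem exists_lab {w : List Layer} {s t : List Bool} (h : Run w s t) :
    ∀ (B : List (Bool × ℕ)), B.map Prod.fst = s → ∀ k : ℕ, ∃ B' A G N,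
      Lab true 0 w B B' A G N ∧ B'.map Prod.fst = t ∧ N.Nodup ∧ ∀ x ∈ N, k ≤ x := by
  induction h with
  | nil s => exact fun B hB k => ⟨B, [], 0, 0, .nil B, hB, Multiset.nodup_zero, by simp⟩
  | @cons L w s t u' h h' ih =>
    intro B hB k
    have step : ∀ (P : Piece) (u v : List Bool) (si so : List Bool) (Bu Bi Bv o : List (Bool × ℕ))
        (A₁ : List (Arrow ℕ)) (G₁ : Multiset (ℕ × ℕ)) (N₁ : Multiset ℕ),
        L = ⟨u.length, P⟩ → t = u ++ so ++ v → B = Bu ++ Bi ++ Bv → Bu.map Prod.fst = u →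
        Bv.map Prod.fst = v → o.map Prod.fst = so → LabPiece true P Bi o A₁ G₁ N₁ →
        N₁.Nodup → (∀ x ∈ N₁, k ≤ x ∧ x < k + 2) →
        ∃ B' A G N, Lab true 0 (L :: w) B B' A G N ∧ B'.map Prod.fst = u' ∧ N.Nodup ∧
          ∀ x ∈ N, k ≤ x := by
      rintro P u v si so Bu Bi Bv o A₁ G₁ N₁ rfl rfl rfl rfl rfl rfl hP hN hN'
      obtain ⟨B', A, G, N, h1, h2, h3, h4⟩ := ih (Bu ++ o ++ Bv) (by simp) (k + 2)
      refine ⟨B', _, _, _, by rw [List.length_map]; exact .cons hP Bu Bv h1, h2, ?_, ?_⟩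
      · refine Multiset.nodup_add.mpr ⟨hN, h3, ?_⟩
        rw [Multiset.disjoint_left]
        intro x hx hx'
        have := hN' x hx
        have := h4 x hx'
        omega
      · intro x hx
        rcases Multiset.mem_add.mp hx with hx | hx
        · exact (hN' x hx).1
        · have := h4 x hx; omega
    cases h with
    | maximum u v d =>
      obtain ⟨Bu, Bv, rfl, hu, hv⟩ := List.map_eq_append_iff.mp hB
      exact step _ u v [] [d, !d] Bu [] Bv [(d, k), (!d, k)] _ _ _ rfl (by simp) (by simp) hu hv rfl
        (.maximum d k) (by simp) (by simp)
    | minimum u v d =>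
      obtain ⟨Bu, C, rfl, hu, hC⟩ := List.map_eq_append_iff.mp hB
      obtain ⟨⟨d1, x⟩, C, rfl, hd1, hC⟩ := List.map_eq_cons_iff.mp hC
      obtain ⟨⟨d2, y⟩, Bv, rfl, hd2, hv⟩ := List.map_eq_cons_iff.mp hC
      simp only at hd1 hd2
      subst hd1 hd2
      exact step _ u v [d1, !d1] [] Bu [(d1, x), (!d1, y)] Bv [] _ _ _ rfl (by simp) (by simp) hu hv
        rfl (.minimum d1 x y) (by simp) (by simp)
    | crossing u v d e c =>
      obtain ⟨Bu, C, rfl, hu, hC⟩ := List.map_eq_append_iff.mp hB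
      obtain ⟨⟨d1, x⟩, C, rfl, hd1, hC⟩ := List.map_eq_cons_iff.mp hC
      obtain ⟨⟨d2, y⟩, Bv, rfl, hd2, hv⟩ := List.map_eq_cons_iff.mp hC
      simp only at hd1 hd2
      subst hd1 hd2
      have real : c.IsReal → ∃ B' A G N,
          Lab true 0 (cr u.length c :: w) (Bu ++ (d1, x) :: (d2, y) :: Bv) B' A G N ∧
          B'.map Prod.fst = u' ∧ N.Nodup ∧ ∀ x ∈ N, k ≤ x := by
        intro hc
        exact step _ u v [d1, d2] [d2, d1] Bu [(d1, x), (d2, y)] Bv [(d2, k + 1), (d1, k)] _ _ _ rfl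
          (by simp) (by simp) hu hv rfl
          (.real c hc d1 d2 x y k (k + 1) _ _ _ _
            (.new _ _ _ (Or.inl rfl)) (.new _ _ _ (Or.inl rfl)))
          (by simp) (by simp)
      cases c with
      | virt =>
        exact step _ u v [d1, d2] [d2, d1] Bu [(d1, x), (d2, y)] Bv [(d2, y), (d1, x)] _ _ _ rfl
          (by simp) (by simp) hu hv rfl (.virt _ _) (by simp) (by simp)
      | leftOver => exact real (by simp [Crossing.IsReal])
      | rightOver => exact real (by simp [Crossing.IsReal])

theorem Lab.find_sub {k : ℕ} {w : List Layer} {B B'' : List (Bool × X)} {A : List (Arrow X)}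
    {G : Multiset (X × X)} {N : Multiset X} (h : Lab f (k + 1) w B B'' A G N) :
    ∃ w₁ w₂ u v d x y A₁ A₂ G₁ G₂ N₁ N₂, w = w₁ ++ w₂ ∧
      Lab f 0 w₁ B (u ++ (d, x) :: v) A₁ G₁ N₁ ∧ Lab f k w₂ (u ++ (d, y) :: v) B'' A₂ G₂ N₂ ∧
      A = A₁ ++ A₂ ∧ G = {link d x y} + (G₁ + G₂) ∧ N = {y} + (N₁ + N₂) := by
  generalize hk : k + 1 = k' at h
  induction h with
  | nil => omega
  | cons h u v h' ih =>
    obtain ⟨w₁, w₂, u', v', d, x, y, A₁, A₂, G₁, G₂, N₁, N₂, rfl, h1, h2, rfl, rfl, rfl⟩ := ih hk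
    exact ⟨_, w₂, u', v', d, x, y, _, A₂, _, G₂, _, N₂, rfl, .cons h u v h1, h2, by simp, by abel,
      by abel⟩
  | sub u v d x y h' ih =>
    obtain rfl := Nat.succ_injective hk
    exact ⟨[], _, u, v, d, x, y, [], _, 0, _, 0, _, rfl, .nil _, h', rfl, by simp, by simp⟩

/-! ### Two labellings of the same diagram -/

theorem Relabel.pair {d : Bool} {x a : X} {y b : Y} {G : Multiset (X × X)} {G' : Multiset (Y × Y)}
    {N : Multiset X} {N' : Multiset Y} (h : Relabel false d x a G N)
    (h' : Relabel false d y b G' N') : ∃ H M, Relabel false d (x, y) (a, b) H M ∧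
      H.map (Prod.map Prod.fst Prod.fst) = G ∧ H.map (Prod.map Prod.snd Prod.snd) = G' ∧
      M.map Prod.fst = N ∧ M.map Prod.snd = N' := by
  cases h with
  | keep x h =>
    cases h' with
    | keep y h' => exact ⟨0, 0, .keep _ rfl, rfl, rfl, rfl, rfl⟩
    | new d y b h => simp at h
  | new d x a h =>
    cases h' with
    | keep y h' => simp at h
    | new d y b h =>
      exact ⟨_, _, .new d (x, y) (a, b) h, by simp [map_link], by simp [map_link], by simp, by simp⟩

theorem arrow_map_single (g : X → Y) (c : Crossing) (d e : Bool) (a b : X) :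
    [arrowOf c d e a b].map (Arrow.map g) = [arrowOf c d e (g a) (g b)] := by
  rw [List.map_singleton, map_arrowOf]

theorem LabPiece.pair {P : Piece} {i o : List (Bool × X)} {i' o' : List (Bool × Y)}
    {A : List (Arrow X)} {A' : List (Arrow Y)} {G : Multiset (X × X)} {G' : Multiset (Y × Y)}
    {N : Multiset X} {N' : Multiset Y} (h : LabPiece false P i o A G N)
    (h' : LabPiece false P i' o' A' G' N') (j : List (Bool × (X × Y)))
    (hj : mapRow Prod.fst j = i) (hj' : mapRow Prod.snd j = i') :
    ∃ q D H M, LabPiece false P j q D H M ∧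
      mapRow Prod.fst q = o ∧ mapRow Prod.snd q = o' ∧
      D.map (Arrow.map Prod.fst) = A ∧ D.map (Arrow.map Prod.snd) = A' ∧
      H.map (Prod.map Prod.fst Prod.fst) = G ∧ H.map (Prod.map Prod.snd Prod.snd) = G' ∧
      M.map Prod.fst = N ∧ M.map Prod.snd = N' := by
  have two : ∀ {d e d' e' : Bool} {x y : X} {x' y' : Y}, mapRow Prod.fst j = [(d, x), (e, y)] →
      mapRow Prod.snd j = [(d', x'), (e', y')] →
      j = [(d, (x, x')), (e, (y, y'))] ∧ d = d' ∧ e = e' := by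
    intro d e d' e' x y x' y' h1 h2
    rcases j with _ | ⟨⟨j1, j2, j3⟩, _ | ⟨⟨j4, j5, j6⟩, _ | ⟨j7, j⟩⟩⟩ <;> simp [mapRow] at h1 h2
    obtain ⟨⟨rfl, rfl⟩, rfl, rfl⟩ := h1
    obtain ⟨⟨rfl, rfl⟩, rfl, rfl⟩ := h2
    exact ⟨rfl, rfl, rfl⟩
  cases h with
  | maximum d y =>
    cases h' with
    | maximum _ y' =>
      have : j = [] := by simpa [mapRow] using hj
      subst this
      exact ⟨_, _, _, _, .maximum d (y, y'), rfl, rfl, rfl, rfl, rfl, rfl, rfl, rfl⟩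
  | minimum d x y =>
    cases h' with
    | minimum d' x' y' =>
      obtain ⟨rfl, rfl, -⟩ := two hj hj'
      exact ⟨_, _, _, _, .minimum d (x, x') (y, y'), rfl, rfl, rfl, rfl, by simp [map_link],
        by simp [map_link], rfl, rfl⟩
  | virt p q =>
    cases h' with
    | virt p' q' =>
      obtain ⟨rfl, h1, h2⟩ := two (d := p.1) (e := q.1) (d' := p'.1) (e' := q'.1) hj hj'
      refine ⟨_, _, _, _, .virt _ _, rfl, ?_, rfl, rfl, rfl, rfl, rfl, rfl⟩
      rw [h1, h2]; rfl
    | real _ hc => exact absurd rfl hc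
  | real c hc d e x y a b G₁ G₂ N₁ N₂ r1 r2 =>
    cases h' with
    | virt => exact absurd rfl hc
    | real _ hc' d' e' x' y' a' b' G₁' G₂' N₁' N₂' s1 s2 =>
      obtain ⟨rfl, rfl, rfl⟩ := two hj hj'
      obtain ⟨H, M, t, rfl, rfl, rfl, rfl⟩ := r1.pair s1
      obtain ⟨H', M', t', rfl, rfl, rfl, rfl⟩ := r2.pair s2
      exact ⟨_, _, _, _, .real c hc d e _ _ _ _ _ _ _ _ t t', rfl, rfl, arrow_map_single ..,
        arrow_map_single .., Multiset.map_add .., Multiset.map_add .., Multiset.map_add ..,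
        Multiset.map_add ..⟩

/-- Two labellings of the same diagram without subdivisions are the coordinates of one labelling by
pairs. -/
theorem Lab.pair {w : List Layer} {B₁ B₁' : List (Bool × X)} {B₂ B₂' : List (Bool × Y)}
    {A₁ : List (Arrow X)} {A₂ : List (Arrow Y)} {G₁ : Multiset (X × X)} {G₂ : Multiset (Y × Y)}
    {N₁ : Multiset X} {N₂ : Multiset Y} (h : Lab false 0 w B₁ B₁' A₁ G₁ N₁)
    (h' : Lab false 0 w B₂ B₂' A₂ G₂ N₂) (B : List (Bool × (X × Y)))
    (hB : mapRow Prod.fst B = B₁) (hB' : mapRow Prod.snd B = B₂) :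
    ∃ C D H M, Lab false 0 w B C D H M ∧ mapRow Prod.fst C = B₁' ∧
      D.map (Arrow.map Prod.fst) = A₁ ∧ D.map (Arrow.map Prod.snd) = A₂ ∧
      H.map (Prod.map Prod.fst Prod.fst) = G₁ ∧ H.map (Prod.map Prod.snd Prod.snd) = G₂ ∧
      M.map Prod.fst = N₁ ∧ M.map Prod.snd = N₂ := by
  induction w generalizing B₁ A₁ G₁ N₁ B₂ A₂ G₂ N₂ B with
  | nil =>
    obtain ⟨rfl, rfl, rfl, rfl⟩ := h.nil_inv
    obtain ⟨-, rfl, rfl, rfl⟩ := h'.nil_inv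
    exact ⟨B, [], 0, 0, .nil B, hB, rfl, rfl, rfl, rfl, rfl, rfl⟩
  | cons L w ih =>
    obtain ⟨p, P⟩ := L
    obtain ⟨u, v, i, o, A, A', G, G', N, N', hp, rfl, hP, hw, rfl, rfl, rfl⟩ := h.cons_inv
    obtain ⟨u₂, v₂, i₂, o₂, C, C', H, H', M, M', hp₂, rfl, hP₂, hw₂, rfl, rfl, rfl⟩ := h'.cons_inv
    obtain ⟨b1, bv, rfl, hb1, rfl⟩ := List.map_eq_append_iff.mp hB
    obtain ⟨bu, bi, rfl, rfl, rfl⟩ := List.map_eq_append_iff.mp hb1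
    change mapRow _ _ = _ at hB'
    rw [mapRow_append, mapRow_append] at hB'
    rw [List.length_map] at hp
    have hi := hP.inputs.1
    rw [List.length_map] at hi
    obtain ⟨e1, rfl⟩ := List.append_inj hB' (by
      simp only [List.length_append, mapRow_length, hP₂.inputs.1]; omega)
    obtain ⟨rfl, rfl⟩ := List.append_inj e1 (by rw [mapRow_length]; omega)
    obtain ⟨q, D, K, L, f1, f2, f3, rfl, rfl, rfl, rfl, rfl, rfl⟩ :=
      hP.pair hP₂ bi rfl rfl
    obtain ⟨C, D', K', L', g1, g2, rfl, rfl, rfl, rfl, rfl, rfl⟩ := ih hw hw₂ (bu ++ q ++ bv)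
      (by rw [mapRow_append, mapRow_append, f2]; rfl) (by rw [mapRow_append, mapRow_append, f3])
    subst hp
    exact ⟨_, _, _, _, .cons f1 bu bv g1, g2, by simp, by simp, by simp, by simp, by simp, by simp⟩

end

/-! ### The welded braid of a labelled diagram -/

theorem range_map_perm {n : ℕ} {π : Perm ℕ} (h : π ∈ Pm n) :
    (Multiset.range (n + 1)).map π = Multiset.range (n + 1) := by
  rw [Multiset.Nodup.ext ((Multiset.nodup_map_iff_of_injective π.injective).mpr
    (Multiset.nodup_range _)) (Multiset.nodup_range _)]
  intro x
  simp only [Multiset.mem_map, Multiset.mem_range]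
  constructor
  · rintro ⟨y, hy, rfl⟩
    exact Nat.lt_succ_of_le (Pm_le h (by omega))
  · intro hx
    have := Pm_le (inv_mem h) (i := x) (by omega)
    exact ⟨π⁻¹ x, by omega, by simp⟩

/-- A labelling of a diagram by the numbers `0, …, n`, each of which is the label of one piece of
strand, together with the closing permutation that joins these pieces. -/
structure Numbering (k : ℕ) (w : List Layer) (n : ℕ) (A : List (Arrow ℕ)) (G : Multiset (ℕ × ℕ))
    (π : Perm ℕ) : Prop where
  lab : Lab false k w [] [] A G (Multiset.range (n + 1))
  mem : π ∈ Pm n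
  joins : ∀ p ∈ G, Joins π p

/-- The welded braid `b` is obtained from a labelling of the diagram `w`. -/
def Presents (w : List Layer) (n : ℕ) (b : WeldedBraid n) : Prop :=
  ∃ k A G π, Numbering k w n A G π ∧ b = wd n A * vb n π

theorem Lab.arrow_ok {f : Bool} {k n : ℕ} {w : List Layer} {B : List (Bool × ℕ)}
    {A : List (Arrow ℕ)} {G : Multiset (ℕ × ℕ)}
    (h : Lab f k w [] B A G (Multiset.range (n + 1))) : ∀ a ∈ A, a.Ok n := by
  intro a ha
  have h1 := h.arrow_mem a ha
  have h2 := h.arrow_ne (by simpa [side_nil] using Multiset.nodup_range _) a ha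
  rw [side_nil, zero_add, Multiset.mem_range, Multiset.mem_range] at h1
  exact ⟨by omega, by omega, h2⟩

theorem Lab.joint_fst {f : Bool} {X : Type} {k : ℕ} {w : List Layer} {A : List (Arrow X)}
    {G : Multiset (X × X)} {N : Multiset X} (h : Lab f k w [] [] A G N) :
    G.map Prod.fst = N := by
  have := h.side true
  rw [side_nil, zero_add, add_zero] at this
  exact this

theorem Lab.joint_snd {f : Bool} {X : Type} {k : ℕ} {w : List Layer} {A : List (Arrow X)}
    {G : Multiset (X × X)} {N : Multiset X} (h : Lab f k w [] [] A G N) :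
    G.map Prod.snd = N := by
  have := h.side false
  rw [side_nil, zero_add, add_zero] at this
  exact this

open Classical in
/-- The joints of a closed diagram form a permutation. -/
theorem exists_perm_of_joints {n : ℕ} {G : Multiset (ℕ × ℕ)}
    (h1 : G.map Prod.fst = Multiset.range (n + 1)) (h2 : G.map Prod.snd = Multiset.range (n + 1)) :
    ∃ π ∈ Pm n, ∀ p ∈ G, Joins π p := by
  have i1 := Multiset.inj_on_of_nodup_map (h1 ▸ Multiset.nodup_range (n + 1))
  have i2 := Multiset.inj_on_of_nodup_map (h2 ▸ Multiset.nodup_range (n + 1))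
  have m1 : ∀ x, x ≤ n ↔ ∃ y, (x, y) ∈ G := by
    intro x
    rw [← Nat.lt_succ_iff, ← Multiset.mem_range, ← h1]
    simp
  have m2 : ∀ y, y ≤ n ↔ ∃ x, (x, y) ∈ G := by
    intro x
    rw [← Nat.lt_succ_iff, ← Multiset.mem_range, ← h2]
    simp
  let F : ℕ → ℕ := fun y => if h : ∃ x, (x, y) ∈ G then h.choose else y
  let F' : ℕ → ℕ := fun x => if h : ∃ y, (x, y) ∈ G then h.choose else x
  have F1 : ∀ x y, (x, y) ∈ G → F y = x := by
    intro x y h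
    have hex : ∃ x, (x, y) ∈ G := ⟨x, h⟩
    have := i2 _ hex.choose_spec _ h rfl
    simp only [F, dif_pos hex]
    exact congrArg Prod.fst this
  have F2 : ∀ x y, (x, y) ∈ G → F' x = y := by
    intro x y h
    have hex : ∃ y, (x, y) ∈ G := ⟨y, h⟩
    have := i1 _ hex.choose_spec _ h rfl
    simp only [F', dif_pos hex]
    exact congrArg Prod.snd this
  have F3 : ∀ y, n < y → F y = y := fun y hy => dif_neg (by rw [← m2]; omega)
  have F4 : ∀ y, n < y → F' y = y := fun y hy => dif_neg (by rw [← m1]; omega)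
  refine ⟨⟨F, F', ?_, ?_⟩, F3, fun p hp => F1 _ _ hp⟩
  · intro y
    rcases le_or_gt y n with h | h
    · obtain ⟨x, hx⟩ := (m2 y).mp h
      rw [F1 _ _ hx, F2 _ _ hx]
    · rw [F3 _ h, F4 _ h]
  · intro x
    rcases le_or_gt x n with h | h
    · obtain ⟨y, hy⟩ := (m1 x).mp h
      rw [F2 _ _ hy, F1 _ _ hy]
    · rw [F4 _ h, F3 _ h]

/-- The joints determine the closing permutation. -/
theorem perm_eq_of_joins {n : ℕ} {G : Multiset (ℕ × ℕ)} {π ρ : Perm ℕ} (hπ : π ∈ Pm n)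
    (hρ : ρ ∈ Pm n) (h2 : G.map Prod.snd = Multiset.range (n + 1)) (h : ∀ p ∈ G, Joins π p)
    (h' : ∀ p ∈ G, Joins ρ p) : π = ρ := by
  ext y
  rcases le_or_gt y n with hy | hy
  · have : y ∈ G.map Prod.snd := by rw [h2, Multiset.mem_range]; omega
    obtain ⟨p, hp, rfl⟩ := Multiset.mem_map.mp this
    rw [h p hp, h' p hp]
  · rw [hπ y hy, hρ y hy]

/-! ### Removal of subdivisions -/

theorem map_arrow_congr {X Y : Type} {g g' : X → Y} {A : List (Arrow X)}
    (h : ∀ a ∈ A, g a.tail = g' a.tail ∧ g a.head = g' a.head) :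
    A.map (Arrow.map g) = A.map (Arrow.map g') := by
  refine List.map_congr_left fun a ha => ?_
  rw [Arrow.map, Arrow.map, (h a ha).1, (h a ha).2]

theorem map_arrow_map {X Y Z : Type} (g : X → Y) (g' : Y → Z) (A : List (Arrow X)) :
    (A.map (Arrow.map g)).map (Arrow.map g') = A.map (Arrow.map (fun x => g' (g x))) := by
  rw [List.map_map]; rfl

/-- A subdivision of a strand is removed by a destabilization. Where a strand is cut into `x` and
`y`, the label `y` is replaced by `x`. On a strand that goes up, the label `y` has no arrows,
because the arrow of a crossing belongs to the label introduced there and `y` is introduced at the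
subdivision. On a strand that goes down, the arrows of `x` come first in the word, and the arrows
of `y` after them. -/
theorem Numbering.remove_sub {k : ℕ} {w : List Layer} {n : ℕ} {A : List (Arrow ℕ)}
    {G : Multiset (ℕ × ℕ)} {π : Perm ℕ} (h : Numbering (k + 1) w n A G π) :
    ∃ m A' G' π', Numbering k w m A' G' π' ∧
      BraidsRelated ⟨n, wd n A * vb n π⟩ ⟨m, wd m A' * vb m π'⟩ := by
  obtain ⟨hL, hπ, hG⟩ := h
  have hok := hL.arrow_ok
  have hfst := hL.joint_fst
  have hsnd := hL.joint_snd
  obtain ⟨w₁, w₂, u, v, d, x, y, A₁, A₂, G₁, G₂, N₁, N₂, rfl, h1, h2, rfl, rfl, hN⟩ := hL.find_sub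
  have hnd := Multiset.nodup_range (n + 1)
  rw [hN, Multiset.nodup_add, Multiset.nodup_add] at hnd
  obtain ⟨-, ⟨hN1, -, hN12⟩, hyN⟩ := hnd
  rw [Multiset.singleton_disjoint, Multiset.mem_add, not_or] at hyN
  rw [Multiset.disjoint_left] at hN12
  have hside : ∀ t, side t (u ++ (d, x) :: v) ≤ N₁ := by
    intro t
    rw [← zero_add N₁, ← side_nil (X := ℕ) t, ← h1.side t]
    exact Multiset.le_add_left _ _
  have hxN : x ∈ N₁ := Multiset.mem_of_le (hside d) (by simp [side_append, side_cons])
  have hxy : x ≠ y := fun e => hyN.1 (e ▸ hxN)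
  have hmem : ∀ z, z ∈ ({y} + (N₁ + N₂) : Multiset ℕ) → z ≤ n := by
    intro z hz
    rw [← hN, Multiset.mem_range] at hz
    omega
  have hx : x ≤ n := hmem x (by simp [hxN])
  have hy : y ≤ n := hmem y (by simp)
  obtain ⟨m, rfl⟩ : ∃ m, n = m + 1 := ⟨n - 1, by omega⟩
  obtain ⟨ρ, hρ, hρx, hρy⟩ :=
    exists_perm₂ hx hy hxy (Nat.le_succ m) le_rfl (Nat.succ_ne_self m).symm
  set g : ℕ → ℕ := fun z => ρ (if z = y then x else z) with hg
  have gy : g y = m := by simp [hg, hρx]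
  have gx : g x = m := by simp [hg, hρx, hxy]
  have gne : ∀ z, z ≠ y → g z = ρ z := fun z hz => by simp [hg, hz]
  have L' : Lab false k (w₁ ++ w₂) [] [] ((A₁ ++ A₂).map (Arrow.map g))
      ((G₁ + G₂).map (Prod.map g g)) (Multiset.range (m + 1)) := by
    have e1 := h1.map g
    have e2 := h2.map g
    rw [mapRow_append, mapRow_cons, gx] at e1
    rw [mapRow_append, mapRow_cons, gy] at e2
    have e3 := e1.append e2
    rw [zero_add, ← List.map_append, ← Multiset.map_add, ← Multiset.map_add] at e3
    have : (N₁ + N₂).map g = Multiset.range (m + 1) := by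
      have c1 : (N₁ + N₂).map g = (N₁ + N₂).map ρ := by
        refine Multiset.map_congr rfl fun z hz => gne z ?_
        rintro rfl
        rw [Multiset.mem_add] at hz
        tauto
      have c2 := congrArg (Multiset.map ρ) hN
      rw [range_map_perm hρ, Multiset.map_add, Multiset.map_singleton, hρy,
        Multiset.range_succ (m + 1), ← Multiset.singleton_add] at c2
      rw [c1]
      exact (add_left_cancel c2).symm
    rwa [this] at e3
  have hok' := L'.arrow_ok
  have hs := swap_mem_Pm hx hy
  have J : Joint (m + 1) x y (vb (m + 1) (swap x y)) := .virt
  obtain ⟨L, hSt, eL⟩ := J.conj hxy hx hy hρ hρx hρy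
  have tt := vb_swap_swap hx hy
  have lab1 : ∀ a ∈ A₁, a.tail ≠ y ∧ a.head ≠ y := by
    intro a ha
    have := h1.arrow_mem a ha
    rw [side_nil, zero_add] at this
    exact ⟨fun e => hyN.1 (e ▸ this.1), fun e => hyN.1 (e ▸ this.2)⟩
  -- other joints do not contain the end or the beginning joined here
  have jn : ∀ p ∈ G₁ + G₂, Joins π p ∧ p.1 ≠ (link d x y).1 ∧ p.2 ≠ (link d x y).2 := by
    intro p hp
    refine ⟨hG p (Multiset.mem_add.mpr (Or.inr hp)), ?_, ?_⟩
    · intro e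
      have := Multiset.nodup_range (m + 1 + 1)
      rw [← hfst, Multiset.map_add, Multiset.nodup_add, Multiset.map_singleton,
        Multiset.singleton_disjoint] at this
      exact this.2.2 (Multiset.mem_map.mpr ⟨p, hp, e⟩)
    · intro e
      have := Multiset.nodup_range (m + 1 + 1)
      rw [← hsnd, Multiset.map_add, Multiset.nodup_add, Multiset.map_singleton,
        Multiset.singleton_disjoint] at this
      exact this.2.2 (Multiset.mem_map.mpr ⟨p, hp, e⟩)
  have hj : Joins π (link d x y) := hG _ (by simp)
  have hok1 : ∀ a ∈ A₁, a.Ok (m + 1) := fun a ha => hok a (List.mem_append_left _ ha)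
  have hok2 : ∀ a ∈ A₂, a.Ok (m + 1) := fun a ha => hok a (List.mem_append_right _ ha)
  rw [List.map_append] at hok'
  have lift : ∀ {C : List (Arrow ℕ)} {h : ℕ → ℕ}, (∀ a ∈ C, a.Ok (m + 1)) →
      (∀ a ∈ C, ρ a.tail = h a.tail ∧ ρ a.head = h a.head) →
      (∀ a ∈ C.map (Arrow.map h), a.Ok m) →
      vb (m + 1) ρ * wd (m + 1) C =
        WeldedBraid.addRight (wd m (C.map (Arrow.map h))) * vb (m + 1) ρ := by
    intro C h c1 c2 c3
    rw [vb_wd hρ c1, map_arrow_congr c2, addRight_wd c3]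
  have lift_perm : ∀ σ ∈ Pm (m + 1), σ y = y → ρ * σ * ρ⁻¹ ∈ Pm m ∧ vb (m + 1) ρ * vb (m + 1) σ =
      WeldedBraid.addRight (vb m (ρ * σ * ρ⁻¹)) * vb (m + 1) ρ := by
    intro σ hσ hσy
    have hm := mul_mem (mul_mem hρ hσ) (inv_mem hρ)
    have hm' : ρ * σ * ρ⁻¹ ∈ Pm m := by
      refine Pm_of_fix hm ?_
      have : ρ⁻¹ (m + 1) = y := by rw [← hρy]; simp
      rw [Perm.mul_apply, Perm.mul_apply, this, hσy, hρy]
    refine ⟨hm', ?_⟩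
    rw [addRight_vb hm', ← vb_mul hρ hσ, ← vb_mul hm hρ, inv_mul_cancel_right]
  cases d
  · -- a strand that goes up: the new label has no arrows
    have hxe : π x = y := hj
    have lab2 : ∀ a ∈ A₂, a.tail ≠ y ∧ a.head ≠ y := by
      have hle : side true (u ++ (false, y) :: v) ≤ N₁ := by
        have := hside true
        simpa [side_append, side_cons] using this
      have : ∀ z, z ∈ side true (u ++ (false, y) :: v) + N₂ → z ≠ y := by
        rintro z hz rfl
        rcases Multiset.mem_add.mp hz with hz | hz
        · exact hyN.1 (Multiset.mem_of_le hle hz)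
        · exact hyN.2 hz
      intro a ha
      have h3 := h2.arrow_mem a ha
      exact ⟨this _ h3.1, this _ h3.2⟩
    have hfix : (π * swap x y) y = y := by simp [hxe]
    obtain ⟨hm', ep⟩ := lift_perm _ (mul_mem hπ hs) hfix
    have eA := lift (C := A₁ ++ A₂) (h := g) hok (by
      intro a ha
      rcases List.mem_append.mp ha with ha | ha
      · exact ⟨(gne _ (lab1 a ha).1).symm, (gne _ (lab1 a ha).2).symm⟩
      · exact ⟨(gne _ (lab2 a ha).1).symm, (gne _ (lab2 a ha).2).symm⟩) (by rwa [List.map_append])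
    have key := destab hSt eL
      (V := wd m ((A₁ ++ A₂).map (Arrow.map g)) * vb m (ρ * (π * swap x y) * ρ⁻¹))
      (by rw [map_mul]; exact conj_mul eA ep)
    refine ⟨m, _, _, _, ⟨L', hm', ?_⟩, BraidsRelated.trans ?_ key⟩
    · intro p hp
      obtain ⟨⟨a, b⟩, hp', rfl⟩ := Multiset.mem_map.mp hp
      obtain ⟨j1, j2, j3⟩ := jn _ hp'
      simp only [link, Bool.false_eq_true, if_false] at j2 j3
      simp only [Joins, Prod.map] at j1 ⊢
      rw [gne a j2]
      simp only [hg, Perm.mul_apply, Perm.inv_def, Equiv.symm_apply_apply]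
      by_cases hb : b = y
      · rw [if_pos hb, Equiv.swap_apply_left, ← j1, hb]
      · rw [if_neg hb, Equiv.swap_apply_of_ne_of_ne j3 hb, j1]
    · have := braidsRelated_comm (wd (m + 1) (A₁ ++ A₂) * vb (m + 1) (π * swap x y))
        (vb (m + 1) (swap x y))
      rwa [mul_assoc, ← vb_mul (mul_mem hπ hs) hs, mul_assoc, Equiv.swap_mul_self, mul_one] at this
  · -- a strand that goes down: the old label has no arrows below the subdivision
    have hye : π y = x := hj
    have lab2 : ∀ a ∈ A₂, a.tail ≠ x ∧ a.head ≠ x := by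
      have hle := Multiset.nodup_of_le (hside true) hN1
      have hxs : x ∉ side true u + side true v := by
        simp only [side_append, side_cons, if_true] at hle
        rw [← add_assoc, add_right_comm, add_comm, Multiset.nodup_add,
          Multiset.singleton_disjoint] at hle
        exact hle.2.2
      have : ∀ z, z ∈ side true (u ++ (true, y) :: v) + N₂ → z ≠ x := by
        rintro z hz rfl
        simp only [side_append, side_cons, if_true, Multiset.mem_add, Multiset.mem_singleton]
          at hz hxs
        rcases hz with (hz | hz | hz) | hz
        · tauto
        · exact hxy hz
        · tauto
        · exact hN12 hxN hz
      intro a ha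
      have h3 := h2.arrow_mem a ha
      exact ⟨this _ h3.1, this _ h3.2⟩
    have hfix : (swap x y * π) y = y := by simp [hye]
    obtain ⟨hm', ep⟩ := lift_perm _ (mul_mem hs hπ) hfix
    have eA1 := lift (C := A₁) (h := g) hok1
      (fun a ha => ⟨(gne _ (lab1 a ha).1).symm, (gne _ (lab1 a ha).2).symm⟩)
      (fun a ha => hok' a (List.mem_append_left _ ha))
    have e0 : A₂.map (Arrow.map g) =
        (A₂.map (Arrow.map (swap x y))).map (Arrow.map ρ) := by
      rw [map_arrow_map]
      have hsw : ∀ z, z ≠ x → g z = ρ (swap x y z) := by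
        intro z hz
        by_cases h : z = y
        · rw [h, gy, Equiv.swap_apply_right, hρx]
        · rw [gne z h, Equiv.swap_apply_of_ne_of_ne hz h]
      exact map_arrow_congr fun a ha => ⟨hsw _ (lab2 a ha).1, hsw _ (lab2 a ha).2⟩
    have eA2 := lift (C := A₂.map (Arrow.map (swap x y))) (h := ρ) (by
        intro a ha
        obtain ⟨a', ha', rfl⟩ := List.mem_map.mp ha
        exact (hok2 a' ha').map hs) (fun _ _ => ⟨rfl, rfl⟩)
      (by rw [← e0]; exact fun a ha => hok' a (List.mem_append_right _ ha))
    rw [← e0] at eA2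
    have key := destab hSt eL
      (V := wd m (A₂.map (Arrow.map g)) * vb m (ρ * (swap x y * π) * ρ⁻¹) *
        wd m (A₁.map (Arrow.map g)))
      (by rw [map_mul, map_mul]; exact conj_mul (conj_mul eA2 ep) eA1)
    refine ⟨m, _, _, _, ⟨L', hm', ?_⟩, BraidsRelated.trans ?_ (key.trans ?_)⟩
    · intro p hp
      obtain ⟨⟨a, b⟩, hp', rfl⟩ := Multiset.mem_map.mp hp
      obtain ⟨j1, j2, j3⟩ := jn _ hp'
      simp only [link, if_true] at j2 j3
      simp only [Joins, Prod.map] at j1 ⊢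
      rw [gne b j3, Perm.mul_apply, Perm.mul_apply, Perm.inv_def, Equiv.symm_apply_apply,
        Perm.mul_apply, j1]
      by_cases hb : a = y
      · rw [hb, gy, Equiv.swap_apply_right, hρx]
      · rw [gne a hb, Equiv.swap_apply_of_ne_of_ne j2 hb]
    · have e10 := vb_wd hs hok2
      have e11 : vb (m + 1) π = vb (m + 1) (swap x y) * vb (m + 1) (swap x y * π) := by
        rw [← vb_mul hs (mul_mem hs hπ), ← mul_assoc, Equiv.swap_mul_self, one_mul]
      have e12 : wd (m + 1) A₂ * vb (m + 1) (swap x y) =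
          vb (m + 1) (swap x y) * wd (m + 1) (A₂.map (Arrow.map (swap x y))) := by
        have e13 := congrArg (fun b => vb (m + 1) (swap x y) * b * vb (m + 1) (swap x y)) e10
        simp only [← mul_assoc, tt, one_mul] at e13
        rwa [mul_assoc _ (vb _ _) (vb _ _), tt, mul_one] at e13
      rw [wd_append, mul_assoc, e11, ← mul_assoc (wd _ A₂), e12]
      have := braidsRelated_comm (wd (m + 1) A₁) (vb (m + 1) (swap x y) *
        wd (m + 1) (A₂.map (Arrow.map (swap x y))) * vb (m + 1) (swap x y * π))
      simpa only [mul_assoc] using this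
    · have := braidsRelated_comm (wd m (A₂.map (Arrow.map g)) *
        vb m (ρ * (swap x y * π) * ρ⁻¹)) (wd m (A₁.map (Arrow.map g)))
      rw [List.map_append, wd_append, mul_assoc (wd m (A₁.map _))]
      exact this

/-- The subdivisions of a labelled diagram may be removed. -/
theorem Numbering.remove_subs {k : ℕ} {w : List Layer} {n : ℕ} {A : List (Arrow ℕ)}
    {G : Multiset (ℕ × ℕ)} {π : Perm ℕ} (h : Numbering k w n A G π) :
    ∃ m A' G' π', Numbering 0 w m A' G' π' ∧
      BraidsRelated ⟨n, wd n A * vb n π⟩ ⟨m, wd m A' * vb m π'⟩ := by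
  induction k generalizing n A G π with
  | zero => exact ⟨n, A, G, π, h, .refl _⟩
  | succ k ih =>
    obtain ⟨m, A', G', π', h', r⟩ := h.remove_sub
    obtain ⟨m', A'', G'', π'', h'', r'⟩ := ih h'
    exact ⟨m', A'', G'', π'', h'', r.trans r'⟩

/-- The welded braid of a diagram does not depend on the labelling, up to Markov moves: without
subdivisions, two labellings differ by a permutation of the labels, which conjugates the braid. -/
theorem Presents.unique {w : List Layer} {n n' : ℕ} {b : WeldedBraid n} {b' : WeldedBraid n'}
    (h : Presents w n b) (h' : Presents w n' b') : BraidsRelated ⟨n, b⟩ ⟨n', b'⟩ := by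
  obtain ⟨k, A, G, π, h, rfl⟩ := h
  obtain ⟨k', A', G', π', h', rfl⟩ := h'
  obtain ⟨m, A, G, π, h, r⟩ := h.remove_subs
  obtain ⟨m', A', G', π', h', r'⟩ := h'.remove_subs
  refine r.trans (BraidsRelated.trans ?_ r'.symm)
  clear r r'
  obtain ⟨C, D, H, M, hL, hC, e1, e2, e3, e4, e5, e6⟩ := h.lab.pair h'.lab [] rfl rfl
  obtain rfl : C = [] := List.map_eq_nil_iff.mp hC
  obtain rfl : m = m' := by
    have c1 := congrArg Multiset.card e5
    have c2 := congrArg Multiset.card e6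
    rw [Multiset.card_map, Multiset.card_range] at c1 c2
    omega
  -- the labels of the two labellings correspond to each other by a permutation
  obtain ⟨ρ, hρ, hj⟩ := exists_perm_of_joints e5 e6
  have hA : A'.map (Arrow.map ρ) = A := by
    rw [← e1, ← e2, map_arrow_map]
    refine map_arrow_congr fun a ha => ?_
    have := hL.arrow_mem a ha
    rw [side_nil, zero_add] at this
    exact ⟨hj _ this.1, hj _ this.2⟩
  have hπ : π = ρ * π' * ρ⁻¹ := by
    refine perm_eq_of_joins h.mem (mul_mem (mul_mem hρ h'.mem) (inv_mem hρ)) h.lab.joint_snd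
      h.joins ?_
    intro p hp
    rw [← e3] at hp
    obtain ⟨⟨⟨a, b⟩, ⟨c, d⟩⟩, hp', rfl⟩ := Multiset.mem_map.mp hp
    have m1 : (a, b) ∈ M := hL.joint_fst ▸ Multiset.mem_map_of_mem Prod.fst hp'
    have m2 : (c, d) ∈ M := hL.joint_snd ▸ Multiset.mem_map_of_mem Prod.snd hp'
    have m3 : Joins π' (b, d) := h'.joins _ (e4 ▸ Multiset.mem_map_of_mem _ hp')
    have j1 : ρ b = a := hj _ m1
    have j2 : ρ d = c := hj _ m2
    have j3 : π' d = b := m3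
    have j4 : ρ⁻¹ c = d := by rw [← j2]; simp
    simp only [Joins, Prod.map]
    rw [Perm.mul_apply, Perm.mul_apply, j4, j3, j1]
  refine (braidsRelated_of_conj (c := vb m ρ) ?_).symm
  refine conj_mul ?_ ?_
  · rw [vb_wd hρ h'.lab.arrow_ok, hA]
  · rw [hπ, ← vb_mul hρ h'.mem, ← vb_mul (mul_mem (mul_mem hρ h'.mem) (inv_mem hρ)) hρ,
      inv_mul_cancel_right]

/-- Finitely many different labels may be replaced by the numbers `0, …, n`. -/
theorem exists_numbers {N : Multiset ℕ} (hN : N.Nodup) (h0 : N ≠ 0) :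
    ∃ (n : ℕ) (g : ℕ → ℕ), N.map g = Multiset.range (n + 1) := by
  obtain ⟨l, rfl⟩ := Quot.exists_rep N
  have hl : l.Nodup := hN
  have hc : l.length ≠ 0 := fun e => h0 (by simpa using e)
  refine ⟨l.length - 1, fun x => l.idxOf x, ?_⟩
  rw [Nat.sub_add_cancel (by omega)]
  change ((l.map (fun x => l.idxOf x) : List ℕ) : Multiset ℕ) = (List.range l.length : Multiset ℕ)
  congr 1
  refine List.ext_getElem (by simp) fun i h1 h2 => ?_
  simp [hl.idxOf_getElem]

/-- Every nonempty diagram has a labelling by numbers, in which all labels at real crossings are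
new. -/
theorem exists_numbering {w : List Layer} (h : Run w [] []) (hw : w ≠ []) :
    ∃ n A G π, Lab true 0 w [] [] A G (Multiset.range (n + 1)) ∧ π ∈ Pm n ∧
      ∀ p ∈ G, Joins π p := by
  obtain ⟨B, A, G, N, hL, hB, hN, -⟩ := exists_lab h [] rfl 0
  obtain rfl : B = [] := by simpa using hB
  have h0 : N ≠ 0 := by
    obtain ⟨⟨p, P⟩, w, rfl⟩ := List.exists_cons_of_ne_nil hw
    obtain ⟨u, v, i, o, A₁, A₂, G₁, G₂, N₁, N₂, -, hB, hP, -, -, -, rfl⟩ := hL.cons_inv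
    obtain ⟨hB, -⟩ := List.append_eq_nil_iff.mp hB.symm
    obtain ⟨-, rfl⟩ := List.append_eq_nil_iff.mp hB
    cases hP
    simp
  obtain ⟨n, g, hg⟩ := exists_numbers hN h0
  have hL' := hL.map g
  rw [hg] at hL'
  obtain ⟨π, hπ, hj⟩ := exists_perm_of_joints hL'.joint_fst hL'.joint_snd
  exact ⟨n, _, _, π, hL', hπ, hj⟩

/-! ### Local moves -/

theorem Relabel.fresh_inv {X : Type} {d : Bool} {x a : X} {G : Multiset (X × X)} {N : Multiset X}
    (h : Relabel true d x a G N) : G = {link d x a} ∧ N = {a} := by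
  cases h with
  | keep _ h => simp at h
  | new => exact ⟨rfl, rfl⟩

/-- The labels at the ends of an arrow are new. -/
theorem Lab.arrow_le {X : Type} {k : ℕ} {w : List Layer} {B B' : List (Bool × X)}
    {A : List (Arrow X)} {G : Multiset (X × X)} {N : Multiset X} (h : Lab true k w B B' A G N) :
    ∀ a ∈ A, {a.tail} + {a.head} ≤ N := by
  induction h with
  | nil B => simp
  | @cons P i o A G N h u v k w B' A' G' N' h' ih =>
    intro q hq
    rcases List.mem_append.mp hq with hq | hq
    · refine le_trans ?_ (Multiset.le_add_right _ _)
      cases h with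
      | maximum d y => simp at hq
      | minimum d x y => simp at hq
      | virt p q => simp at hq
      | real c hc d e x y a b G G' N N' h₁ h₂ =>
        obtain ⟨-, rfl⟩ := h₁.fresh_inv
        obtain ⟨-, rfl⟩ := h₂.fresh_inv
        rw [List.mem_singleton] at hq
        subst hq
        cases c
        · exact le_rfl
        · exact le_of_eq (add_comm _ _)
        · exact le_of_eq (add_comm _ _)
    · exact (ih q hq).trans (Multiset.le_add_left _ _)
  | @sub u v d x y k w B' A' G' N' h' ih =>
    exact fun q hq => (ih q hq).trans (Multiset.le_add_left _ _)

/-- The labels at the ends of each arrow belong to `N`; they are different when `N` has no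
repetitions. -/
def ArrowsIn (A : List (Arrow ℕ)) (N : Multiset ℕ) : Prop :=
  ∀ a ∈ A, {a.tail} + {a.head} ≤ N

theorem ArrowsIn.mem {A : List (Arrow ℕ)} {N : Multiset ℕ} (h : ArrowsIn A N) {a : Arrow ℕ}
    (ha : a ∈ A) : a.tail ∈ N ∧ a.head ∈ N :=
  ⟨Multiset.mem_of_le (h a ha) (by simp), Multiset.mem_of_le (h a ha) (by simp)⟩

theorem ArrowsIn.ok {A : List (Arrow ℕ)} {N : Multiset ℕ} (h : ArrowsIn A N) {n : ℕ}
    (hN : N.Nodup) (hn : ∀ x ∈ N, x ≤ n) {a : Arrow ℕ} (ha : a ∈ A) : a.Ok n := by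
  refine ⟨hn _ (h.mem ha).1, hn _ (h.mem ha).2, fun e => ?_⟩
  have := Multiset.nodup_of_le (h a ha) hN
  rw [e] at this
  simp at this

theorem ArrowsIn.mem_Avoid {A : List (Arrow ℕ)} {N : Multiset ℕ} (h : ArrowsIn A N) {n : ℕ}
    (hN : N.Nodup) (hn : ∀ x ∈ N, x ≤ n) {y : ℕ} (hy : y ∉ N) : wd n A ∈ Avoid n y :=
  wd_mem_Avoid fun _ ha => ⟨h.ok hN hn ha, fun e => hy (e ▸ (h.mem ha).1),
    fun e => hy (e ▸ (h.mem ha).2)⟩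

theorem wd_comm_of_forall {n : ℕ} {A A' : List (Arrow ℕ)}
    (h : ∀ a ∈ A, ∀ a' ∈ A', Commute (a.ev n) (a'.ev n)) : Commute (wd n A) (wd n A') := by
  refine Commute.list_prod_left _ _ fun x hx => Commute.list_prod_right _ _ fun y hy => ?_
  obtain ⟨a, ha, rfl⟩ := List.mem_map.mp hx
  obtain ⟨a', ha', rfl⟩ := List.mem_map.mp hy
  exact h a ha a' ha'

theorem ArrowsIn.comm {A A' : List (Arrow ℕ)} {N N' : Multiset ℕ} (h : ArrowsIn A N)
    (h' : ArrowsIn A' N') {n : ℕ} (hN : (N + N').Nodup) (hn : ∀ x ∈ N + N', x ≤ n) :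
    Commute (wd n A) (wd n A') := by
  obtain ⟨h1, h2, h3⟩ := Multiset.nodup_add.mp hN
  rw [Multiset.disjoint_left] at h3
  have n1 : ∀ x ∈ N, x ≤ n := fun x hx => hn x (Multiset.mem_add.mpr (Or.inl hx))
  have n2 : ∀ x ∈ N', x ≤ n := fun x hx => hn x (Multiset.mem_add.mpr (Or.inr hx))
  refine wd_comm_of_forall fun a ha a' ha' => ev_comm_disjoint (h.ok h1 n1 ha) (h'.ok h2 n2 ha') ?_
  have m := h.mem ha
  have m' := h'.mem ha'
  exact ⟨fun e => h3 m.1 (e ▸ m'.1), fun e => h3 m.1 (e ▸ m'.2), fun e => h3 m.2 (e ▸ m'.1),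
    fun e => h3 m.2 (e ▸ m'.2)⟩

/-- The arrows `A` may be replaced by `A'` in a diagram that contains the joints `G` and whose other
arrows do not use the labels `N`. -/
def Replace (A A' : List (Arrow ℕ)) (G : Multiset (ℕ × ℕ)) (N : Multiset ℕ) : Prop :=
  ∀ (n : ℕ) (π : Perm ℕ) (r : WeldedBraid n), π ∈ Pm n → (∀ p ∈ G, Joins π p) → N.Nodup →
    (∀ x ∈ N, x ≤ n) → (∀ x ∈ N, r ∈ Avoid n x) →
    BraidsRelated ⟨n, wd n A * r * vb n π⟩ ⟨n, wd n A' * r * vb n π⟩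

theorem Replace.refl (A : List (Arrow ℕ)) (G : Multiset (ℕ × ℕ)) (N : Multiset ℕ) :
    Replace A A G N := fun _ _ _ _ _ _ _ _ => .refl _

/-- A labelling of `l`, in which all labels at real crossings are new, can be replaced by a
labelling of `r` with the same labels and joints, where subdivisions take up the labels of vanished
crossings. -/
def Carries (l r : List Layer) : Prop :=
  ∀ B B' A G N, Lab true 0 l B B' A G N →
    ∃ k A', Lab true k r B B' A' G N ∧ Replace A A' G N

/-- Effect of a local move on the welded braid of a diagram. The labels in the rest of the diagram
are different from those of the changed part, so the arrows above this part commute with its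
arrows, and `Replace` applies to the rest as a whole. -/
theorem Carries.presents {l r x y : List Layer} (h : Carries l r) (hw : Run (x ++ l ++ y) [] [])
    (h0 : x ++ l ++ y ≠ []) : ∃ n b b', Presents (x ++ l ++ y) n b ∧ Presents (x ++ r ++ y) n b' ∧
      BraidsRelated ⟨n, b⟩ ⟨n, b'⟩ := by
  obtain ⟨n, A, G, π, hL, hπ, hj⟩ := exists_numbering hw h0
  have hnd := Multiset.nodup_range (n + 1)
  have hn : ∀ z ∈ Multiset.range (n + 1), z ≤ n := fun z hz => by
    rw [Multiset.mem_range] at hz; omega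
  have hL0 := hL
  obtain ⟨k₁, k₂, B', A₁, A₂, G₁, G₂, N₁, N₂, hxl, hy, hk, rfl, rfl, hN⟩ := hL.split
  obtain ⟨k₃, k₄, B'', A₃, A₄, G₃, G₄, N₃, N₄, hx, hl, hk', rfl, rfl, rfl⟩ := hxl.split
  obtain ⟨rfl, rfl, rfl⟩ : k₂ = 0 ∧ k₃ = 0 ∧ k₄ = 0 := by omega
  obtain ⟨k, A', hr, hR⟩ := h _ _ _ _ _ hl
  have hL' := (hx.append hr).append hy
  rw [← hN] at hL'
  rw [hN] at hnd hn
  obtain ⟨k', f⟩ := hL.of_fresh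
  obtain ⟨k'', f'⟩ := hL'.of_fresh
  refine ⟨n, _, _, ⟨_, _, _, π, ⟨f, hπ, hj⟩, rfl⟩, ⟨_, _, _, π, ⟨f', hπ, hj⟩, rfl⟩, ?_⟩
  have ix : ArrowsIn A₃ N₃ := hx.arrow_le
  have il : ArrowsIn A₄ N₄ := hl.arrow_le
  have ir : ArrowsIn A' N₄ := hr.arrow_le
  have iy : ArrowsIn A₂ N₂ := hy.arrow_le
  obtain ⟨d1, d2, d3⟩ := Multiset.nodup_add.mp hnd
  have d1' := d1
  obtain ⟨d4, d5, d6⟩ := Multiset.nodup_add.mp d1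
  rw [Multiset.disjoint_left] at d3 d6
  have n1 : ∀ z ∈ N₃ + N₄, z ≤ n := fun z hz => hn z (Multiset.mem_add.mpr (Or.inl hz))
  have n2 : ∀ z ∈ N₂, z ≤ n := fun z hz => hn z (Multiset.mem_add.mpr (Or.inr hz))
  have n3 : ∀ z ∈ N₃, z ≤ n := fun z hz => n1 z (Multiset.mem_add.mpr (Or.inl hz))
  have n4 : ∀ z ∈ N₄, z ≤ n := fun z hz => n1 z (Multiset.mem_add.mpr (Or.inr hz))
  have key := hR n π (wd n A₃ * wd n A₂) hπ (fun p hp => hj p (by simp [hp])) d5 n4 (by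
    intro z hz
    exact mul_mem (ix.mem_Avoid d4 n3 fun hz' => d6 hz' hz)
      (iy.mem_Avoid d2 n2 fun hz' => d3 (Multiset.mem_add.mpr (Or.inr hz)) hz'))
  rw [← mul_assoc, ← mul_assoc, ← (ix.comm il d1 n1).eq, ← (ix.comm ir d1 n1).eq] at key
  rw [wd_append, wd_append, wd_append, wd_append]
  exact key

/-! ### Labellings of single pieces -/

section
variable {X : Type}

theorem Lab.head_inv {p : ℕ} {P : Piece} {w : List Layer} {B u C B' : List (Bool × X)}
    {A : List (Arrow X)} {G : Multiset (X × X)} {N : Multiset X}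
    (h : Lab true 0 (⟨p, P⟩ :: w) B B' A G N) (hB : B = u ++ C) (hp : u.length = p) :
    ∃ i o v A₁ A₂ G₁ G₂ N₁ N₂, C = i ++ v ∧ LabPiece true P i o A₁ G₁ N₁ ∧
      Lab true 0 w (u ++ (o ++ v)) B' A₂ G₂ N₂ ∧ A = A₁ ++ A₂ ∧ G = G₁ + G₂ ∧ N = N₁ + N₂ := by
  subst hp
  obtain ⟨u', v, i, o, A₁, A₂, G₁, G₂, N₁, N₂, hu, rfl, hP, hw, rfl, rfl, rfl⟩ := h.cons_inv
  rw [List.append_assoc] at hB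
  obtain ⟨rfl, rfl⟩ := List.append_inj hB hu
  exact ⟨i, o, v, _, _, _, _, _, _, rfl, hP, by simpa using hw, rfl, rfl, rfl⟩

/-- The labelling at a crossing of a strand with the orientation `d`, whose label changes from `x`
to `x'`, and a strand on its right with the orientation `e`, whose label changes from `y` to
`y'`. -/
inductive Cross : Crossing → Bool → X → X → Bool → X → X → List (Arrow X) → Multiset (X × X) →
    Multiset X → Prop
  | virt (d e : Bool) (x y : X) : Cross .virt d x x e y y [] 0 0
  | real (c : Crossing) (hc : c.IsReal) (d e : Bool) (x x' y y' : X) :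
      Cross c d x x' e y y' [arrowOf c d e x' y'] ({link d x x'} + {link e y y'}) ({x'} + {y'})

theorem LabPiece.cross {c : Crossing} {i o : List (Bool × X)} {A : List (Arrow X)}
    {G : Multiset (X × X)} {N : Multiset X} (h : LabPiece true (.crossing c) i o A G N) :
    ∃ d x x' e y y', i = [(d, x), (e, y)] ∧ o = [(e, y'), (d, x')] ∧
      Cross c d x x' e y y' A G N := by
  cases h with
  | virt p q => exact ⟨p.1, p.2, p.2, q.1, q.2, q.2, rfl, rfl, .virt _ _ _ _⟩
  | real c hc d e x y a b G G' N N' h h' =>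
    obtain ⟨rfl, rfl⟩ := h.fresh_inv
    obtain ⟨rfl, rfl⟩ := h'.fresh_inv
    exact ⟨_, _, _, _, _, _, rfl, rfl, .real _ hc _ _ _ _ _ _⟩

theorem Cross.piece {c : Crossing} {d e : Bool} {x x' y y' : X} {A : List (Arrow X)}
    {G : Multiset (X × X)} {N : Multiset X} (h : Cross c d x x' e y y' A G N) :
    LabPiece true (.crossing c) [(d, x), (e, y)] [(e, y'), (d, x')] A G N := by
  cases h with
  | virt => exact .virt _ _
  | real _ hc =>
    exact .real _ hc _ _ _ _ _ _ _ _ _ _ (.new _ _ _ (Or.inl rfl)) (.new _ _ _ (Or.inl rfl))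

theorem Lab.cross_inv {p : ℕ} {c : Crossing} {w : List Layer} {B u C B' : List (Bool × X)}
    {A : List (Arrow X)} {G : Multiset (X × X)} {N : Multiset X}
    (h : Lab true 0 (cr p c :: w) B B' A G N) (hB : B = u ++ C) (hp : u.length = p) :
    ∃ d x x' e y y' v A₁ A₂ G₁ G₂ N₁ N₂, C = (d, x) :: (e, y) :: v ∧
      Cross c d x x' e y y' A₁ G₁ N₁ ∧ Lab true 0 w (u ++ (e, y') :: (d, x') :: v) B' A₂ G₂ N₂ ∧
      A = A₁ ++ A₂ ∧ G = G₁ + G₂ ∧ N = N₁ + N₂ := by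
  obtain ⟨i, o, v, A₁, A₂, G₁, G₂, N₁, N₂, rfl, hP, hw, rfl, rfl, rfl⟩ := h.head_inv hB hp
  obtain ⟨d, x, x', e, y, y', rfl, rfl, hc⟩ := hP.cross
  exact ⟨d, x, x', e, y, y', v, _, _, _, _, _, _, rfl, hc, hw, rfl, rfl, rfl⟩

theorem Cross.cons {p : ℕ} {c : Crossing} {d e : Bool} {x x' y y' : X} {A A' : List (Arrow X)}
    {G G' : Multiset (X × X)} {N N' : Multiset X} (h : Cross c d x x' e y y' A G N)
    {u v B B₁ B' : List (Bool × X)} {k : ℕ} {w : List Layer} (h' : Lab true k w B₁ B' A' G' N')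
    (hp : u.length = p) (hB : u ++ (d, x) :: (e, y) :: v = B)
    (hB₁ : u ++ (e, y') :: (d, x') :: v = B₁) :
    Lab true k (cr p c :: w) B B' (A ++ A') (G + G') (N + N') := by
  subst hp hB hB₁
  have := Lab.cons h.piece u v (k := k) (w := w) (B' := B') (A' := A') (G' := G') (N' := N')
    (by simpa using h')
  simpa using this

theorem Lab.min_inv {p : ℕ} {w : List Layer} {B u C B' : List (Bool × X)}
    {A : List (Arrow X)} {G : Multiset (X × X)} {N : Multiset X}
    (h : Lab true 0 (mn p :: w) B B' A G N) (hB : B = u ++ C) (hp : u.length = p) :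
    ∃ d x y v G₂, C = (d, x) :: (!d, y) :: v ∧ Lab true 0 w (u ++ v) B' A G₂ N ∧
      G = {link d x y} + G₂ := by
  obtain ⟨i, o, v, A₁, A₂, G₁, G₂, N₁, N₂, rfl, hP, hw, rfl, rfl, rfl⟩ := h.head_inv hB hp
  cases hP with
  | minimum d x y => exact ⟨d, x, y, v, _, rfl, by simpa using hw, rfl⟩

theorem Lab.min_cons {p : ℕ} {w : List Layer} {B B₁ u v B' : List (Bool × X)} (d : Bool) (x y : X)
    {A : List (Arrow X)} {G : Multiset (X × X)} {N : Multiset X} {k : ℕ}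
    (h : Lab true k w B₁ B' A G N) (hp : u.length = p) (hB : u ++ (d, x) :: (!d, y) :: v = B)
    (hB₁ : u ++ v = B₁) :
    Lab true k (mn p :: w) B B' A ({link d x y} + G) N := by
  subst hp hB hB₁
  have := Lab.cons (.minimum d x y) u v (k := k) (by simpa using h)
  simpa using this

theorem Lab.max_inv {p : ℕ} {d : Bool} {w : List Layer} {B u C B' : List (Bool × X)}
    {A : List (Arrow X)} {G : Multiset (X × X)} {N : Multiset X}
    (h : Lab true 0 (mx p d :: w) B B' A G N) (hB : B = u ++ C) (hp : u.length = p) :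
    ∃ y N₂, Lab true 0 w (u ++ (d, y) :: (!d, y) :: C) B' A G N₂ ∧ N = {y} + N₂ := by
  obtain ⟨i, o, v, A₁, A₂, G₁, G₂, N₁, N₂, rfl, hP, hw, rfl, rfl, rfl⟩ := h.head_inv hB hp
  cases hP with
  | maximum d y => exact ⟨y, _, by simpa using hw, rfl⟩

theorem Lab.max_cons {p : ℕ} {w : List Layer} {B B₁ u v B' : List (Bool × X)} (d : Bool) (y : X)
    {A : List (Arrow X)} {G : Multiset (X × X)} {N : Multiset X} {k : ℕ}
    (h : Lab true k w B₁ B' A G N) (hp : u.length = p) (hB : u ++ v = B)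
    (hB₁ : u ++ (d, y) :: (!d, y) :: v = B₁) :
    Lab true k (mx p d :: w) B B' A G ({y} + N) := by
  subst hp hB hB₁
  have := Lab.cons (.maximum d y) u v (k := k) (by simpa using h)
  simpa using this

/-- The strands to the left of the first piece. -/
theorem Lab.exists_left {p : ℕ} {P : Piece} {w : List Layer} {B B' : List (Bool × X)}
    {A : List (Arrow X)} {G : Multiset (X × X)} {N : Multiset X}
    (h : Lab true 0 (⟨p, P⟩ :: w) B B' A G N) : ∃ u v, B = u ++ v ∧ u.length = p := by
  obtain ⟨u, v, i, o, A₁, A₂, G₁, G₂, N₁, N₂, hu, rfl, -⟩ := h.cons_inv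
  exact ⟨u, i ++ v, by simp, hu⟩

end

/-! ### Plane isotopy -/

theorem carries_exchange (p k : ℕ) (P Q : Piece) :
    Carries [⟨p, P⟩, ⟨p + P.outputs + k, Q⟩] [⟨p + P.inputs + k, Q⟩, ⟨p, P⟩] := by
  intro B B' A G N h
  obtain ⟨u, C, rfl, rfl⟩ := h.exists_left
  obtain ⟨i, o, v, A₁, A₂, G₁, G₂, N₁, N₂, rfl, hP, hw, rfl, rfl, rfl⟩ := h.head_inv rfl rfl
  obtain ⟨u', v', i', o', A₃, A₄, G₃, G₄, N₃, N₄, hu, hB, hQ, hw', rfl, rfl, rfl⟩ := hw.cons_inv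
  obtain ⟨rfl, rfl, rfl, rfl⟩ := hw'.nil_inv
  obtain ⟨m, rfl, rfl⟩ : ∃ m, u' = u ++ o ++ m ∧ v = m ++ i' ++ v' := by
    have e : (u ++ o) ++ v = u' ++ (i' ++ v') := by simpa using hB
    obtain ⟨m, h1, h2⟩ | ⟨m, h1, h2⟩ := List.append_eq_append_iff.mp e
    · exact ⟨m, h1, by simpa using h2⟩
    · have := congrArg List.length h1
      have := hP.inputs.2
      simp only [List.length_append] at *
      obtain rfl : m = [] := List.length_eq_zero_iff.mp (by omega)
      exact ⟨[], by simpa using h1.symm, by simpa using h2.symm⟩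
  have l1 : Lab true 0 [⟨u.length, P⟩] (u ++ i ++ (m ++ o' ++ v')) (u ++ o ++ (m ++ o' ++ v'))
      (A₁ ++ []) (G₁ + 0) (N₁ + 0) := .cons hP _ _ (.nil _)
  have l2 := Lab.cons hQ (u ++ i ++ m) v' (by simpa using l1)
  have hl : (u ++ i ++ m).length = u.length + P.inputs + k := by
    have h1 := hP.inputs
    simp only [List.length_append] at hu ⊢
    omega
  rw [hl] at l2
  refine ⟨0, A₃ ++ A₁, ?_, ?_⟩
  · convert l2 using 1
    all_goals first | (simp; done) | (simp only [add_zero]; abel)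
  · intro n π r hπ hj hN hn hr
    rw [List.append_nil, wd_append, wd_append]
    have i1 : ArrowsIn A₁ N₁ := by
      have := l1.arrow_le
      rwa [List.append_nil, add_zero] at this
    have i3 : ArrowsIn A₃ N₃ := by
      have := hw.arrow_le
      rwa [List.append_nil, add_zero] at this
    rw [add_zero] at hN hn
    rw [(i1.comm i3 hN hn).eq]
    exact .refl _

theorem Lab.exists_left_succ {X : Type} {p : ℕ} {P : Piece} {w : List Layer}
    {B B' : List (Bool × X)} {A : List (Arrow X)} {G : Multiset (X × X)} {N : Multiset X}
    (h : Lab true 0 (⟨p + 1, P⟩ :: w) B B' A G N) :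
    ∃ u s x v, B = u ++ (s, x) :: v ∧ u.length = p := by
  obtain ⟨u', v', rfl, hu⟩ := h.exists_left
  rcases List.eq_nil_or_concat' u' with rfl | ⟨u, ⟨s, x⟩, rfl⟩
  · simp at hu
  · exact ⟨u, s, x, v', by simp, by simpa using hu⟩

theorem carries_zigzag_right (p : ℕ) (d : Bool) : Carries [mx (p + 1) d, mn p] [] := by
  intro B B' A G N h
  obtain ⟨u, s, x, v, rfl, rfl⟩ := h.exists_left_succ
  obtain ⟨y, N, h1, rfl⟩ := h.max_inv (u := u ++ [(s, x)]) (C := v) (by simp) (by simp)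
  obtain ⟨d', x', y', v', G, e, h2, rfl⟩ := h1.min_inv (List.append_assoc ..) rfl
  obtain ⟨rfl, rfl, rfl, rfl⟩ := h2.nil_inv
  simp only [List.cons_append, List.nil_append, List.cons.injEq, Prod.mk.injEq] at e
  obtain ⟨⟨rfl, rfl⟩, ⟨rfl, rfl⟩, rfl⟩ := e
  refine ⟨1, [], ?_, .refl _ _ _⟩
  have := Lab.sub (f := true) u v s x y (.nil _)
  simpa using this

theorem carries_zigzag_left (p : ℕ) (d : Bool) : Carries [mx p d, mn (p + 1)] [] := by
  intro B B' A G N h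
  obtain ⟨u, v, rfl, rfl⟩ := h.exists_left
  obtain ⟨y, N, h1, rfl⟩ := h.max_inv rfl rfl
  obtain ⟨d', x', y', v', G, e, h2, rfl⟩ := h1.min_inv (u := u ++ [(d, y)]) (C := (!d, y) :: v)
    (by simp) (by simp)
  obtain ⟨rfl, rfl, rfl, rfl⟩ := h2.nil_inv
  simp only [List.cons.injEq, Prod.mk.injEq] at e
  obtain ⟨⟨rfl, rfl⟩, rfl⟩ := e
  refine ⟨1, [], ?_, .refl _ _ _⟩
  have := Lab.sub (f := true) u v' d y' y (.nil _)
  cases d <;> simpa [link] using this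

theorem link_not {X : Type} (d : Bool) (x y : X) : link (!d) x y = link d y x := by
  cases d <;> rfl

theorem carries_minimum_slide (p : ℕ) (c : Crossing) :
    Carries [cr p c, mn (p + 1)] [cr (p + 1) c.swap, mn p] := by
  intro B B' A G N h
  obtain ⟨u, v, rfl, rfl⟩ := h.exists_left
  obtain ⟨d, x, x', e, z, z', v, A₁, A₂, G₁, G₂, N₁, N₂, rfl, hc, h1, rfl, rfl, rfl⟩ :=
    h.cross_inv rfl rfl
  obtain ⟨d', x'', w, v', G, e', h2, rfl⟩ := h1.min_inv (u := u ++ [(e, z')]) (C := (d, x') :: v)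
    (by simp) (by simp)
  obtain ⟨rfl, rfl, rfl, rfl⟩ := h2.nil_inv
  simp only [List.cons.injEq, Prod.mk.injEq] at e'
  obtain ⟨⟨rfl, rfl⟩, rfl⟩ := e'
  have h3 : Lab true 0 [mn u.length] (u ++ (d, x) :: (!d, x') :: (e, z') :: v')
      (u ++ (e, z') :: v') [] ({link d x x'} + 0) 0 := Lab.min_cons d x x' (.nil _) rfl rfl rfl
  cases hc with
  | virt =>
    have h3 : Lab true 0 [mn u.length] (u ++ (d, x) :: (!d, w) :: (e, z) :: v')
      (u ++ (e, z) :: v') [] ({link d x w} + 0) 0 := Lab.min_cons d x w (.nil _) rfl rfl rfl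
    have h4 := (Cross.virt e (!d) z w).cons (u := u ++ [(d, x)]) (v := v') (p := u.length + 1) h3
      (by simp) rfl (by simp)
    refine ⟨0, _, ?_, .refl _ _ _⟩
    simpa [Crossing.swap] using h4
  | real _ hc =>
    have h4 := (Cross.real c.swap (by cases c <;> simp_all [Crossing.IsReal, Crossing.swap])
      e (!d) z z' w x').cons (u := u ++ [(d, x)]) (v := v') (p := u.length + 1) h3 (by simp) rfl
      (by simp)
    refine ⟨0, _, ?_, .refl _ _ _⟩
    convert h4 using 1
    · simp
    · simp
    · cases c <;> cases d <;> cases e <;> simp_all [arrowOf, Crossing.IsReal, Crossing.swap]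
    · rw [link_not]
      abel
    · abel

theorem IsReal.swap {c : Crossing} (h : c.IsReal) : c.swap.IsReal := by
  cases c <;> simp_all [Crossing.IsReal, Crossing.swap]

theorem carries_maximum_slide (p : ℕ) (d : Bool) (c : Crossing) :
    Carries [mx p d, cr (p + 1) c] [mx (p + 1) d, cr p c.swap] := by
  intro B B' A G N h
  obtain ⟨u, v, rfl, rfl⟩ := h.exists_left
  obtain ⟨y, N, h1, rfl⟩ := h.max_inv rfl rfl
  obtain ⟨d', y', y₁, e, z, z₁, v, A₁, A₂, G₁, G₂, N₁, N₂, e', hc, h2, rfl, rfl, rfl⟩ :=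
    h1.cross_inv (u := u ++ [(d, y)]) (C := (!d, y) :: v) (by simp) (by simp)
  obtain ⟨rfl, rfl, rfl, rfl⟩ := h2.nil_inv
  simp only [List.cons.injEq, Prod.mk.injEq] at e'
  obtain ⟨⟨rfl, rfl⟩, rfl⟩ := e'
  cases hc with
  | virt =>
    have h4 := (Cross.virt e d z y).cons (u := u) (v := (!d, y) :: v) (p := u.length) (.nil _) rfl
      rfl rfl
    have h5 := Lab.max_cons (u := u ++ [(e, z)]) (p := u.length + 1) (v := v) d y h4 (by simp)
      rfl (by simp)
    refine ⟨0, _, ?_, .refl _ _ _⟩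
    simpa [Crossing.swap] using h5
  | real _ hc =>
    have h4 := (Cross.real c.swap (IsReal.swap hc) e d z z₁ y₁ y).cons (u := u)
      (v := (!d, y₁) :: v) (p := u.length) (.nil _) rfl rfl rfl
    have h5 := Lab.max_cons (u := u ++ [(e, z)]) (p := u.length + 1) (v := v) d y₁ h4 (by simp)
      rfl (by simp)
    refine ⟨0, [arrowOf c.swap e d z₁ y], ?_, ?_⟩
    · convert h5 using 1
      · simp
      · simp
      · simp
      · rw [link_not]; abel
      · abel
    · intro n π r hπ hj hN hn hr
      have hl : [y, y₁, z₁].Nodup := by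
        rw [← Multiset.coe_nodup]
        convert hN using 1
        simp only [← Multiset.cons_coe, ← Multiset.singleton_add, Multiset.coe_nil]
        abel
      have hj1 := hj _ (by simp : link (!d) y y₁ ∈ _)
      simp only [List.nodup_cons, List.mem_cons, List.not_mem_nil, not_or, or_false] at hl
      obtain ⟨⟨l1, l2⟩, l3, -⟩ := hl
      have key := fun o s => slide_move (e := s) (o := o) (d := d) hπ (hn y₁ (by simp))
        (hn y (by simp)) (hn z₁ (by simp)) (by cases d <;> exact hj1) (Ne.symm l1) (Ne.symm l3)
        (Ne.symm l2) (hr y₁ (by simp)) (hr y (by simp))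
      cases c
      · have := key true (!d != e)
        cases d <;> cases e <;> simpa [wd, arrowOf, Crossing.swap] using this
      · have := key false ((!d) == e)
        cases d <;> cases e <;> simpa [wd, arrowOf, Crossing.swap] using this
      · exact absurd rfl hc

/-! ### Reidemeister moves -/

theorem nodup_of_eq_coe {N : Multiset ℕ} (hN : N.Nodup) {l : List ℕ} (h : N = (l : Multiset ℕ)) :
    l.Nodup := by
  rwa [h, Multiset.coe_nodup] at hN

/-- The arrow of a kink connects two pieces of the same strand, with one piece without arrows
between them. -/
theorem replace_kink {s o e : Bool} {x x₁ y y₁ : ℕ} :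
    Replace [if o then ⟨x₁, y₁, e⟩ else ⟨y₁, x₁, e⟩] []
      ({link s x x₁} + {link s x₁ y} + {link s y y₁}) ({x₁} + {y} + {y₁}) := by
  intro n π r hπ hj hN hn hr
  have hl := nodup_of_eq_coe hN (l := [x₁, y, y₁]) (by
    simp only [← Multiset.cons_coe, ← Multiset.singleton_add, Multiset.coe_nil]
    abel)
  simp only [List.nodup_cons, List.mem_cons, List.not_mem_nil, not_or, or_false] at hl
  obtain ⟨⟨l1, l2⟩, l3, -⟩ := hl
  have j1 := hj _ (by simp : link s x₁ y ∈ _)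
  have j2 := hj _ (by simp : link s y y₁ ∈ _)
  have n1 := hn x₁ (by simp)
  have n2 := hn y (by simp)
  have n3 := hn y₁ (by simp)
  have r1 := hr x₁ (by simp)
  have r2 := hr y (by simp)
  have r3 := hr y₁ (by simp)
  simp only [wd_cons, wd_nil, mul_one, one_mul]
  cases s
  · have := remove_kink (e := e) (o := !o)
      hπ n2 n1 j2 j1 (Ne.symm l3) (Ne.symm l1) (Ne.symm l2) r3 r2
    cases o <;> exact this
  · exact remove_kink (e := e) (o := o) hπ n2 n3 j1 j2 l1 l3 l2 r1 r2

theorem arrowOf_eq {c : Crossing} {d e : Bool} (hc : c.IsReal) :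
    ∃ o s : Bool, ∀ x y : ℕ, arrowOf c d e x y = if o then ⟨x, y, s⟩ else ⟨y, x, s⟩ := by
  cases c
  · exact ⟨true, _, fun x y => rfl⟩
  · exact ⟨false, _, fun x y => rfl⟩
  · exact absurd rfl hc

/-- A strand without crossings takes three labels by three subdivisions. -/
theorem lab_three_subs {X : Type} (u v : List (Bool × X)) (s : Bool) (x x₁ y y₁ : X) :
    Lab true 3 [] (u ++ (s, x) :: v) (u ++ (s, y₁) :: v) []
      ({link s x x₁} + {link s x₁ y} + {link s y y₁}) ({x₁} + {y} + {y₁}) := by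
  have := Lab.sub (f := true) u v s x x₁ (.sub u v s x₁ y (.sub u v s y y₁ (.nil _)))
  convert this using 1
  · simp only [add_zero]; abel
  · simp only [add_zero]; abel

theorem carries_one_right (p : ℕ) (d : Bool) (c : Crossing) :
    Carries [mx (p + 1) d, cr p c, mn (p + 1)] [] := by
  intro B B' A G N h
  obtain ⟨u, s, x, v, rfl, rfl⟩ := h.exists_left_succ
  obtain ⟨y, N, h1, rfl⟩ := h.max_inv (u := u ++ [(s, x)]) (C := v) (by simp) (by simp)
  obtain ⟨s', x', x₁, d', y', y₁, v', A₁, A₂, G₁, G₂, N₁, N₂, e, hc, h2, rfl, rfl, rfl⟩ :=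
    h1.cross_inv (List.append_assoc ..) rfl
  simp only [List.cons_append, List.nil_append, List.cons.injEq, Prod.mk.injEq] at e
  obtain ⟨⟨rfl, rfl⟩, ⟨rfl, rfl⟩, rfl⟩ := e
  obtain ⟨d', x', y', v', G, e, h3, rfl⟩ := h2.min_inv (u := u ++ [(d, y₁)])
    (C := (s, x₁) :: (!d, y) :: v) (by simp) (by simp)
  obtain ⟨rfl, rfl, rfl, rfl⟩ := h3.nil_inv
  simp only [List.cons.injEq, Prod.mk.injEq] at e
  obtain ⟨⟨rfl, rfl⟩, ⟨hd, rfl⟩, rfl⟩ := e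
  obtain rfl := Bool.not_inj hd
  cases hc with
  | virt =>
    refine ⟨1, [], ?_, .refl _ _ _⟩
    have := Lab.sub (f := true) u v d x y (.nil _)
    simpa using this
  | real _ hc =>
    have hG : {link d x x₁} + {link d y y₁} + ({link d x₁ y} + 0) =
        ({link d x x₁} + {link d x₁ y} + {link d y y₁} : Multiset (ℕ × ℕ)) := by abel
    have hN : ({y} + ({x₁} + {y₁} + 0) : Multiset ℕ) = {x₁} + {y} + {y₁} := by abel
    rw [hG, hN]
    refine ⟨3, [], by simpa using lab_three_subs u v d x x₁ y y₁, ?_⟩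
    obtain ⟨o, s, ho⟩ := arrowOf_eq (d := d) (e := d) hc
    rw [ho]
    exact replace_kink

theorem carries_one_left (p : ℕ) (d : Bool) (c : Crossing) :
    Carries [mx p d, cr (p + 1) c, mn p] [] := by
  intro B B' A G N h
  obtain ⟨u, v, rfl, rfl⟩ := h.exists_left
  obtain ⟨y, N, h1, rfl⟩ := h.max_inv rfl rfl
  obtain ⟨s', y', y₁, s, x, x₁, v', A₁, A₂, G₁, G₂, N₁, N₂, e, hc, h2, rfl, rfl, rfl⟩ :=
    h1.cross_inv (u := u ++ [(d, y)]) (C := (!d, y) :: v) (by simp) (by simp)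
  simp only [List.cons.injEq, Prod.mk.injEq] at e
  obtain ⟨⟨rfl, rfl⟩, rfl⟩ := e
  obtain ⟨d', x', y', v', G, e, h3, rfl⟩ := h2.min_inv (List.append_assoc ..) rfl
  obtain ⟨rfl, rfl, rfl, rfl⟩ := h3.nil_inv
  simp only [List.cons_append, List.nil_append, List.cons.injEq, Prod.mk.injEq] at e
  obtain ⟨⟨rfl, rfl⟩, ⟨rfl, rfl⟩, rfl⟩ := e
  cases hc with
  | virt =>
    refine ⟨1, [], ?_, .refl _ _ _⟩
    have := Lab.sub (f := true) u v' (!d) x y (.nil _)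
    rw [link_not] at this
    simpa using this
  | real _ hc =>
    have hG : {link (!d) y y₁} + {link (!d) x x₁} + ({link d y x₁} + 0) =
        ({link (!d) x x₁} + {link (!d) x₁ y} + {link (!d) y y₁} : Multiset (ℕ × ℕ)) := by
      rw [link_not d x₁ y]
      abel
    have hN : ({y} + ({y₁} + {x₁} + 0) : Multiset ℕ) = {x₁} + {y} + {y₁} := by abel
    rw [hG, hN]
    refine ⟨3, [], by simpa using lab_three_subs u v' (!d) x x₁ y y₁, ?_⟩
    obtain ⟨o, s, ho⟩ := arrowOf_eq (d := !d) (e := !d) hc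
    have : arrowOf c (!d) (!d) y₁ x₁ = if (!o) then ⟨x₁, y₁, s⟩ else ⟨y₁, x₁, s⟩ := by
      rw [ho]; cases o <;> rfl
    rw [this]
    exact replace_kink

theorem carries_two (p : ℕ) (c : Crossing) : Carries [cr p c, cr p c.swap] [] := by
  intro B B' A G N h
  obtain ⟨u, v, rfl, rfl⟩ := h.exists_left
  obtain ⟨d, x, x₁, e, y, y₁, v', A₁, A₂, G₁, G₂, N₁, N₂, rfl, hc, h2, rfl, rfl, rfl⟩ :=
    h.cross_inv rfl rfl
  obtain ⟨e', y', y₂, d', x', x₂, v', A₃, A₄, G₃, G₄, N₃, N₄, e₁, hc', h3, rfl, rfl, rfl⟩ :=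
    h2.cross_inv rfl rfl
  obtain ⟨rfl, rfl, rfl, rfl⟩ := h3.nil_inv
  simp only [List.cons.injEq, Prod.mk.injEq] at e₁
  obtain ⟨⟨rfl, rfl⟩, ⟨rfl, rfl⟩, rfl⟩ := e₁
  cases hc with
  | virt =>
    cases hc' with
    | virt => exact ⟨0, [], .nil _, .refl _ _ _⟩
    | real _ hc' => exact absurd rfl hc'
  | real _ hc =>
  generalize hs : c.swap = c' at hc'
  cases hc' with
  | virt => exact absurd hs (IsReal.swap hc)
  | real _ hc' =>
  subst hs
  refine ⟨4, [], ?_, ?_⟩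
  · have l1 := Lab.sub (f := true) (u ++ [(d, x₂)]) v' e y y₁
      (.sub (u ++ [(d, x₂)]) v' e y₁ y₂ (.nil _))
    rw [List.append_assoc] at l1
    have := Lab.sub (f := true) u ((e, y) :: v') d x x₁ (.sub u ((e, y) :: v') d x₁ x₂ l1)
    convert this using 1
    · simp
    · simp only [add_zero]; abel
    · simp only [add_zero]; abel
  · intro n π r hπ hj hN hn hr
    have hl := nodup_of_eq_coe hN (l := [x₁, x₂, y₁, y₂]) (by
      simp only [← Multiset.cons_coe, ← Multiset.singleton_add, Multiset.coe_nil]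
      abel)
    have hl' := nodup_of_eq_coe hN (l := [y₁, y₂, x₁, x₂]) (by
      simp only [← Multiset.cons_coe, ← Multiset.singleton_add, Multiset.coe_nil]
      abel)
    have j1 := hj _ (by simp : link d x₁ x₂ ∈ _)
    have j2 := hj _ (by simp : link e y₁ y₂ ∈ _)
    have n1 := hn x₁ (by simp)
    have n2 := hn x₂ (by simp)
    have n3 := hn y₁ (by simp)
    have n4 := hn y₂ (by simp)
    have r1 := hr x₁ (by simp)
    have r2 := hr x₂ (by simp)
    have r3 := hr y₁ (by simp)
    have r4 := hr y₂ (by simp)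
    cases c
    · have := second_move (e := d != e) hπ n1 n2 n3 n4 j1 j2 hl r1 r2 r3 r4
      cases d <;> cases e <;> simpa [wd, arrowOf, Crossing.swap] using this
    · have := second_move (e := d == e) hπ n3 n4 n1 n2 j2 j1 hl' r3 r4 r1 r2
      cases d <;> cases e <;> simpa [wd, arrowOf, Crossing.swap] using this
    · exact absurd rfl hc

/-! ### Moves of three strands -/

/-- A labelling of three strands that cross pairwise. -/
theorem lab_triangle_inv {p : ℕ} {c₁₂ c₁₃ c₂₃ : Crossing} {B B' : List (Bool × ℕ)}
    {A : List (Arrow ℕ)} {G : Multiset (ℕ × ℕ)} {N : Multiset ℕ}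
    (h : Lab true 0 [cr p c₁₂, cr (p + 1) c₁₃, cr p c₂₃] B B' A G N) :
    ∃ u v d₁ d₂ d₃ x₁ x₂ x₃ y₁ y₂ y₃ z₁ z₂ z₃ A₁ A₂ A₃ G₁ G₂ G₃ N₁ N₂ N₃, u.length = p ∧
      B = u ++ (d₁, x₁) :: (d₂, x₂) :: (d₃, x₃) :: v ∧
      B' = u ++ (d₃, z₃) :: (d₂, z₂) :: (d₁, z₁) :: v ∧
      Cross c₁₂ d₁ x₁ y₁ d₂ x₂ y₂ A₁ G₁ N₁ ∧ Cross c₁₃ d₁ y₁ z₁ d₃ x₃ y₃ A₂ G₂ N₂ ∧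
      Cross c₂₃ d₂ y₂ z₂ d₃ y₃ z₃ A₃ G₃ N₃ ∧ A = A₁ ++ A₂ ++ A₃ ∧ G = G₁ + G₂ + G₃ ∧
      N = N₁ + N₂ + N₃ := by
  obtain ⟨u, v, rfl, rfl⟩ := h.exists_left
  obtain ⟨d₁, x₁, y₁, d₂, x₂, y₂, v, A₁, A₄, G₁, G₄, N₁, N₄, rfl, hc, h1, rfl, rfl, rfl⟩ :=
    h.cross_inv rfl rfl
  obtain ⟨d₁', y₁', z₁, d₃, x₃, y₃, v, A₂, A₅, G₂, G₅, N₂, N₅, e, hc', h2, rfl, rfl, rfl⟩ :=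
    h1.cross_inv (u := u ++ [(d₂, y₂)]) (C := (d₁, y₁) :: v) (by simp) (by simp)
  simp only [List.cons.injEq, Prod.mk.injEq] at e
  obtain ⟨⟨rfl, rfl⟩, rfl⟩ := e
  obtain ⟨d₂', y₂', z₂, d₃', y₃', z₃, v, A₃, A₆, G₃, G₆, N₃, N₆, e, hc'', h3, rfl, rfl, rfl⟩ :=
    h2.cross_inv (List.append_assoc ..) rfl
  obtain ⟨rfl, rfl, rfl, rfl⟩ := h3.nil_inv
  simp only [List.cons_append, List.nil_append, List.cons.injEq, Prod.mk.injEq] at e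
  obtain ⟨⟨rfl, rfl⟩, ⟨rfl, rfl⟩, rfl⟩ := e
  exact ⟨u, _, _, _, _, _, _, _, _, _, _, _, _, _, _, _, _, _, _, _, _, _, _, rfl, rfl, rfl, hc,
    hc', hc'', by simp, by simp [add_assoc], by simp [add_assoc]⟩

theorem lab_triangle {u v : List (Bool × ℕ)} {c₁₂ c₁₃ c₂₃ : Crossing} {d₁ d₂ d₃ : Bool}
    {x₁ x₂ x₃ y₁ y₂ y₃ z₁ z₂ z₃ : ℕ} {A₁ A₂ A₃ : List (Arrow ℕ)} {G₁ G₂ G₃ G : Multiset (ℕ × ℕ)}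
    {N₁ N₂ N₃ N : Multiset ℕ} (h₁ : Cross c₂₃ d₂ x₂ y₂ d₃ x₃ y₃ A₁ G₁ N₁)
    (h₂ : Cross c₁₃ d₁ x₁ y₁ d₃ y₃ z₃ A₂ G₂ N₂) (h₃ : Cross c₁₂ d₁ y₁ z₁ d₂ y₂ z₂ A₃ G₃ N₃)
    (hG : G = G₁ + G₂ + G₃) (hN : N = N₁ + N₂ + N₃) :
    Lab true 0 [cr (u.length + 1) c₂₃, cr u.length c₁₃, cr (u.length + 1) c₁₂]
      (u ++ (d₁, x₁) :: (d₂, x₂) :: (d₃, x₃) :: v) (u ++ (d₃, z₃) :: (d₂, z₂) :: (d₁, z₁) :: v)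
      (A₁ ++ A₂ ++ A₃) G N := by
  have l3 := h₃.cons (u := u ++ [(d₃, z₃)]) (v := v) (p := u.length + 1) (.nil _) (by simp) rfl rfl
  have l2 := h₂.cons (u := u) (v := (d₂, y₂) :: v) (p := u.length) l3 rfl rfl (by simp)
  have l1 := h₁.cons (u := u ++ [(d₁, x₁)]) (v := v) (p := u.length + 1) l2 (by simp) rfl (by simp)
  convert l1 using 1
  · simp
  · simp
  · simp
  · rw [hG]; abel
  · rw [hN]; abel

theorem commute_three {M : Type} [Monoid M] {a b c : M} (hab : Commute a b) (hac : Commute a c)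
    (hbc : Commute b c) : b * a * c = a * b * c ∧ a * c * b = a * b * c ∧ b * c * a = a * b * c ∧
      c * a * b = a * b * c ∧ c * b * a = a * b * c := by
  refine ⟨by rw [hab.eq], by rw [mul_assoc, mul_assoc, hbc.eq], ?_, ?_, ?_⟩
  · rw [hab.mul_right hac |>.symm.eq |>.trans (mul_assoc ..).symm]
  · rw [← hac.eq, mul_assoc, mul_assoc, hbc.eq]
  · rw [← hbc.eq, hab.mul_right hac |>.symm.eq |>.trans (mul_assoc ..).symm]

/-- In a Reidemeister triangle of real crossings, the strands are ordered by height, and each of the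
six orders is an instance of `third_move`. The arrows on each side have no strands in common, so
they may be listed in any order. -/
theorem replace_triangle {c₁₂ c₁₃ c₂₃ : Crossing} (h₁₂ : c₁₂.IsReal) (h₁₃ : c₁₃.IsReal)
    (h₂₃ : c₂₃.IsReal) (h : ¬ (c₁₂ = .leftOver ∧ c₂₃ = .leftOver ∧ c₁₃ = .rightOver))
    (h' : ¬ (c₁₂ = .rightOver ∧ c₂₃ = .rightOver ∧ c₁₃ = .leftOver)) {d₁ d₂ d₃ : Bool}
    {y₁ y₂ y₃ z₁ z₂ z₃ : ℕ} {G : Multiset (ℕ × ℕ)} {N : Multiset ℕ} (g₁ : link d₁ y₁ z₁ ∈ G)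
    (g₂ : link d₂ y₂ z₂ ∈ G) (g₃ : link d₃ y₃ z₃ ∈ G)
    (hM : N = {y₁} + {y₂} + {y₃} + {z₁} + {z₂} + {z₃}) :
    Replace [arrowOf c₁₂ d₁ d₂ y₁ y₂, arrowOf c₁₃ d₁ d₃ z₁ y₃, arrowOf c₂₃ d₂ d₃ z₂ z₃]
      [arrowOf c₂₃ d₂ d₃ y₂ y₃, arrowOf c₁₃ d₁ d₃ y₁ z₃, arrowOf c₁₂ d₁ d₂ z₁ z₂] G N := by
  intro n π r hπ hj hN hn hr
  subst hM
  have nd : ∀ l : List ℕ, (l : Multiset ℕ) = {y₁} + {y₂} + {y₃} + {z₁} + {z₂} + {z₃} → l.Nodup :=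
    fun l hl => nodup_of_eq_coe hN hl.symm
  have j₁ := hj _ g₁
  have j₂ := hj _ g₂
  have j₃ := hj _ g₃
  have j₁' : Joins π (link (!d₁) z₁ y₁) := by rwa [link_not]
  have j₂' : Joins π (link (!d₂) z₂ y₂) := by rwa [link_not]
  have j₃' : Joins π (link (!d₃) z₃ y₃) := by rwa [link_not]
  have n₁ := hn y₁ (by simp)
  have n₂ := hn y₂ (by simp)
  have n₃ := hn y₃ (by simp)
  have m₁ := hn z₁ (by simp)
  have m₂ := hn z₂ (by simp)
  have m₃ := hn z₃ (by simp)
  have r₁ := hr y₁ (by simp)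
  have r₂ := hr y₂ (by simp)
  have r₃ := hr y₃ (by simp)
  have s₁ := hr z₁ (by simp)
  have s₂ := hr z₂ (by simp)
  have s₃ := hr z₃ (by simp)
  have cA : ∀ (c c' : Crossing) (x y z w : ℕ) (d e f g : Bool), x ≤ n → y ≤ n → z ≤ n → w ≤ n →
      [x, y, z, w].Nodup → Commute ((arrowOf c d e x y).ev n) ((arrowOf c' f g z w).ev n) := by
    intro c c' x y z w d e f g hx hy hz hw hd
    simp only [List.nodup_cons, List.mem_cons, List.not_mem_nil, not_or, or_false] at hd
    obtain ⟨⟨d1, d2, d3⟩, ⟨d4, d5⟩, d6, -⟩ := hd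
    cases c <;> cases c' <;> first
      | exact comm_disjoint hx hy hz hw d1 d6 d2 d3 d4 d5
      | exact comm_disjoint hy hx hz hw (Ne.symm d1) d6 d4 d5 d2 d3
      | exact comm_disjoint hx hy hw hz d1 (Ne.symm d6) d3 d2 d5 d4
      | exact comm_disjoint hy hx hw hz (Ne.symm d1) (Ne.symm d6) d5 d4 d3 d2
  have e₁ := cA c₁₂ c₁₃ y₁ y₂ z₁ y₃ d₁ d₂ d₁ d₃ n₁ n₂ m₁ n₃
    (nd ([y₁, y₂, z₁, y₃] ++ [z₂, z₃]) (by
      simp only [← Multiset.cons_coe, ← Multiset.singleton_add, Multiset.coe_nil, List.cons_append,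
        List.nil_append]; abel)).of_append_left
  have e₂ := cA c₁₂ c₂₃ y₁ y₂ z₂ z₃ d₁ d₂ d₂ d₃ n₁ n₂ m₂ m₃
    (nd ([y₁, y₂, z₂, z₃] ++ [z₁, y₃]) (by
      simp only [← Multiset.cons_coe, ← Multiset.singleton_add, Multiset.coe_nil, List.cons_append,
        List.nil_append]; abel)).of_append_left
  have e₃ := cA c₁₃ c₂₃ z₁ y₃ z₂ z₃ d₁ d₃ d₂ d₃ m₁ n₃ m₂ m₃
    (nd ([z₁, y₃, z₂, z₃] ++ [y₁, y₂]) (by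
      simp only [← Multiset.cons_coe, ← Multiset.singleton_add, Multiset.coe_nil, List.cons_append,
        List.nil_append]; abel)).of_append_left
  have f₁ := cA c₂₃ c₁₃ y₂ y₃ y₁ z₃ d₂ d₃ d₁ d₃ n₂ n₃ n₁ m₃
    (nd ([y₂, y₃, y₁, z₃] ++ [z₁, z₂]) (by
      simp only [← Multiset.cons_coe, ← Multiset.singleton_add, Multiset.coe_nil, List.cons_append,
        List.nil_append]; abel)).of_append_left
  have f₂ := cA c₂₃ c₁₂ y₂ y₃ z₁ z₂ d₂ d₃ d₁ d₂ n₂ n₃ m₁ m₂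
    (nd ([y₂, y₃, z₁, z₂] ++ [y₁, z₃]) (by
      simp only [← Multiset.cons_coe, ← Multiset.singleton_add, Multiset.coe_nil, List.cons_append,
        List.nil_append]; abel)).of_append_left
  have f₃ := cA c₁₃ c₁₂ y₁ z₃ z₁ z₂ d₁ d₃ d₁ d₂ n₁ m₃ m₁ m₂
    (nd ([y₁, z₃, z₁, z₂] ++ [y₂, y₃]) (by
      simp only [← Multiset.cons_coe, ← Multiset.singleton_add, Multiset.coe_nil, List.cons_append,
        List.nil_append]; abel)).of_append_left
  obtain ⟨a₁, a₂, a₃, a₄, a₅⟩ := commute_three e₁ e₂ e₃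
  obtain ⟨b₁, b₂, b₃, b₄, b₅⟩ := commute_three f₁ f₂ f₃
  simp only [wd_cons, wd_nil, mul_one, ← mul_assoc]
  -- the comments list the three strands from the highest to the lowest
  cases c₁₂ <;> cases c₁₃ <;> cases c₂₃ <;> first
    | exact absurd rfl h₁₂
    | exact absurd rfl h₁₃
    | exact absurd rfl h₂₃
    | exact absurd ⟨rfl, rfl, rfl⟩ h
    | exact absurd ⟨rfl, rfl, rfl⟩ h'
    | skip
  · -- `1`, `2`, `3`
    exact third_move hπ n₁ m₁ n₂ m₂ n₃ m₃ j₁ j₂ j₃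
      (by cases d₁ <;> cases d₂ <;> cases d₃ <;> decide)
      (nd [y₁, z₁, y₂, z₂, y₃, z₃] (by
      simp only [← Multiset.cons_coe, ← Multiset.singleton_add, Multiset.coe_nil]; abel))
      r₁ s₁ r₂ s₂ r₃ s₃
  · -- `1`, `3`, `2`
    rw [← a₁, ← b₂]
    exact third_move hπ m₁ n₁ n₃ m₃ n₂ m₂ j₁' j₃ j₂
      (by cases d₁ <;> cases d₂ <;> cases d₃ <;> decide)
      (nd [z₁, y₁, y₃, z₃, y₂, z₂] (by
      simp only [← Multiset.cons_coe, ← Multiset.singleton_add, Multiset.coe_nil]; abel))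
      s₁ r₁ r₃ s₃ r₂ s₂
  · -- `3`, `1`, `2`
    rw [← a₃, ← b₄]
    exact third_move hπ n₃ m₃ m₁ n₁ m₂ n₂ j₃ j₁' j₂'
      (by cases d₁ <;> cases d₂ <;> cases d₃ <;> decide)
      (nd [y₃, z₃, z₁, y₁, z₂, y₂] (by
      simp only [← Multiset.cons_coe, ← Multiset.singleton_add, Multiset.coe_nil]; abel))
      r₃ s₃ s₁ r₁ s₂ r₂
  · -- `2`, `1`, `3`
    rw [← a₂, ← b₁]
    exact third_move hπ n₂ m₂ n₁ m₁ m₃ n₃ j₂ j₁ j₃'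
      (by cases d₁ <;> cases d₂ <;> cases d₃ <;> decide)
      (nd [y₂, z₂, y₁, z₁, z₃, y₃] (by
      simp only [← Multiset.cons_coe, ← Multiset.singleton_add, Multiset.coe_nil]; abel))
      r₂ s₂ r₁ s₁ s₃ r₃
  · -- `2`, `3`, `1`
    rw [← a₄, ← b₃]
    exact third_move hπ m₂ n₂ m₃ n₃ n₁ m₁ j₂' j₃' j₁
      (by cases d₁ <;> cases d₂ <;> cases d₃ <;> decide)
      (nd [z₂, y₂, z₃, y₃, y₁, z₁] (by
      simp only [← Multiset.cons_coe, ← Multiset.singleton_add, Multiset.coe_nil]; abel))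
      s₂ r₂ s₃ r₃ r₁ s₁
  · -- `3`, `2`, `1`
    rw [← a₅, ← b₅]
    exact third_move hπ m₃ n₃ m₂ n₂ m₁ n₁ j₃' j₂' j₁'
      (by cases d₁ <;> cases d₂ <;> cases d₃ <;> decide)
      (nd [z₃, y₃, z₂, y₂, z₁, y₁] (by
      simp only [← Multiset.cons_coe, ← Multiset.singleton_add, Multiset.coe_nil]; abel))
      s₃ r₃ s₂ r₂ s₁ r₁

theorem carries_three (p : ℕ) {c₁₂ c₁₃ c₂₃ : Crossing} (h : ReidemeisterTriangle c₁₂ c₁₃ c₂₃) :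
    Carries [cr p c₁₂, cr (p + 1) c₁₃, cr p c₂₃] [cr (p + 1) c₂₃, cr p c₁₃, cr (p + 1) c₁₂] := by
  intro B B' A G N hL
  obtain ⟨u, v, d₁, d₂, d₃, x₁, x₂, x₃, y₁, y₂, y₃, z₁, z₂, z₃, A₁, A₂, A₃, G₁, G₂, G₃, N₁, N₂, N₃,
    rfl, rfl, rfl, k₁₂, k₁₃, k₂₃, rfl, rfl, rfl⟩ := lab_triangle_inv hL
  clear hL
  cases h with
  | real _ _ _ h₁₂ h₁₃ h₂₃ h h' =>
    cases k₁₂ with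
    | virt => exact absurd rfl h₁₂
    | real =>
    cases k₁₃ with
    | virt => exact absurd rfl h₁₃
    | real =>
    cases k₂₃ with
    | virt => exact absurd rfl h₂₃
    | real =>
    exact ⟨0, _, lab_triangle (.real _ h₂₃ _ _ _ _ _ _) (.real _ h₁₃ _ _ _ _ _ _)
      (.real _ h₁₂ _ _ _ _ _ _) (by abel) (by abel),
      replace_triangle h₁₂ h₁₃ h₂₃ h h' (by simp) (by simp) (by simp) (by abel)⟩
  | virt =>
    cases k₁₂ with
    | real _ h => exact absurd rfl h
    | virt =>
    cases k₁₃ with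
    | real _ h => exact absurd rfl h
    | virt =>
    cases k₂₃ with
    | real _ h => exact absurd rfl h
    | virt =>
    exact ⟨0, _, lab_triangle (.virt _ _ _ _) (.virt _ _ _ _) (.virt _ _ _ _) rfl rfl, .refl _ _ _⟩
  | mixed₁ _ hc =>
    cases k₁₂ with
    | real _ h => exact absurd rfl h
    | virt =>
    cases k₁₃ with
    | real _ h => exact absurd rfl h
    | virt =>
    cases k₂₃ with
    | virt => exact absurd rfl hc
    | real =>
    exact ⟨0, _, lab_triangle (.real _ hc _ _ _ _ _ _) (.virt _ _ _ _) (.virt _ _ _ _) (by abel)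
      (by abel), .refl _ _ _⟩
  | mixed₂ _ hc =>
    cases k₁₂ with
    | real _ h => exact absurd rfl h
    | virt =>
    cases k₁₃ with
    | virt => exact absurd rfl hc
    | real =>
    cases k₂₃ with
    | real _ h => exact absurd rfl h
    | virt =>
    exact ⟨0, _, lab_triangle (.virt _ _ _ _) (.real _ hc _ _ _ _ _ _) (.virt _ _ _ _) (by abel)
      (by abel), .refl _ _ _⟩
  | mixed₃ _ hc =>
    cases k₁₂ with
    | virt => exact absurd rfl hc
    | real =>
    cases k₁₃ with
    | real _ h => exact absurd rfl h
    | virt =>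
    cases k₂₃ with
    | real _ h => exact absurd rfl h
    | virt =>
    exact ⟨0, _, lab_triangle (.virt _ _ _ _) (.virt _ _ _ _) (.real _ hc _ _ _ _ _ _) (by abel)
      (by abel), .refl _ _ _⟩

theorem replace_tails {o o' u v : ℕ} {e f d : Bool} {G : Multiset (ℕ × ℕ)} {N : Multiset ℕ}
    (hG : link d o o' ∈ G) (hM : N = {o} + {o'} + {u} + {v}) :
    Replace [⟨o, u, e⟩, ⟨o', v, f⟩] [⟨o, v, f⟩, ⟨o', u, e⟩] G N := by
  intro n π r hπ hj hN hn hr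
  subst hM
  have hl := nodup_of_eq_coe hN (l := [o, o', u, v]) (by
    simp only [← Multiset.cons_coe, ← Multiset.singleton_add, Multiset.coe_nil]
    abel)
  simp only [wd_cons, wd_nil, mul_one]
  exact tails_move hπ (hn o (by simp)) (hn o' (by simp)) (hn u (by simp)) (hn v (by simp))
    (hj _ hG) hl (hr o (by simp)) (hr o' (by simp))

theorem carries_w (p : ℕ) {c₁₂ c₁₃ c₂₃ : Crossing} (h : WTriangle c₁₂ c₁₃ c₂₃) :
    Carries [cr p c₁₂, cr (p + 1) c₁₃, cr p c₂₃] [cr (p + 1) c₂₃, cr p c₁₃, cr (p + 1) c₁₂] := by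
  intro B B' A G N hL
  obtain ⟨u, v, d₁, d₂, d₃, x₁, x₂, x₃, y₁, y₂, y₃, z₁, z₂, z₃, A₁, A₂, A₃, G₁, G₂, G₃, N₁, N₂, N₃,
    rfl, rfl, rfl, k₁₂, k₁₃, k₂₃, rfl, rfl, rfl⟩ := lab_triangle_inv hL
  clear hL
  cases h with
  | over₁ =>
    cases k₂₃ with
    | real _ h => exact absurd rfl h
    | virt =>
    cases k₁₂ with | real _ h₁₂ =>
    cases k₁₃ with | real _ h₁₃ =>
    exact ⟨0, _, lab_triangle (.virt _ _ _ _) (.real _ h₁₃ _ _ _ _ _ _) (.real _ h₁₂ _ _ _ _ _ _)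
      (by abel) (by abel), replace_tails (d := d₁) (by simp) (by abel)⟩
  | over₂ =>
    cases k₁₃ with
    | real _ h => exact absurd rfl h
    | virt =>
    cases k₁₂ with | real _ h₁₂ =>
    cases k₂₃ with | real _ h₂₃ =>
    exact ⟨0, _, lab_triangle (.real _ h₂₃ _ _ _ _ _ _) (.virt _ _ _ _) (.real _ h₁₂ _ _ _ _ _ _)
      (by abel) (by abel), replace_tails (d := d₂) (by simp) (by abel)⟩
  | over₃ =>
    cases k₁₂ with
    | real _ h => exact absurd rfl h
    | virt =>
    cases k₁₃ with | real _ h₁₃ =>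
    cases k₂₃ with | real _ h₂₃ =>
    exact ⟨0, _, lab_triangle (.real _ h₂₃ _ _ _ _ _ _) (.real _ h₁₃ _ _ _ _ _ _) (.virt _ _ _ _)
      (by abel) (by abel), replace_tails (d := d₃) (by simp) (by abel)⟩

/-! ### Invariance of the welded braid of a diagram -/

theorem carries_of_move {l r : List Layer}
    (h : PlanarIsotopy l r ∨ VirtualReidemeister l r ∨ WMove l r) : l ≠ [] ∧ Carries l r := by
  rcases h with h | h | h
  · cases h with
    | exchange p k P Q => exact ⟨by simp, carries_exchange p k P Q⟩
    | zigzag_right p d => exact ⟨by simp, carries_zigzag_right p d⟩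
    | zigzag_left p d => exact ⟨by simp, carries_zigzag_left p d⟩
    | minimum_slide p c => exact ⟨by simp, carries_minimum_slide p c⟩
    | maximum_slide p d c => exact ⟨by simp, carries_maximum_slide p d c⟩
  · cases h with
    | one_right p d c => exact ⟨by simp, carries_one_right p d c⟩
    | one_left p d c => exact ⟨by simp, carries_one_left p d c⟩
    | two p c => exact ⟨by simp, carries_two p c⟩
    | three p c₁₂ c₁₃ c₂₃ h => exact ⟨by simp, carries_three p h⟩
  · cases h with
    | w p c₁₂ c₁₃ c₂₃ h => exact ⟨by simp, carries_w p h⟩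

theorem Lab.eq_zero_of_nil {f : Bool} {X : Type} {k : ℕ} {A : List (Arrow X)} {G : Multiset (X × X)}
    {N : Multiset X} (h : Lab f k [] [] [] A G N) : N = 0 := by
  generalize hw : ([] : List Layer) = w at h
  generalize hB : ([] : List (Bool × X)) = B at h
  cases h with
  | nil => rfl
  | cons => simp at hw
  | sub => simp at hB

theorem Presents.ne_nil {w : List Layer} {n : ℕ} {b : WeldedBraid n} (h : Presents w n b) :
    w ≠ [] := by
  rintro rfl
  obtain ⟨k, A, G, π, h, -⟩ := h
  have := h.lab.eq_zero_of_nil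
  simp [Multiset.range_succ] at this

theorem LinkMove.presents {K K' : LinkDiagram} (h : LinkMove K K') :
    ∃ n b b', Presents K.layers n b ∧ Presents K'.layers n b' ∧ BraidsRelated ⟨n, b⟩ ⟨n, b'⟩ := by
  obtain ⟨x, y, l, r, hlr, e, e'⟩ := h
  obtain ⟨h0, hc⟩ := carries_of_move hlr
  rw [e, e']
  exact hc.presents (e ▸ K.closed) (by simp [h0])

theorem exists_presents (K : LinkDiagram) (h : K.layers ≠ []) : ∃ n b, Presents K.layers n b := by
  obtain ⟨n, A, G, π, hL, hπ, hj⟩ := exists_numbering K.closed h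
  obtain ⟨k, f⟩ := hL.of_fresh
  exact ⟨n, _, _, _, _, _, ⟨f, hπ, hj⟩, rfl⟩

/-- Equivalent diagrams have related welded braids. -/
theorem EquivalentAsWeldedLinks.braidsRelated {K K' : LinkDiagram}
    (h : EquivalentAsWeldedLinks K K') : (K.layers = [] ↔ K'.layers = []) ∧
      ∀ n b n' b', Presents K.layers n b → Presents K'.layers n' b' →
        BraidsRelated ⟨n, b⟩ ⟨n', b'⟩ := by
  induction h with
  | rel K K' h =>
    obtain ⟨n, b, b', h1, h2, h3⟩ := h.presents
    exact ⟨⟨fun e => absurd e h1.ne_nil, fun e => absurd e h2.ne_nil⟩, fun m c m' c' k1 k2 =>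
      (k1.unique h1).trans (h3.trans (h2.unique k2))⟩
  | refl K => exact ⟨Iff.rfl, fun _ _ _ _ h h' => h.unique h'⟩
  | symm K K' _ ih => exact ⟨ih.1.symm, fun _ _ _ _ h h' => (ih.2 _ _ _ _ h' h).symm⟩
  | trans K K' K'' _ _ ih ih' =>
    refine ⟨ih.1.trans ih'.1, fun _ _ _ _ h h' => ?_⟩
    obtain ⟨m, c, hc⟩ := exists_presents K' fun e => h.ne_nil (ih.1.mpr e)
    exact (ih.2 _ _ _ _ h hc).trans (ih'.2 _ _ _ _ hc h')

/-! ### The labelling of a closure -/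

/-- The strands `0, …, m - 1` of a braid diagram, with the labels `f 0, …, f (m - 1)`. -/
def downRow (m : ℕ) (f : ℕ → ℕ) : List (Bool × ℕ) := (List.range m).map fun k => (true, f k)

/-- The returning strands of a closure. -/
def upRow (m : ℕ) : List (Bool × ℕ) := (List.range m).reverse.map fun k => (false, k)

theorem downRow_succ (m : ℕ) (f : ℕ → ℕ) : downRow (m + 1) f = downRow m f ++ [(true, f m)] := by
  simp [downRow, List.range_succ]

theorem upRow_succ (m : ℕ) : upRow (m + 1) = (false, m) :: upRow m := by
  simp [upRow, List.range_succ]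

theorem downRow_length (m : ℕ) (f : ℕ → ℕ) : (downRow m f).length = m := by simp [downRow]

theorem lab_maxima (m : ℕ) : Lab false 0 ((List.range m).map (fun k => mx k true)) []
    (downRow m id ++ upRow m) [] 0 (Multiset.range m) := by
  induction m with
  | zero => exact .nil _
  | succ m ih =>
    have h := Lab.cons (f := false) (.maximum true m) (downRow m id) (upRow m) (k := 0) (w := [])
      (.nil _)
    rw [List.append_nil, downRow_length] at h
    have := ih.append h
    rw [List.range_succ, List.map_append, downRow_succ, upRow_succ, Multiset.range_succ]
    convert this using 1
    · simp
    · simp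
    · rfl
    · rfl
    · rw [add_zero, ← Multiset.singleton_add, add_comm]

/-- The minima of a closure join the strand that arrives at position `k` to the strand `k`. -/
theorem lab_minima (m : ℕ) (f : ℕ → ℕ) : ∃ G,
    Lab false 0 ((List.range m).reverse.map (fun k => mn k))
    (downRow m f ++ upRow m) [] [] G 0 ∧ ∀ p ∈ G, ∃ k < m, p = (f k, k) := by
  induction m with
  | zero => exact ⟨0, .nil _, by simp⟩
  | succ m ih =>
    obtain ⟨G, h, hG⟩ := ih
    have h' := Lab.cons (f := false) (.minimum true (f m) m) (downRow m f) (upRow m) (k := 0)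
      (by rwa [List.append_nil])
    rw [downRow_length] at h'
    refine ⟨{link true (f m) m} + G, ?_, ?_⟩
    · rw [List.range_succ, List.reverse_append, List.map_append, downRow_succ, upRow_succ]
      convert h' using 1
      · simp
      · simp
      · rfl
      · rfl
    · intro p hp
      rcases Multiset.mem_add.mp hp with hp | hp
      · exact ⟨m, Nat.lt_succ_self m, Multiset.mem_singleton.mp hp⟩
      · obtain ⟨k, hk, rfl⟩ := hG p hp
        exact ⟨k, by omega, rfl⟩

theorem downRow_split {m i : ℕ} (h : i + 1 < m) (f : ℕ → ℕ) : ∃ v,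
    downRow m f = downRow i f ++ [(true, f i), (true, f (i + 1))] ++ v ∧
      downRow m (fun k => f (swap i (i + 1) k)) =
        downRow i f ++ [(true, f (i + 1)), (true, f i)] ++ v := by
  obtain ⟨j, rfl⟩ := Nat.exists_eq_add_of_lt h
  induction j with
  | zero =>
    refine ⟨[], ?_, ?_⟩
    · rw [downRow_succ, downRow_succ]; simp
    · have : downRow i (fun k => f (swap i (i + 1) k)) = downRow i f := by
        refine List.map_congr_left fun k hk => ?_
        rw [List.mem_range] at hk
        simp only [Equiv.swap_apply_of_ne_of_ne (show k ≠ i by omega) (show k ≠ i + 1 by omega)]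
      rw [downRow_succ, downRow_succ, this]
      simp
  | succ j ih =>
    obtain ⟨v, h1, h2⟩ := ih (by omega)
    refine ⟨v ++ [(true, f (i + 1 + j + 1))], ?_, ?_⟩
    · rw [← add_assoc, downRow_succ, h1, ← List.append_assoc]
    · rw [← add_assoc, downRow_succ, h2,
        Equiv.swap_apply_of_ne_of_ne (by omega) (by omega), ← List.append_assoc]

theorem vb_mul_tu {n i : ℕ} (hi : i < n) {ρ : Perm ℕ} (hρ : ρ ∈ Pm n) :
    vb n ρ * tu n i = vb n (ρ * swap i (i + 1)) := by
  rw [← vb_swap hi, vb_mul hρ (swap_mem_Pm (by omega) (by omega))]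

/-- When the strand at position `k` has the label `ρ k`, a letter has an arrow between the labels of
its strands, which the virtual braid of `ρ` takes out of the word. -/
theorem lab_letter {n : ℕ} (a : Letter n) {ρ : Perm ℕ} (hρ : ρ ∈ Pm n) (U : List (Bool × ℕ)) :
    ∃ A, (∀ {w : List Layer} {B : List (Bool × ℕ)} {A' : List (Arrow ℕ)} {G : Multiset (ℕ × ℕ)}
      {N : Multiset ℕ},
      Lab false 0 w
        (downRow (n + 1) (ρ * toPerm n (BraidDiagram.toBraid [a]) : Perm ℕ) ++ U) B A' G N →
      Lab false 0 (a.toLayer :: w) (downRow (n + 1) ρ ++ U) B (A ++ A') G N) ∧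
      toPerm n (BraidDiagram.toBraid [a]) ∈ Pm n ∧
      vb n ρ * BraidDiagram.toBraid [a] =
        wd n A * vb n (ρ * toPerm n (BraidDiagram.toBraid [a])) := by
  have piece : ∀ (i : Fin n) (c : Crossing) (A : List (Arrow ℕ)),
      LabPiece false (.crossing c) [(true, ρ i), (true, ρ (i + 1))] [(true, ρ (i + 1)), (true, ρ i)]
        A 0 0 →
      ∀ {w : List Layer} {B : List (Bool × ℕ)} {A' : List (Arrow ℕ)} {G : Multiset (ℕ × ℕ)}
        {N : Multiset ℕ},
      Lab false 0 w (downRow (n + 1) (ρ * swap (i : ℕ) (i + 1) : Perm ℕ) ++ U) B A' G N →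
      Lab false 0 (cr i c :: w) (downRow (n + 1) ρ ++ U) B (A ++ A') G N := by
    intro i c A hA w B A' G N h
    obtain ⟨v, h1, h2⟩ := downRow_split (m := n + 1) (i := i) (by omega) ρ
    change downRow (n + 1) (ρ * swap (i : ℕ) (i + 1) : Perm ℕ) = _ at h2
    rw [h2] at h
    have := Lab.cons hA (downRow i ρ) (v ++ U) (k := 0) (w := w) (by simpa using h)
    rw [downRow_length, zero_add, zero_add] at this
    rw [h1]
    simpa using this
  have real : ∀ (c : Crossing), c.IsReal → ∀ x y : ℕ, LabPiece false (.crossing c)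
      [(true, x), (true, y)] [(true, y), (true, x)] [arrowOf c true true x y] 0 0 := by
    intro c hc x y
    exact .real c hc true true x y x y 0 0 0 0 (.keep _ rfl) (.keep _ rfl)
  have ne : ∀ i : ℕ, ρ i ≠ ρ (i + 1) := fun i e => by simpa using ρ.injective e
  have le : ∀ i : Fin n, (i : ℕ) ≤ n ∧ (i : ℕ) + 1 ≤ n := fun i => ⟨by omega, by omega⟩
  cases a with
  | tau i =>
    have hp : toPerm n (BraidDiagram.toBraid [Letter.tau i]) = swap (i : ℕ) (i + 1) := by
      rw [BraidDiagram.toBraid_tau, ← tu_fin, toPerm_tu i.2]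
    rw [hp]
    refine ⟨[], piece i _ _ (.virt _ _), swap_mem_Pm (le i).1 (le i).2, ?_⟩
    rw [BraidDiagram.toBraid_tau, ← tu_fin, vb_mul_tu i.2 hρ, wd_nil, one_mul]
  | sigma i =>
    have hp : toPerm n (BraidDiagram.toBraid [Letter.sigma i]) = swap (i : ℕ) (i + 1) := by
      rw [BraidDiagram.toBraid_sigma, ← sg_fin, toPerm_sg i.2]
    rw [hp]
    refine ⟨_, piece i _ _ (real .rightOver (by simp [Crossing.IsReal]) _ _),
      swap_mem_Pm (le i).1 (le i).2, ?_⟩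
    have h1 := arr_succ i.2
    have h2 := vb_arr hρ (le i).2 (le i).1 (Nat.succ_ne_self i)
    have h3 : sg n i = arr n (i + 1) i * tu n i := by
      rw [h1, mul_assoc, tu_tu, mul_one]
    rw [BraidDiagram.toBraid_sigma, ← sg_fin, h3, ← mul_assoc, h2, mul_assoc, vb_mul_tu i.2 hρ]
    simp [wd, arrowOf, Arrow.ev]
  | sigmaInv i =>
    have hp : toPerm n (BraidDiagram.toBraid [Letter.sigmaInv i]) = swap (i : ℕ) (i + 1) := by
      rw [BraidDiagram.toBraid_sigmaInv, ← sg_fin, map_inv, toPerm_sg i.2, Equiv.swap_inv]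
    rw [hp]
    refine ⟨_, piece i _ _ (real .leftOver (by simp [Crossing.IsReal]) _ _),
      swap_mem_Pm (le i).1 (le i).2, ?_⟩
    have h1 := arr_succ i.2
    have h2 := vb_arr (mul_mem hρ (swap_mem_Pm (le i).1 (le i).2)) (le i).2 (le i).1
      (Nat.succ_ne_self i)
    rw [Perm.mul_apply, Perm.mul_apply, Equiv.swap_apply_left, Equiv.swap_apply_right] at h2
    have h3 : (sg n i)⁻¹ = tu n i * (arr n (i + 1) i)⁻¹ := by
      rw [h1, mul_inv_rev, tu_inv, ← mul_assoc, tu_tu, one_mul]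
    rw [BraidDiagram.toBraid_sigmaInv, ← sg_fin, h3, ← mul_assoc, vb_mul_tu i.2 hρ]
    have h4 : SemiconjBy (vb n (ρ * swap (i : ℕ) (i + 1))) (arr n (i + 1) i)
      (arr n (ρ i) (ρ (i + 1))) := h2
    rw [h4.inv_right.eq]
    simp [wd, arrowOf, Arrow.ev]

/-- The crossings of a braid diagram keep their labels. -/
theorem lab_braid {n : ℕ} (w : BraidDiagram n) {ρ : Perm ℕ} (hρ : ρ ∈ Pm n)
    (U : List (Bool × ℕ)) : ∃ A, Lab false 0 (w.map Letter.toLayer) (downRow (n + 1) ρ ++ U)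
      (downRow (n + 1) (ρ * toPerm n w.toBraid : Perm ℕ) ++ U) A 0 0 ∧ toPerm n w.toBraid ∈ Pm n ∧
      vb n ρ * w.toBraid = wd n A * vb n (ρ * toPerm n w.toBraid) := by
  induction w generalizing ρ with
  | nil =>
    refine ⟨[], ?_, ?_, ?_⟩
    · rw [BraidDiagram.toBraid_nil, map_one, mul_one]
      exact .nil _
    · rw [BraidDiagram.toBraid_nil, map_one]
      exact one_mem _
    · rw [BraidDiagram.toBraid_nil, map_one, mul_one, mul_one, wd_nil, one_mul]
  | cons a w ih =>
    obtain ⟨A, h1, h2, h3⟩ := lab_letter a hρ U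
    obtain ⟨A', h4, h5, h6⟩ := ih (mul_mem hρ h2)
    have e := BraidDiagram.toBraid_cons a w
    refine ⟨A ++ A', ?_, ?_, ?_⟩
    · rw [e, map_mul, ← mul_assoc]
      exact h1 h4
    · rw [e, map_mul]
      exact mul_mem h2 h5
    · rw [e, map_mul, ← mul_assoc, h3, mul_assoc, h6, wd_append, ← mul_assoc, ← mul_assoc]

/-- The closure of a braid diagram presents its welded braid. -/
theorem presents_closure {n : ℕ} (w : BraidDiagram n) : Presents (closureLayers w) n w.toBraid := by
  obtain ⟨A, h1, h2, h3⟩ := lab_braid w (one_mem (Pm n)) (upRow (n + 1))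
  rw [one_mul] at h1 h3
  obtain ⟨G, h4, h5⟩ := lab_minima (n + 1) (toPerm n w.toBraid)
  have h := ((lab_maxima (n + 1)).append h1).append h4
  simp only [List.nil_append, List.append_nil, zero_add, add_zero] at h
  refine ⟨_, A, G, toPerm n w.toBraid, ⟨h, h2, ?_⟩, ?_⟩
  · intro p hp
    obtain ⟨k, -, rfl⟩ := h5 p hp
    rfl
  · rwa [vb_one, one_mul] at h3

/-- Diagrams with equivalent closures have related welded braids. -/
theorem braidsRelated_of_closure {n n' : ℕ} {w : BraidDiagram n} {w' : BraidDiagram n'}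
    (h : EquivalentAsWeldedLinks (closure w) (closure w')) :
    BraidsRelated ⟨n, w.toBraid⟩ ⟨n', w'.toBraid⟩ :=
  h.braidsRelated.2 _ _ _ _ (presents_closure w) (presents_closure w')

/-! ### Moves of closures -/

theorem LabPiece.step {f : Bool} {X : Type} {P : Piece} {i o : List (Bool × X)} {A : List (Arrow X)}
    {G : Multiset (X × X)} {N : Multiset X} (h : LabPiece f P i o A G N) (u v : List Bool) :
    Step ⟨u.length, P⟩ (u ++ i.map Prod.fst ++ v) (u ++ o.map Prod.fst ++ v) := by
  cases h with
  | maximum d y => simpa using Step.maximum u v d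
  | minimum d x y => simpa using Step.minimum u v d
  | virt p q => simpa using Step.crossing u v p.1 q.1 .virt
  | real c hc d e x y a b => simpa using Step.crossing u v d e c

theorem Lab.run {f : Bool} {X : Type} {k : ℕ} {w : List Layer} {B B' : List (Bool × X)}
    {A : List (Arrow X)} {G : Multiset (X × X)} {N : Multiset X} (h : Lab f k w B B' A G N) :
    Run w (B.map Prod.fst) (B'.map Prod.fst) := by
  induction h with
  | nil B => exact .nil _
  | cons h u v _ ih =>
    have := h.step (u.map Prod.fst) (v.map Prod.fst)
    rw [List.length_map, ← List.map_append, ← List.map_append, ← List.map_append,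
      ← List.map_append] at this
    exact .cons this ih
  | sub u v d x y _ ih => simpa using ih

/-- A local move `l → r` (not its inverse) is applied somewhere in a list of layers. -/
inductive Forward : List Layer → List Layer → Prop
  | intro (x y : List Layer) {l r : List Layer}
      (h : PlanarIsotopy l r ∨ VirtualReidemeister l r ∨ WMove l r) :
      Forward (x ++ l ++ y) (x ++ r ++ y)

theorem Run.split {x y : List Layer} {s t : List Bool} (h : Run (x ++ y) s t) :
    ∃ u, Run x s u ∧ Run y u t := by
  induction x generalizing s with
  | nil => exact ⟨s, .nil s, h⟩
  | cons L x ih =>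
    cases h with
    | cons h h' =>
      obtain ⟨u, h1, h2⟩ := ih h'
      exact ⟨u, .cons h h1, h2⟩

/-- A local move preserves the orientations of the strands: a labelling of the left side gives a
labelling of the right side, whose strands have orientations. -/
theorem Forward.run {w w' : List Layer} (h : Forward w w') (hw : Run w [] []) : Run w' [] [] := by
  obtain ⟨x, y, hm⟩ := h
  obtain ⟨t, h1, h3⟩ := hw.split
  obtain ⟨s, h1, h2⟩ := h1.split
  obtain ⟨B', A, G, N, hL, hB', -⟩ := exists_lab h2 (s.map fun d => (d, 0))
    (by simp [Function.comp_def]) 0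
  obtain ⟨k, A', hL', -⟩ := (carries_of_move hm).2 _ _ _ _ _ hL
  have := hL'.run
  rw [hB', List.map_map] at this
  simp only [Function.comp_def, List.map_id'] at this
  exact (h1.append this).append h3

/-- A sequence of local moves, none of which is inverted. -/
def Forwards : List Layer → List Layer → Prop := Relation.ReflTransGen Forward

theorem Forwards.equivalent {w w' : List Layer} (h : Forwards w w') (hw : Run w [] []) :
    ∃ hw' : Run w' [] [], EquivalentAsWeldedLinks ⟨w, hw⟩ ⟨w', hw'⟩ := by
  induction h with
  | refl => exact ⟨hw, .refl _⟩
  | @tail w₁ w₂ _ h ih =>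
    obtain ⟨hw₁, ih⟩ := ih
    have hw₂ := h.run hw₁
    refine ⟨hw₂, ih.trans _ _ _ (.rel _ _ ?_)⟩
    obtain ⟨x, y, hm⟩ := h
    exact ⟨x, y, _, _, hm, rfl, rfl⟩

theorem Forwards.trans {x y z : List Layer} (h : Forwards x y) (h' : Forwards y z) : Forwards x z :=
  Relation.ReflTransGen.trans h h'

theorem Forwards.context {w w' : List Layer} (h : Forwards w w') (x y : List Layer) :
    Forwards (x ++ w ++ y) (x ++ w' ++ y) := by
  induction h with
  | refl => exact .refl
  | tail _ h ih =>
    refine ih.tail ?_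
    obtain ⟨x', y', hm⟩ := h
    have := Forward.intro (x ++ x') (y' ++ y) hm
    simpa using this

theorem Forwards.of_isotopy {l r : List Layer} (h : PlanarIsotopy l r) : Forwards l r := by
  have := Forward.intro [] [] (Or.inl h)
  rw [List.nil_append, List.nil_append, List.append_nil, List.append_nil] at this
  exact .single this

theorem forwards_exchange {p q q' : ℕ} {P Q : Piece} (hq : p + P.outputs ≤ q)
    (h : q' + P.outputs = q + P.inputs) : Forwards [⟨p, P⟩, ⟨q, Q⟩] [⟨q', Q⟩, ⟨p, P⟩] := by
  obtain ⟨k, rfl⟩ := Nat.exists_eq_add_of_le hq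
  obtain rfl : q' = p + P.inputs + k := by omega
  exact .of_isotopy (.exchange p k P Q)

theorem Crossing.swap_swap (c : Crossing) : c.swap.swap = c := by cases c <;> rfl

/-- The maxima of a closure. -/
def maxima (m : ℕ) : List Layer := (List.range m).map fun k => mx k true

/-- The minima of a closure. -/
def minima (m : ℕ) : List Layer := (List.range m).reverse.map fun k => mn k

theorem maxima_succ (m : ℕ) : maxima (m + 1) = maxima m ++ [mx m true] := by
  simp [maxima, List.range_succ]

theorem minima_succ (m : ℕ) : minima (m + 1) = mn m :: minima m := by
  simp [minima, List.range_succ]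

theorem closureLayers_eq {n : ℕ} (w : BraidDiagram n) :
    closureLayers w = maxima (n + 1) ++ w.map Letter.toLayer ++ minima (n + 1) := rfl

/-- A crossing of the returning strands slides through the maxima. -/
theorem forwards_maxima (i j : ℕ) (c : Crossing) :
    Forwards (maxima (i + 2 + j) ++ [cr (i + 2 + 2 * j) c]) (maxima (i + 2 + j) ++ [cr i c]) := by
  induction j with
  | zero =>
    have s1 := Forwards.context (.of_isotopy (.maximum_slide (i + 1) true c)) (maxima (i + 1)) []
    have s2 := Forwards.context (forwards_exchange (P := .maximum true) (Q := .maximum true)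
      (le_refl (i + 2)) rfl) (maxima i) [cr (i + 1) c.swap]
    have s3 := Forwards.context (.of_isotopy (.maximum_slide i true c.swap))
      (maxima i ++ [mx i true]) []
    rw [Crossing.swap_swap] at s3
    rw [add_zero, mul_zero, add_zero, maxima_succ, maxima_succ]
    rw [maxima_succ] at s1
    simp only [List.append_assoc, List.cons_append, List.nil_append, List.append_nil] at s1 s2 s3 ⊢
    exact s1.trans (s2.trans s3)
  | succ j ih =>
    have s1 := Forwards.context (forwards_exchange (p := i + 2 + j) (P := .maximum true)
      (Q := .crossing c) (q := i + 2 + 2 * (j + 1)) (q' := i + 2 + 2 * j)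
      (by simp only [Piece.outputs]; omega) (by simp only [Piece.outputs, Piece.inputs]; omega))
      (maxima (i + 2 + j)) []
    have s2 := Forwards.context ih [] [mx (i + 2 + j) true]
    have s3 := Forwards.context (forwards_exchange (p := i) (P := .crossing c) (Q := .maximum true)
      (q := i + 2 + j) (q' := i + 2 + j) (by simp only [Piece.outputs]; omega) rfl)
      (maxima (i + 2 + j)) []
    rw [← add_assoc, maxima_succ]
    simp only [List.append_assoc, List.cons_append, List.nil_append, List.append_nil] at s1 s2 s3 ⊢
    exact s1.trans (s2.trans s3)

/-- A crossing of a closed braid slides through the minima. -/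
theorem forwards_minima (i j : ℕ) (c : Crossing) :
    Forwards (cr i c :: minima (i + 2 + j)) (cr (i + 2 + 2 * j) c :: minima (i + 2 + j)) := by
  induction j with
  | zero =>
    have s1 := Forwards.context (.of_isotopy (.minimum_slide i c)) [] (minima (i + 1))
    have s2 := Forwards.context (forwards_exchange (P := .minimum) (Q := .minimum) (le_refl i)
      (rfl : i + 2 + 0 = i + 2)) [cr (i + 1) c.swap] (minima i)
    have s3 := Forwards.context (.of_isotopy (.minimum_slide (i + 1) c.swap)) [] (minima (i + 1))
    rw [Crossing.swap_swap] at s3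
    rw [add_zero, mul_zero, add_zero, minima_succ, minima_succ]
    rw [minima_succ] at s1 s3
    simp only [List.cons_append, List.nil_append] at s1 s2 s3 ⊢
    exact s1.trans (s2.trans s3)
  | succ j ih =>
    have s1 := Forwards.context (forwards_exchange (p := i) (P := .crossing c) (Q := .minimum)
      (q := i + 2 + j) (q' := i + 2 + j) (by simp only [Piece.outputs]; omega) rfl)
      [] (minima (i + 2 + j))
    have s2 := Forwards.context ih [mn (i + 2 + j)] []
    have s3 := Forwards.context (forwards_exchange (p := i + 2 + j) (P := .minimum)
      (Q := .crossing c) (q := i + 2 + 2 * j) (q' := i + 2 + 2 * (j + 1))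
      (by simp only [Piece.outputs]; omega) (by simp only [Piece.outputs, Piece.inputs]; omega))
      [] (minima (i + 2 + j))
    rw [← add_assoc, minima_succ]
    simp only [List.cons_append, List.nil_append, List.append_nil] at s1 s2 s3 ⊢
    exact s1.trans (s2.trans s3)

theorem Letter.exists_toLayer {n : ℕ} (a : Letter n) : ∃ i < n, ∃ c, a.toLayer = cr i c := by
  cases a with
  | sigma i => exact ⟨i, i.2, _, rfl⟩
  | sigmaInv i => exact ⟨i, i.2, _, rfl⟩
  | tau i => exact ⟨i, i.2, _, rfl⟩

/-- Pieces to the right of a braid are moved to its top. -/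
theorem forwards_braid_left {n q : ℕ} {Q : Piece} (hq : n < q) (w : BraidDiagram n) :
    Forwards (w.map Letter.toLayer ++ [⟨q, Q⟩]) (⟨q, Q⟩ :: w.map Letter.toLayer) := by
  induction w with
  | nil => exact .refl
  | cons a w ih =>
    obtain ⟨i, hi, c, hc⟩ := a.exists_toLayer
    have s1 := ih.context [a.toLayer] []
    have s2 := Forwards.context (forwards_exchange (p := i) (P := .crossing c) (Q := Q) (q := q)
      (q' := q) (by simp only [Piece.outputs]; omega) rfl) [] (w.map Letter.toLayer)
    rw [List.map_cons]
    rw [hc] at s1 ⊢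
    simp only [List.cons_append, List.nil_append, List.append_nil] at s1 s2 ⊢
    exact s1.trans s2

/-- The last crossing of a closed braid is moved to its top. -/
theorem closure_rotate {n : ℕ} (a : Letter n) (w : BraidDiagram n) :
    EquivalentAsWeldedLinks (closure (w ++ [a])) (closure (a :: w)) := by
  obtain ⟨i, hi, c, hc⟩ := a.exists_toLayer
  obtain ⟨j, rfl⟩ := Nat.exists_eq_add_of_lt hi
  have e : i + j + 1 + 1 = i + 2 + j := by omega
  have s1 := (forwards_minima i j c).context (maxima (i + 2 + j) ++ w.map Letter.toLayer) []
  have s2 := (forwards_braid_left (q := i + 2 + 2 * j) (Q := .crossing c) (by omega) w).context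
    (maxima (i + 2 + j)) (minima (i + 2 + j))
  have s3 := (forwards_maxima i j c).context [] (w.map Letter.toLayer ++ minima (i + 2 + j))
  have key : Forwards (closureLayers (w ++ [a])) (closureLayers (a :: w)) := by
    rw [closureLayers_eq, closureLayers_eq, List.map_append, List.map_cons, List.map_cons,
      List.map_nil, hc, e]
    simp only [List.append_assoc, List.cons_append, List.nil_append, List.append_nil] at s1 s2 s3 ⊢
    exact s1.trans (s2.trans s3)
  exact (key.equivalent (closure (w ++ [a])).closed).2

theorem closure_comm {n : ℕ} (x y : BraidDiagram n) :
    EquivalentAsWeldedLinks (closure (x ++ y)) (closure (y ++ x)) := by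
  induction y using List.reverseRecOn generalizing x with
  | nil => rw [List.append_nil, List.nil_append]; exact .refl _
  | append_singleton y a ih =>
    rw [← List.append_assoc, List.append_assoc y]
    exact (closure_rotate a (x ++ y)).trans _ _ _ (ih (a :: x))

theorem closure_relation {n : ℕ} (x y : BraidDiagram n) {l r : BraidDiagram n}
    (h : BraidRelation n l r) :
    EquivalentAsWeldedLinks (closure (x ++ l ++ y)) (closure (x ++ r ++ y)) := by
  have key : ∀ l r : BraidDiagram n, Forwards (l.map Letter.toLayer) (r.map Letter.toLayer) →
      EquivalentAsWeldedLinks (closure (x ++ l ++ y)) (closure (x ++ r ++ y)) := by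
    intro l r h
    have := h.context (maxima (n + 1) ++ x.map Letter.toLayer)
      (y.map Letter.toLayer ++ minima (n + 1))
    have e : ∀ l : BraidDiagram n, closureLayers (x ++ l ++ y) =
        maxima (n + 1) ++ x.map Letter.toLayer ++ l.map Letter.toLayer ++
          (y.map Letter.toLayer ++ minima (n + 1)) := by
      intro l; rw [closureLayers_eq]; simp
    rw [← e, ← e] at this
    exact (this.equivalent (closure (x ++ l ++ y)).closed).2
  have move : ∀ {l r : List Layer}, VirtualReidemeister l r ∨ WMove l r → Forwards l r := by
    intro l r h
    have := Forward.intro [] [] (Or.inr h)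
    rw [List.nil_append, List.nil_append, List.append_nil, List.append_nil] at this
    exact .single this
  have comm : ∀ (a b : Letter n) (i j : Fin n) (c d : Crossing), a.toLayer = cr i c →
      b.toLayer = cr j d → ((i : ℕ) + 1 < j ∨ (j : ℕ) + 1 < i) →
      EquivalentAsWeldedLinks (closure (x ++ [a, b] ++ y)) (closure (x ++ [b, a] ++ y)) := by
    intro a b i j c d ha hb hij
    rcases hij with hij | hij
    · refine key _ _ ?_
      simp only [List.map_cons, List.map_nil]
      rw [ha, hb]
      exact forwards_exchange (by simp only [Piece.outputs]; omega) rfl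
    · refine Relation.EqvGen.symm _ _ (key _ _ ?_)
      simp only [List.map_cons, List.map_nil]
      rw [ha, hb]
      exact forwards_exchange (by simp only [Piece.outputs]; omega) rfl
  cases h with
  | sigma_sigmaInv i => exact key _ _ (move (Or.inl (.two i .rightOver)))
  | sigmaInv_sigma i => exact key _ _ (move (Or.inl (.two i .leftOver)))
  | tau_tau i => exact key _ _ (move (Or.inl (.two i .virt)))
  | sigma_comm i j h => exact comm _ _ i j _ _ rfl rfl h
  | tau_comm i j h => exact comm _ _ i j _ _ rfl rfl h
  | mixed_comm i j h => exact comm _ _ i j _ _ rfl rfl h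
  | sigma_braid i j h =>
    refine key _ _ ?_
    simp only [List.map_cons, List.map_nil, Letter.toLayer, h]
    refine move (Or.inl (.three _ _ _ _ (.real _ _ _ ?_ ?_ ?_ ?_ ?_))) <;> simp [Crossing.IsReal]
  | tau_braid i j h =>
    refine key _ _ ?_
    simp only [List.map_cons, List.map_nil, Letter.toLayer, h]
    exact move (Or.inl (.three _ _ _ _ .virt))
  | mixed_braid i j h =>
    refine key _ _ ?_
    simp only [List.map_cons, List.map_nil, Letter.toLayer, h]
    refine move (Or.inl (.three _ _ _ _ (.mixed₃ _ ?_)))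
    simp [Crossing.IsReal]
  | welded i j h =>
    refine key _ _ ?_
    simp only [List.map_cons, List.map_nil, Letter.toLayer, h]
    exact move (Or.inr (.w _ _ _ _ .over₃))

theorem closure_cancel {n : ℕ} (x v : BraidDiagram n) :
    EquivalentAsWeldedLinks (closure (v ++ v.inv ++ x)) (closure x) := by
  induction v using List.reverseRecOn with
  | nil => exact .refl _
  | append_singleton v a ih =>
    refine Relation.EqvGen.trans _ _ _ ?_ ih
    have e : (v ++ [a]) ++ BraidDiagram.inv (v ++ [a]) ++ x =
        v ++ [a, a.inv] ++ (BraidDiagram.inv v ++ x) := by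
      simp [BraidDiagram.inv]
    have e' : v ++ BraidDiagram.inv v ++ x = v ++ [] ++ (BraidDiagram.inv v ++ x) := by simp
    rw [e, e']
    cases a with
    | sigma i => exact closure_relation _ _ (.sigma_sigmaInv i)
    | sigmaInv i => exact closure_relation _ _ (.sigmaInv_sigma i)
    | tau i => exact closure_relation _ _ (.tau_tau i)

theorem map_addRight_toLayer {n : ℕ} (w : BraidDiagram n) :
    w.addRight.map Letter.toLayer = w.map Letter.toLayer := by
  rw [BraidDiagram.addRight, List.map_map]
  refine List.map_congr_left fun a _ => ?_
  cases a <;> rfl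

/-- A stabilization adds a kink to the last strand of the closed braid. Both closures arise by
forward moves from the diagram in which the kink is below the braid, as a maximum, a crossing and a
minimum. -/
theorem closure_stab {n : ℕ} (w : BraidDiagram n) {a : Letter (n + 1)} {c : Crossing}
    (ha : a.toLayer = cr n c) :
    EquivalentAsWeldedLinks (closure w) (closure (w.addRight ++ [a])) := by
  have hk : Run [mx (n + 1) true, cr n c, mn (n + 1)]
      (List.replicate (n + 1) true ++ List.replicate (n + 1) false)
      (List.replicate (n + 1) true ++ List.replicate (n + 1) false) := by
    have s1 := Step.maximum (List.replicate n true ++ [true]) (List.replicate (n + 1) false) true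
    have s2 := Step.crossing (List.replicate n true) (false :: List.replicate (n + 1) false) true
      true c
    have s3 := Step.minimum (List.replicate n true ++ [true]) (List.replicate (n + 1) false) true
    rw [List.length_append, List.length_replicate, List.length_singleton] at s1 s3
    rw [List.length_replicate] at s2
    rw [List.replicate_succ' (n := n) (a := true)]
    simp only [List.append_assoc, List.cons_append, List.nil_append, Bool.not_true] at s1 s2 s3 ⊢
    exact .cons s1 (.cons s2 (.cons s3 (.nil _)))
  have hrun := (((run_maxima (n + 1)).append (run_braid w _)).append hk).append (run_minima (n + 1))
  have f1 : Forwards (maxima (n + 1) ++ w.map Letter.toLayer ++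
      [mx (n + 1) true, cr n c, mn (n + 1)] ++ minima (n + 1)) (closureLayers w) := by
    have := Forward.intro (maxima (n + 1) ++ w.map Letter.toLayer) (minima (n + 1))
      (Or.inr (Or.inl (.one_right n true c)))
    rw [closureLayers_eq]
    rw [List.append_nil] at this
    exact .single this
  have f2 : Forwards (maxima (n + 1) ++ w.map Letter.toLayer ++
      [mx (n + 1) true, cr n c, mn (n + 1)] ++ minima (n + 1))
      (closureLayers (w.addRight ++ [a])) := by
    have := (forwards_braid_left (q := n + 1) (Q := .maximum true) (Nat.lt_succ_self n) w).context
      (maxima (n + 1)) ([cr n c, mn (n + 1)] ++ minima (n + 1))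
    rw [closureLayers_eq, List.map_append, map_addRight_toLayer, maxima_succ (n + 1),
      minima_succ (n + 1), List.map_singleton, ha]
    simpa using this
  exact (Relation.EqvGen.symm _ _ (f1.equivalent hrun).2).trans _ _ _ (f2.equivalent hrun).2

/-- Related braid diagrams have equivalent closures. -/
theorem DiagramsRelated.closure {p q : Σ n, BraidDiagram n} (h : DiagramsRelated p q) :
    EquivalentAsWeldedLinks (Welded.closure p.2) (Welded.closure q.2) := by
  induction h with
  | refl => exact .refl _
  | symm _ _ _ ih => exact .symm _ _ ih
  | trans _ _ _ _ _ ih ih' => exact ih.trans _ _ _ ih'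
  | rel p q h =>
    cases h with
    | braid x y l r h => exact closure_relation x y h
    | conj w v =>
      have s := closure_comm v (v.inv ++ w)
      rw [← List.append_assoc] at s
      exact .symm _ _ ((Relation.EqvGen.symm _ _ s).trans _ _ _ (closure_cancel w v))
    | stab_pos w => exact closure_stab w rfl
    | stab_neg w => exact closure_stab w rfl
    | stab_virt w => exact closure_stab w rfl

/-! ### Words that represent the same welded braid -/

/-- The monoid of braid diagrams modulo the defining relations. -/
def diagramCon (n : ℕ) : Con (FreeMonoid (Letter n)) := conGen (BraidRelation n)

/-- Congruent words are related by replacements inside any longer word. -/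
theorem diagramsRelated_of_rel {n : ℕ} {l r : BraidDiagram n}
    (h : ConGen.Rel (M := FreeMonoid (Letter n)) (BraidRelation n) l r) (x y : BraidDiagram n) :
    DiagramsRelated ⟨n, x ++ l ++ y⟩ ⟨n, x ++ r ++ y⟩ := by
  induction h generalizing x y with
  | of l r h => exact .rel _ _ (.braid x y l r h)
  | refl => exact .refl _
  | symm _ ih => exact .symm _ _ (ih x y)
  | trans _ _ ih ih' => exact (ih x y).trans _ _ _ (ih' x y)
  | @mul a b c d _ _ ih ih' =>
    have h1 := ih x (c ++ y)
    have h2 := ih' (x ++ b) y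
    change DiagramsRelated ⟨n, x ++ (a ++ c) ++ y⟩ ⟨n, x ++ (b ++ d) ++ y⟩
    simp only [List.append_assoc] at h1 h2 ⊢
    exact h1.trans _ _ _ h2

theorem diagramCon_letter {n : ℕ} (a : Letter n) :
    diagramCon n (FreeMonoid.of a * FreeMonoid.of a.inv) 1 := by
  cases a with
  | sigma i => exact .of _ _ (.sigma_sigmaInv i)
  | sigmaInv i => exact .of _ _ (.sigmaInv_sigma i)
  | tau i => exact .of _ _ (.tau_tau i)

theorem Letter.inv_inv {n : ℕ} (a : Letter n) : a.inv.inv = a := by cases a <;> rfl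

/-- The invertible class of a letter. -/
def letterUnit {n : ℕ} (a : Letter n) : (diagramCon n).Quotientˣ where
  val := (FreeMonoid.of a : FreeMonoid (Letter n))
  inv := (FreeMonoid.of a.inv : FreeMonoid (Letter n))
  val_inv := (Con.eq _).mpr (diagramCon_letter a)
  inv_val := by
    have := (Con.eq _).mpr (diagramCon_letter a.inv)
    rwa [Letter.inv_inv] at this

/-- The classes of the generators. -/
def generatorUnit {n : ℕ} : Generator n → (diagramCon n).Quotientˣ
  | .sigma i => letterUnit (.sigma i)
  | .tau i => letterUnit (.tau i)

/-- The class of a braid diagram. -/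
def diagramClass {n : ℕ} (w : BraidDiagram n) : (diagramCon n).Quotient :=
  ((show FreeMonoid (Letter n) from w) : FreeMonoid (Letter n))

theorem lift_toFree_eq {n : ℕ} (w : BraidDiagram n) :
    ((FreeGroup.lift generatorUnit w.toFree : (diagramCon n).Quotientˣ) : (diagramCon n).Quotient) =
      diagramClass w := by
  induction w with
  | nil => rfl
  | cons a w ih =>
    have e : BraidDiagram.toFree (a :: w) = a.toFree * BraidDiagram.toFree w := by
      simp [BraidDiagram.toFree]
    have e' : diagramClass (a :: w) = (letterUnit a : (diagramCon n).Quotient) * diagramClass w :=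
      rfl
    rw [e, map_mul, Units.val_mul, ih, e']
    congr 1
    cases a with
    | sigma i => rw [Letter.toFree, FreeGroup.lift_apply_of]; rfl
    | sigmaInv i => rw [Letter.toFree, map_inv, FreeGroup.lift_apply_of]; rfl
    | tau i => rw [Letter.toFree, FreeGroup.lift_apply_of]; rfl

/-- Diagrams that represent the same welded braid are related by welded braid moves. -/
theorem diagramsRelated_of_toBraid_eq {n : ℕ} {w w' : BraidDiagram n} (h : w.toBraid = w'.toBraid) :
    DiagramsRelated ⟨n, w⟩ ⟨n, w'⟩ := by
  let f : WeldedBraid n →* (diagramCon n).Quotientˣ :=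
    PresentedGroup.toGroup (f := generatorUnit) (by
    rintro _ ⟨l, r, h, rfl⟩
    rw [map_mul, map_inv, mul_inv_eq_one]
    ext
    rw [lift_toFree_eq, lift_toFree_eq]
    exact (Con.eq _).mpr (.of _ _ h))
  have key : ∀ w : BraidDiagram n, (f w.toBraid : (diagramCon n).Quotient) = diagramClass w :=
    lift_toFree_eq
  have h1 : diagramClass w = diagramClass w' := by rw [← key, ← key, h]
  have := diagramsRelated_of_rel ((Con.eq _).mp h1) [] []
  simpa using this

theorem toBraid_surjective {n : ℕ} (b : WeldedBraid n) : ∃ w : BraidDiagram n, w.toBraid = b := by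
  obtain ⟨g, rfl⟩ := PresentedGroup.mk_surjective (relators n) b
  induction g using FreeGroup.induction_on with
  | C1 => exact ⟨[], BraidDiagram.toBraid_nil⟩
  | of a =>
    cases a with
    | sigma i => exact ⟨[.sigma i], BraidDiagram.toBraid_sigma i⟩
    | tau i => exact ⟨[.tau i], BraidDiagram.toBraid_tau i⟩
  | inv_of a _ =>
    rw [map_inv]
    cases a with
    | sigma i => exact ⟨[.sigmaInv i], BraidDiagram.toBraid_sigmaInv i⟩
    | tau i =>
      refine ⟨[.tau i], ?_⟩
      rw [BraidDiagram.toBraid_tau, ← tu_fin, ← tu_inv, tu_fin]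
      rfl
  | mul x y hx hy =>
    obtain ⟨v, hv⟩ := hx
    obtain ⟨w, hw⟩ := hy
    exact ⟨v ++ w, by rw [BraidDiagram.toBraid_append, hv, hw, map_mul]⟩

theorem toBraid_inv {n : ℕ} (v : BraidDiagram n) : v.inv.toBraid = v.toBraid⁻¹ := by
  rw [eq_inv_iff_mul_eq_one]
  induction v with
  | nil => rw [BraidDiagram.toBraid_nil, mul_one]; rfl
  | cons a v ih =>
    have e : BraidDiagram.inv (a :: v) = BraidDiagram.inv v ++ [a.inv] := by simp [BraidDiagram.inv]
    have ha : BraidDiagram.toBraid [a.inv] * BraidDiagram.toBraid [a] = 1 := by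
      cases a with
      | sigma i => rw [Letter.inv, BraidDiagram.toBraid_sigma, BraidDiagram.toBraid_sigmaInv,
          inv_mul_cancel]
      | sigmaInv i => rw [Letter.inv, BraidDiagram.toBraid_sigma, BraidDiagram.toBraid_sigmaInv,
          mul_inv_cancel]
      | tau i => rw [Letter.inv, BraidDiagram.toBraid_tau, ← tu_fin, tu_tu]
    rw [e, BraidDiagram.toBraid_append, BraidDiagram.toBraid_cons a v, mul_assoc,
      ← mul_assoc (BraidDiagram.toBraid [a.inv]), ha, one_mul, ih]

theorem toBraid_addRight {n : ℕ} (w : BraidDiagram n) :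
    w.addRight.toBraid = WeldedBraid.addRight w.toBraid :=
  (BraidDiagram.lift_toFree w).symm

/-- Diagrams of related welded braids are related. -/
theorem BraidsRelated.diagramsRelated {p q : Σ n, WeldedBraid n} (h : BraidsRelated p q)
    (w : BraidDiagram p.1) (w' : BraidDiagram q.1) (hw : w.toBraid = p.2) (hw' : w'.toBraid = q.2) :
    DiagramsRelated ⟨p.1, w⟩ ⟨q.1, w'⟩ := by
  induction h with
  | refl p => exact diagramsRelated_of_toBraid_eq (hw.trans hw'.symm)
  | symm _ _ _ ih => exact .symm _ _ (ih w' w hw' hw)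
  | trans p q r _ _ ih ih' =>
    obtain ⟨v, hv⟩ := toBraid_surjective q.2
    exact (ih w v hw hv).trans _ _ _ (ih' v w' hv hw')
  | rel p q h =>
    cases h with
    | @conj n b c =>
      obtain ⟨v, rfl⟩ := toBraid_surjective c
      refine .trans _ _ _ (.rel _ _ (.conj w v)) (diagramsRelated_of_toBraid_eq ?_)
      rw [hw', BraidDiagram.toBraid_append, BraidDiagram.toBraid_append, toBraid_inv, hw]
    | stab_pos b =>
      refine .trans _ _ _ (.rel _ _ (.stab_pos w)) (diagramsRelated_of_toBraid_eq ?_)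
      rw [hw', BraidDiagram.toBraid_append, toBraid_addRight, hw, BraidDiagram.toBraid_sigma]
    | stab_neg b =>
      refine .trans _ _ _ (.rel _ _ (.stab_neg w)) (diagramsRelated_of_toBraid_eq ?_)
      rw [hw', BraidDiagram.toBraid_append, toBraid_addRight, hw, BraidDiagram.toBraid_sigmaInv]
    | stab_virt b =>
      refine .trans _ _ _ (.rel _ _ (.stab_virt w)) (diagramsRelated_of_toBraid_eq ?_)
      rw [hw', BraidDiagram.toBraid_append, toBraid_addRight, hw, BraidDiagram.toBraid_tau]

end Welded

/-- Markov theorem for welded links.  The first part is about welded braids (elements of the welded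
braid groups, given by arbitrary representing diagrams), the second part about welded braid
diagrams. -/
theorem theorem7p2 :
    (∀ (n n' : ℕ) (b : Welded.WeldedBraid n) (b' : Welded.WeldedBraid n')
        (w : Welded.BraidDiagram n) (w' : Welded.BraidDiagram n'),
        w.toBraid = b → w'.toBraid = b' →
        (Welded.EquivalentAsWeldedLinks (Welded.closure w) (Welded.closure w') ↔
          Welded.BraidsRelated ⟨n, b⟩ ⟨n', b'⟩)) ∧
    (∀ (n n' : ℕ) (w : Welded.BraidDiagram n) (w' : Welded.BraidDiagram n'),
        Welded.EquivalentAsWeldedLinks (Welded.closure w) (Welded.closure w') ↔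
          Welded.DiagramsRelated ⟨n, w⟩ ⟨n', w'⟩) := by
  refine ⟨?_, fun n n' w w' => ⟨fun h => ?_, fun h => h.closure⟩⟩
  · rintro n n' _ _ w w' rfl rfl
    exact ⟨Welded.braidsRelated_of_closure, fun h => (h.diagramsRelated w w' rfl rfl).closure⟩
  · exact (Welded.braidsRelated_of_closure h).diagramsRelated w w' rfl rfl
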